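/- Let $M$ be a smooth (Hausdorff) Lorentzian manifold of dimension $m$ with metric $\langle\cdot,\cdot\rangle$ and Levi-Civita connection $\nabla$, carrying two commuting Killing fields $\mathcal K_t,\mathcal K_\varphi$ with $\mathcal G=\det(\mathcal G_{\alpha\beta})<0$ everywhere, where $\mathcal G_{\alpha\beta}=\langle\mathcal K_\alpha,\mathcal K_\beta\rangle$, and such that $\mathcal K_t$ is complete, i.e. generates a one-parameter group of isometries (time translations). Fix $\rho\in\mathbb R$ and put $\rho^\alpha=(\rho,1)$, $\hat\rho=\rho^\alpha\mathcal K_\alpha=\rho\mathcal K_t+\mathcal K_\varphi$ and $\hat\tau=\tau^\alpha\mathcal K_\alpha$ with $\tau^\alpha=\mathcal G^{\alpha\lambda}\epsilon_{\lambda\beta}\rho^\beta$, where $\epsilon$ is the two-dimensional Levi-Civita tensor. Assume $\nabla_{\hat\rho}\hat\rho\neq0$ at every point where $\langle\hat\rho,\hat\rho\rangle=0$. Let $\mathcal C$ be a causal region, i.e. a connected component of $\{\langle\hat\rho,\hat\rho\rangle\ge0\}$, with boundary $\partial\mathcal C=\mathcal C\cap\{\langle\hat\rho,\hat\rho\rangle=0\}$.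 Let $S\subset\mathcal C$ be a fundamental photon submanifold, i.e. an embedded $n$-dimensional submanifold of $M$, possibly with boundary, with Lorentzian induced metric, such that 1. $S$ is invariant: $\mathcal K_t,\mathcal K_\varphi$ and $[\mathcal K_\alpha,\mathcal K_\beta]$ are tangent to $S$; 2. $S$ has a compact spatial section: $S$ is mapped to itself by the time translations, and there is an embedded spacelike hypersurface $\Sigma$ of $M$ such that $S\cap\Sigma$ is compact and every orbit of $\mathcal K_t$ in $S$ meets $\Sigma$; 3. $\partial S\subset\partial\mathcal C$; 4. at each point of $S$ there is a normal vector $\mathrm H\in TS^\perp$ such that the second fundamental form satisfies, for all $a,b\in TS$ orthogonal to $\mathcal K_t$ and $\mathcal K_\varphi$, and all normal vectors $\xi$, $$\mathrm{II}(\mathcal K_\alpha,\mathcal K_\beta)=-\tfrac12\nabla^\perp\mathcal G_{\alpha\beta},\qquad \langle\mathrm{II}(\mathcal K_\alpha,a),\xi\rangle=-\langle\nabla_\xi\mathcal K_\alpha,a\rangle,\qquad \mathrm{II}(a,b)=\langle a,b\rangle\,\mathrm H,\qquad \mathrm{II}(\hat\tau,a)=0,$$ and the master equation $\rho^\alpha\mathcal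 M_{\alpha\beta}\rho^\beta=0$ holds, where $\mathcal M_{\alpha\beta}=\tfrac12\nabla^\perp(\mathcal G^{-1}\mathcal G_{\alpha\beta})-\mathcal G^{-1}\mathcal G_{\alpha\beta}\mathrm H$ and $\nabla^\perp$ is the normal part of the gradient (the inequality $\langle\hat\rho,\hat\rho\rangle\ge0$ on $S$ is part of $S\subset\mathcal C$). Let $\gamma:J\to M$ be an affinely parametrized null geodesic on an open interval $J$ with energy $-\langle\mathcal K_t,\dot\gamma\rangle\neq0$ and impact parameter $\rho=-\langle\mathcal K_\varphi,\dot\gamma\rangle/\langle\mathcal K_t,\dot\gamma\rangle$. If $\gamma$ touches $S$ at some time $t_0\in J$, i.e. $\gamma(t_0)\in S$ and $\dot\gamma(t_0)\in T_{\gamma(t_0)}S$, then $\gamma(J)\subset S$. -/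

import Mathlib

open scoped Manifold ContDiff Topology

noncomputable section

namespace PhotonSubmanifold

/-- A symmetric bilinear form of Lorentzian signature `(-, +, …, +)`: it is negative on some vector
and positive definite on the orthogonal complement of that vector. -/
def IsLorentzForm {V : Type*} [AddCommGroup V] [Module ℝ V] (b : V → V → ℝ) : Prop :=
  (∀ v w, b v w = b w v) ∧ ∃ v, b v v < 0 ∧ ∀ w, w ≠ 0 → b v w = 0 → 0 < b w w

section Ambient

variable {m : ℕ} {M : Type*} [TopologicalSpace M] [ChartedSpace (EuclideanSpace ℝ (Fin m)) M]
  [IsManifold (𝓡 m) ∞ M]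

variable (m M) in
/-- A smooth Lorentzian metric on the manifold `M` of dimension `m`. -/
structure LorentzMetric where
  /-- The scalar product on the tangent space at `p`. -/
  inner (p : M) : TangentSpace (𝓡 m) p →L[ℝ] TangentSpace (𝓡 m) p →L[ℝ] ℝ
  lorentz (p : M) : IsLorentzForm (fun v w : TangentSpace (𝓡 m) p => inner p v w)
  contMDiff : ContMDiff (𝓡 m)
    ((𝓡 m).prod 𝓘(ℝ, EuclideanSpace ℝ (Fin m) →L[ℝ] EuclideanSpace ℝ (Fin m) →L[ℝ] ℝ)) ∞
    (fun p : M => Bundle.TotalSpace.mk'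
      (EuclideanSpace ℝ (Fin m) →L[ℝ] EuclideanSpace ℝ (Fin m) →L[ℝ] ℝ) p (inner p))

variable (m M) in
/-- Vector fields on `M` (smoothness is a separate condition). -/
abbrev VField := (p : M) → TangentSpace (𝓡 m) p

variable (g : LorentzMetric m M)

/-! ### The Levi-Civita connection in coordinates

A chart is a member `e` of the maximal smooth atlas. Vectors that result from a covariant
differentiation are described by their scalar products with all vectors `w`. This loses nothing,
because the metric is nondegenerate. -/

/-- The coefficients of the metric in the chart `e`, as a bilinear form depending on the coordinate
point `x`. -/
def coordMetric (e : OpenPartialHomeomorph M (EuclideanSpace ℝ (Fin m)))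
    (x : EuclideanSpace ℝ (Fin m)) :
    EuclideanSpace ℝ (Fin m) →L[ℝ] EuclideanSpace ℝ (Fin m) →L[ℝ] ℝ :=
  let b : EuclideanSpace ℝ (Fin m) →L[ℝ] EuclideanSpace ℝ (Fin m) →L[ℝ] ℝ := g.inner (e.symm x)
  let A : EuclideanSpace ℝ (Fin m) →L[ℝ] EuclideanSpace ℝ (Fin m) :=
    mfderiv (𝓡 m) (𝓡 m) e.symm x
  b.bilinearComp A A

/-- The components of a vector field in the chart `e`. -/
def coordField (X : VField m M) (e : OpenPartialHomeomorph M (EuclideanSpace ℝ (Fin m)))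
    (x : EuclideanSpace ℝ (Fin m)) : EuclideanSpace ℝ (Fin m) :=
  mfderiv (𝓡 m) (𝓡 m) e (e.symm x) (X (e.symm x))

/-- Christoffel symbols of the first kind in the chart `e`:
`Γ(u, v; w) = (∂_u g(v, w) + ∂_v g(u, w) - ∂_w g(u, v)) / 2`. -/
def christoffel (e : OpenPartialHomeomorph M (EuclideanSpace ℝ (Fin m)))
    (x u v w : EuclideanSpace ℝ (Fin m)) : ℝ :=
  (fderiv ℝ (coordMetric g e) x u v w + fderiv ℝ (coordMetric g e) x v u w
    - fderiv ℝ (coordMetric g e) x w u v) / 2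

/-- The scalar product `⟨∇_u X, w⟩` at `p`, for the Levi-Civita connection `∇`, computed in the
preferred chart at `p`. -/
def covDeriv (X : VField m M) (p : M) (u w : TangentSpace (𝓡 m) p) : ℝ :=
  let e := chartAt (EuclideanSpace ℝ (Fin m)) p
  let d := mfderiv (𝓡 m) (𝓡 m) e p
  coordMetric g e (e p) (fderiv ℝ (coordField X e) (e p) (d u)) (d w)
    + christoffel g e (e p) (d u) (coordField X e (e p)) (d w)

/-- `X` is a (smooth) Killing field: in all charts the Lie derivative of the metric along `X`
vanishes. -/
def IsKilling (X : VField m M) : Prop :=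
  ContMDiff (𝓡 m) (𝓡 m).tangent ∞ (fun p => (⟨p, X p⟩ : TangentBundle (𝓡 m) M)) ∧
  ∀ e ∈ IsManifold.maximalAtlas (𝓡 m) ∞ M, ∀ x ∈ e.target, ∀ u v : EuclideanSpace ℝ (Fin m),
    fderiv ℝ (coordMetric g e) x (coordField X e x) u v
      + coordMetric g e x (fderiv ℝ (coordField X e) x u) v
      + coordMetric g e x u (fderiv ℝ (coordField X e) x v) = 0

/-- The derivative `dh(ξ)` of a real function. -/
def dirDeriv (h : M → ℝ) (p : M) (ξ : TangentSpace (𝓡 m) p) : ℝ :=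
  mfderiv (𝓡 m) 𝓘(ℝ, ℝ) h p ξ

/-! ### Geodesics -/

/-- The velocity of a curve. -/
def velocity (γ : ℝ → M) (t : ℝ) : TangentSpace (𝓡 m) (γ t) :=
  mfderiv 𝓘(ℝ, ℝ) (𝓡 m) γ t (1 : ℝ)

/-- `γ` is an affinely parametrized geodesic on `J` (an open interval in all uses): it is smooth and
satisfies the geodesic equation in all charts. -/
def IsGeodesicOn (γ : ℝ → M) (J : Set ℝ) : Prop :=
  ContMDiffOn 𝓘(ℝ, ℝ) (𝓡 m) ∞ γ J ∧
  ∀ e ∈ IsManifold.maximalAtlas (𝓡 m) ∞ M, ∀ t ∈ J, γ t ∈ e.source →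
    ∀ w : EuclideanSpace ℝ (Fin m),
      coordMetric g e (e (γ t)) (deriv (deriv (fun s => e (γ s))) t) w
        + christoffel g e (e (γ t)) (deriv (fun s => e (γ s)) t) (deriv (fun s => e (γ s)) t) w = 0

/-! ### Stationary axisymmetric spacetimes

`K 0` is the field `K_t` and `K 1` is the field `K_φ`. -/

variable (K : Fin 2 → VField m M)

/-- The Gram matrix `𝒢_{αβ} = ⟨K_α, K_β⟩`. -/
def gram (p : M) : Matrix (Fin 2) (Fin 2) ℝ := Matrix.of fun α β => g.inner p (K α p) (K β p)

/-- `X` generates a global smooth flow (one-parameter group of diffeomorphisms). -/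
def IsCompleteField (X : VField m M) : Prop :=
  ∃ Φ : ℝ × M → M, ContMDiff (𝓘(ℝ, ℝ).prod (𝓡 m)) (𝓡 m) ∞ Φ ∧
    ∀ p, Φ (0, p) = p ∧ IsMIntegralCurve (fun s => Φ (s, p)) X

/-- `K_t`, `K_φ` are commuting Killing fields whose Gram determinant is negative, and `K_t` generates
a one-parameter group (time translations). -/
structure IsStationaryAxisymmetric : Prop where
  killing : ∀ α, IsKilling g (K α)
  commute : ∀ p, VectorField.mlieBracket (𝓡 m) (K 0) (K 1) p = 0
  det_neg : ∀ p, (gram g K p).det < 0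
  complete : IsCompleteField (K 0)

/-- The constants `ρ^α = (ρ, 1)`. -/
def rhoCoeff (ρ : ℝ) : Fin 2 → ℝ := ![ρ, 1]

/-- The Killing field `ρ̂ = ρ^α K_α = ρ K_t + K_φ`. -/
def rhoHat (ρ : ℝ) : VField m M := fun p => ∑ α, rhoCoeff ρ α • K α p

/-- The function `⟨ρ̂, ρ̂⟩`. -/
def rhoNormSq (ρ : ℝ) (p : M) : ℝ := g.inner p (rhoHat K ρ p) (rhoHat K ρ p)

/-- The two-dimensional Levi-Civita tensor on the span of `K_t`, `K_φ`. -/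
def levi (p : M) : Matrix (Fin 2) (Fin 2) ℝ :=
  Real.sqrt |(gram g K p).det| • !![0, 1; -1, 0]

/-- The field `τ̂ = τ^α K_α` with `τ^α = 𝒢^{αλ} ε_{λβ} ρ^β`. -/
def tauHat (ρ : ℝ) : VField m M := fun p =>
  ∑ α, ((gram g K p)⁻¹.mulVec ((levi g K p).mulVec (rhoCoeff ρ))) α • K α p

/-- `∇_ρ̂ ρ̂ ≠ 0` wherever `ρ̂` is null. -/
def IsRegularParameter (ρ : ℝ) : Prop :=
  ∀ p : M, rhoNormSq g K ρ p = 0 → ∃ w, covDeriv g (rhoHat K ρ) p (rhoHat K ρ p) w ≠ 0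

/-- A causal region: a connected component of `{⟨ρ̂, ρ̂⟩ ≥ 0}`. -/
def IsCausalRegion (ρ : ℝ) (C : Set M) : Prop :=
  ∃ p, 0 ≤ rhoNormSq g K ρ p ∧ C = connectedComponentIn {q | 0 ≤ rhoNormSq g K ρ q} p

/-- The boundary `∂C` of a causal region, where `⟨ρ̂, ρ̂⟩ = 0`. -/
def causalBoundary (ρ : ℝ) (C : Set M) : Set M := {p ∈ C | rhoNormSq g K ρ p = 0}

/-- `γ` is a null geodesic on `J` with nonzero energy `E = -⟨K_t, γ'⟩` and impact parameter `ρ`. -/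
structure IsNullGeodesicWithImpact (ρ : ℝ) (γ : ℝ → M) (J : Set ℝ) : Prop where
  geodesic : IsGeodesicOn g γ J
  null : ∀ t ∈ J, g.inner (γ t) (velocity γ t) (velocity (m := m) γ t) = 0
  energy_ne : ∀ t ∈ J, g.inner (γ t) (K 0 (γ t)) (velocity γ t) ≠ 0
  impact : ∀ t ∈ J,
    ρ = -(g.inner (γ t) (K 1 (γ t)) (velocity γ t)) / g.inner (γ t) (K 0 (γ t)) (velocity γ t)

/-- A (not necessarily closed) embedded spacelike hypersurface of `M`: locally a regular level set
whose tangent vectors are all spacelike. -/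
def IsSpacelikeHypersurface (A : Set M) : Prop :=
  ∀ p ∈ A, ∃ (U : Set M) (T : M → ℝ), IsOpen U ∧ p ∈ U ∧ ContMDiffOn (𝓡 m) 𝓘(ℝ, ℝ) ∞ T U ∧
    A ∩ U = {q ∈ U | T q = 0} ∧
    ∀ q ∈ A ∩ U, mfderiv (𝓡 m) 𝓘(ℝ, ℝ) T q ≠ 0 ∧
      ∀ v : TangentSpace (𝓡 m) q, v ≠ 0 → dirDeriv T q v = 0 → 0 < g.inner q v v

end Ambient

section Submanifold

/-! ### Submanifolds

A submanifold is a smooth manifold `S` of dimension `n`, possibly with boundary, together with a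
smooth embedding `ι : S → M`. -/

variable {m n : ℕ} [NeZero n]
  {M : Type*} [TopologicalSpace M] [ChartedSpace (EuclideanSpace ℝ (Fin m)) M]
  [IsManifold (𝓡 m) ∞ M]
  {S : Type*} [TopologicalSpace S] [ChartedSpace (EuclideanHalfSpace n) S]
  [IsManifold (𝓡∂ n) ∞ S]
  (g : LorentzMetric m M) (K : Fin 2 → VField m M) (ι : S → M)

/-- The tangent space of the submanifold at `p`, as a subspace of the tangent space of `M`. -/
def tangentSub (p : S) : Submodule ℝ (TangentSpace (𝓡 m) (ι p)) :=
  LinearMap.range (mfderiv (𝓡∂ n) (𝓡 m) ι p).toLinearMap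

/-- `ξ` is normal to the submanifold at `p`. -/
def IsNormal (p : S) (ξ : TangentSpace (𝓡 m) (ι p)) : Prop :=
  ∀ v ∈ tangentSub (n := n) ι p, g.inner (ι p) v ξ = 0

/-- The scalar product `⟨II(u, v), ξ⟩` of the second fundamental form of the submanifold with a
normal vector `ξ`, computed in charts `φ` of `S` at `p` and `e` of `M` at `ι p`: with
`F = e ∘ ι ∘ φ⁻¹` it is `g(∂_u ∂_v F, ξ) + Γ(∂_u F, ∂_v F; ξ)`, the normal part of the ambient
covariant derivative of a tangent field. -/
def secondForm (φ : OpenPartialHomeomorph S (EuclideanHalfSpace n))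
    (e : OpenPartialHomeomorph M (EuclideanSpace ℝ (Fin m))) (p : S)
    (u v : TangentSpace (𝓡∂ n) p) (ξ : TangentSpace (𝓡 m) (ι p)) : ℝ :=
  let F : EuclideanSpace ℝ (Fin n) → EuclideanSpace ℝ (Fin m) :=
    e ∘ ι ∘ (φ.extend (𝓡∂ n)).symm
  let R : Set (EuclideanSpace ℝ (Fin n)) := Set.range (𝓡∂ n)
  let y : EuclideanSpace ℝ (Fin n) := φ.extend (𝓡∂ n) p
  let u' : EuclideanSpace ℝ (Fin n) := mfderiv (𝓡∂ n) (𝓡 n) (φ.extend (𝓡∂ n)) p u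
  let v' : EuclideanSpace ℝ (Fin n) := mfderiv (𝓡∂ n) (𝓡 n) (φ.extend (𝓡∂ n)) p v
  let ξ' : EuclideanSpace ℝ (Fin m) := mfderiv (𝓡 m) (𝓡 m) e (ι p) ξ
  coordMetric g e (e (ι p)) (fderivWithin ℝ (fderivWithin ℝ F R) R y u' v') ξ'
    + christoffel g e (e (ι p)) (fderivWithin ℝ F R y u') (fderivWithin ℝ F R y v') ξ'

/-- Invariance: the Killing fields and their commutators are tangent to the submanifold. -/
structure IsInvariant : Prop where
  tangent : ∀ α (p : S), K α (ι p) ∈ tangentSub (n := n) ι p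
  bracket_tangent : ∀ α β (p : S),
    VectorField.mlieBracket (𝓡 m) (K α) (K β) (ι p) ∈ tangentSub (n := n) ι p

/-- The submanifold has a compact spatial section: it meets some spacelike hypersurface `A` in a
compact set and is swept out from this set by the time translations, that is, it is mapped to
itself by them and all their orbits in it meet `A`. -/
def HasCompactSpatialSection : Prop :=
  ∃ A : Set M, IsSpacelikeHypersurface g A ∧ IsCompact (Set.range ι ∩ A) ∧
    ∀ c : ℝ → M, IsMIntegralCurve c (K 0) → c 0 ∈ Set.range ι →
      (∀ s, c s ∈ Set.range ι) ∧ ∃ s, c s ∈ A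

/-- The conditions on the second fundamental form at a point `p`, for the part `H` of the mean
curvature vector belonging to `ρ̂^⊥`. Identities between normal vectors are expressed by scalar
products with all normal vectors `ξ`; in particular `⟨∇^⊥ h, ξ⟩ = dh(ξ)`. Elements of the
orthogonal complement of `K_t`, `K_φ` in the tangent space of the submanifold are written as images
of `a`, `b` under the differential of `ι`. -/
structure SecondFormCondition (ρ : ℝ) (p : S) (H : TangentSpace (𝓡 m) (ι p)) : Prop where
  normal : IsNormal (n := n) g ι p H
  /-- `II(K_α, K_β) = -∇^⊥ 𝒢_{αβ} / 2`. -/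
  killing_killing : ∀ φ ∈ IsManifold.maximalAtlas (𝓡∂ n) ∞ S, p ∈ φ.source →
    ∀ e ∈ IsManifold.maximalAtlas (𝓡 m) ∞ M, ι p ∈ e.source →
    ∀ ξ, IsNormal (n := n) g ι p ξ → ∀ α β, ∀ u v : TangentSpace (𝓡∂ n) p,
      mfderiv (𝓡∂ n) (𝓡 m) ι p u = K α (ι p) → mfderiv (𝓡∂ n) (𝓡 m) ι p v = K β (ι p) →
      secondForm g ι φ e p u v ξ
        = -(1 / 2) * dirDeriv (fun q => gram g K q α β) (ι p) ξ
  /-- `⟨II(K_α, a), ξ⟩ = -⟨∇_ξ K_α, a⟩`. -/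
  killing_perp : ∀ φ ∈ IsManifold.maximalAtlas (𝓡∂ n) ∞ S, p ∈ φ.source →
    ∀ e ∈ IsManifold.maximalAtlas (𝓡 m) ∞ M, ι p ∈ e.source →
    ∀ ξ, IsNormal (n := n) g ι p ξ → ∀ α, ∀ u a : TangentSpace (𝓡∂ n) p,
      mfderiv (𝓡∂ n) (𝓡 m) ι p u = K α (ι p) →
      (∀ β, g.inner (ι p) (K β (ι p)) (mfderiv (𝓡∂ n) (𝓡 m) ι p a) = 0) →
      secondForm g ι φ e p u a ξ
        = -covDeriv g (K α) (ι p) ξ (mfderiv (𝓡∂ n) (𝓡 m) ι p a)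
  /-- `II(a, b) = ⟨a, b⟩ H`. -/
  perp_perp : ∀ φ ∈ IsManifold.maximalAtlas (𝓡∂ n) ∞ S, p ∈ φ.source →
    ∀ e ∈ IsManifold.maximalAtlas (𝓡 m) ∞ M, ι p ∈ e.source →
    ∀ ξ, IsNormal (n := n) g ι p ξ → ∀ a b : TangentSpace (𝓡∂ n) p,
      (∀ β, g.inner (ι p) (K β (ι p)) (mfderiv (𝓡∂ n) (𝓡 m) ι p a) = 0) →
      (∀ β, g.inner (ι p) (K β (ι p)) (mfderiv (𝓡∂ n) (𝓡 m) ι p b) = 0) →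
      secondForm g ι φ e p a b ξ
        = g.inner (ι p) (mfderiv (𝓡∂ n) (𝓡 m) ι p a) (mfderiv (𝓡∂ n) (𝓡 m) ι p b)
          * g.inner (ι p) H ξ
  /-- `II(τ̂, a) = 0`. -/
  tau_perp : ∀ φ ∈ IsManifold.maximalAtlas (𝓡∂ n) ∞ S, p ∈ φ.source →
    ∀ e ∈ IsManifold.maximalAtlas (𝓡 m) ∞ M, ι p ∈ e.source →
    ∀ ξ, IsNormal (n := n) g ι p ξ → ∀ u a : TangentSpace (𝓡∂ n) p,
      mfderiv (𝓡∂ n) (𝓡 m) ι p u = tauHat g K ρ (ι p) →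
      (∀ β, g.inner (ι p) (K β (ι p)) (mfderiv (𝓡∂ n) (𝓡 m) ι p a) = 0) →
      secondForm g ι φ e p u a ξ = 0
  /-- The master equation `ρ^α ℳ_{αβ} ρ^β = 0`, where
  `ℳ_{αβ} = ∇^⊥ (𝒢⁻¹ 𝒢_{αβ}) / 2 - 𝒢⁻¹ 𝒢_{αβ} H` and `𝒢 = det 𝒢_{αβ}`. -/
  master : ∀ ξ, IsNormal (n := n) g ι p ξ →
    ∑ α, ∑ β, rhoCoeff ρ α * rhoCoeff ρ β *
      ((1 / 2) * dirDeriv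
          (fun q => ((gram g K q).det)⁻¹ * gram g K q α β) (ι p) ξ
        - ((gram g K (ι p)).det)⁻¹ * gram g K (ι p) α β * g.inner (ι p) H ξ) = 0

/-- Fundamental photon submanifolds `S ⊆ C`. The inequality `⟨ρ̂, ρ̂⟩ ≥ 0` on `S` is part of
`S ⊆ C`. -/
structure IsFundamentalPhotonSubmanifold (ρ : ℝ) (C : Set M) : Prop where
  embedding : Manifold.IsSmoothEmbedding (𝓡∂ n) (𝓡 m) ∞ ι
  lorentz : ∀ p : S, IsLorentzForm (fun u v : TangentSpace (𝓡∂ n) p =>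
    g.inner (ι p) (mfderiv (𝓡∂ n) (𝓡 m) ι p u) (mfderiv (𝓡∂ n) (𝓡 m) ι p v))
  subset : Set.range ι ⊆ C
  invariant : IsInvariant (n := n) K ι
  compact_section : HasCompactSpatialSection g K ι
  boundary : ι '' (𝓡∂ n).boundary S ⊆ causalBoundary g K ρ C
  second_form : ∀ p : S, ∃ H, SecondFormCondition (n := n) g K ι ρ p H

variable (m n) in
/-- The curve `γ` touches the submanifold at time `t`: its point lies on the submanifold and its
velocity is tangent to it. -/
def TouchesAt (γ : ℝ → M) (t : ℝ) : Prop :=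
  ∃ u : TangentBundle (𝓡∂ n) S, tangentMap (𝓡∂ n) (𝓡 m) ι u =
    (⟨γ t, velocity γ t⟩ : TangentBundle (𝓡 m) M)

end Submanifold

end PhotonSubmanifold

end

/-!
A null geodesic of impact parameter `ρ` that touches the submanifold once stays in it, because the set
of touching times is open and closed in the interval `J`.

*Openness.* In charts adapted to the embedding, the submanifold is the half slice
`{L (y, 0) | 0 ≤ y 0}` of a coordinate space, and its second fundamental form is given by the
Christoffel symbols alone (`IsAdaptedChart.secondForm_eq`). Along the geodesic `⟨ρ̂, γ'⟩ = 0` and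
`⟨γ', γ'⟩ = 0`. The conditions on the second fundamental form, the master equation included, say that
`II` is umbilic on tangent vectors orthogonal to `ρ̂`. Hence the transverse acceleration of the
geodesic agrees, up to sign, with the value of a `C¹` function (`normalDefect`) that vanishes on all
vectors tangent to the submanifold. So the transverse coordinate `z` satisfies `‖z''‖ ≤ c (‖z‖ + ‖z'‖)` with
zero initial data, and vanishes by Gronwall's inequality. At a boundary point of the submanifold
`⟨ρ̂, ρ̂⟩` vanishes, the velocity is a multiple of `ρ̂`, and regularity of `ρ` forces the second
derivative of `⟨ρ̂, ρ̂⟩` along the geodesic to be positive (`CoordKilling.eventually_comboSq_nonneg`).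
Since `⟨ρ̂, ρ̂⟩` also has a positive inner normal derivative at the face of the half slice, the
distance by which the geodesic could leave through the face is bounded in terms of `z`, so that the same inequality applies (`eventually_mem_slice`, `eventually_touchesAt`).

*Closedness.* The submanifold need not be closed in the spacetime, but it has a compact section. Let
`t₁` be a limit of touching times `t`. Time translations `Φ_s` carry the points `γ t` into the section,
where they accumulate at some `q`. The flow preserves `⟨γ', γ'⟩` and `⟨K_α, γ'⟩` (`inner_translate`),
and a null vector orthogonal to both Killing fields vanishes, so in a chart at `q` the translated
geodesics have bounded speed (`CoordKilling.exists_norm_le_of_null`). For `t` close to `t₁` the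
translated geodesic therefore stays in the chart until `t₁` (`mem_chart_ball_of_speed_le`), and there
the submanifold is closed. Translating back gives `γ t₁` on the submanifold
(`mem_range_of_mem_closure`), and the velocity is tangent by continuity.
-/

noncomputable section

namespace PhotonSubmanifold

/-! ### Lorentzian linear algebra -/

section Lorentz

variable {V : Type*} [AddCommGroup V] [Module ℝ V] [TopologicalSpace V]
  {B : V →L[ℝ] V →L[ℝ] ℝ}

theorem IsLorentzForm.eq_zero_of_forall (hB : IsLorentzForm (fun v w => B v w)) {x : V}
    (hx : ∀ w, B x w = 0) : x = 0 := by
  obtain ⟨hs, t, ht, hpos⟩ := hB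
  by_contra h
  have h1 := hpos x h (by simpa using (hs t x).trans (hx t))
  simp [hx] at h1

theorem IsLorentzForm.pos_of_orthogonal_timelike (hB : IsLorentzForm (fun v w => B v w)) {t w : V}
    (ht : B t t < 0) (htw : B t w = 0) (hw : w ≠ 0) : 0 < B w w := by
  obtain ⟨hs, v, hv, hpos⟩ := hB
  simp only at hs hv hpos
  by_contra! hle
  have hvt : B v t ≠ 0 := by
    intro h0
    have := hpos t (by rintro rfl; simp at ht) h0
    linarith
  -- the combination of `t` and `w` orthogonal to `v` has nonpositive square
  have hx : B v ((B v t) • w - (B v w) • t) = 0 := by simp; ring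
  have hxx : B ((B v t) • w - (B v w) • t) ((B v t) • w - (B v w) • t)
      = (B v t) ^ 2 * B w w + (B v w) ^ 2 * B t t := by
    have : B w t = 0 := (hs w t).trans htw
    simp [this, htw]; ring
  by_cases h0 : (B v t) • w - (B v w) • t = 0
  · have h1 : B t ((B v t) • w - (B v w) • t) = 0 := by rw [h0]; simp
    have h2 : B v w = 0 := by simpa [htw, ht.ne] using h1
    rw [h2, zero_smul, sub_zero, smul_eq_zero] at h0
    exact h0.elim hvt hw
  · have := hpos _ h0 hx
    nlinarith [sq_nonneg (B v t), sq_nonneg (B v w)]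

/-- A plane with negative Gram determinant contains a timelike vector, so its orthogonal
complement is spacelike. -/
theorem IsLorentzForm.pos_of_orthogonal_plane (hB : IsLorentzForm (fun v w => B v w)) {k l w : V}
    (hdet : B k k * B l l - B k l * B k l < 0) (hk : B k w = 0) (hl : B l w = 0) (hw : w ≠ 0) :
    0 < B w w := by
  have hs : ∀ v w, B v w = B w v := hB.1
  by_cases hkk : B k k < 0
  · exact hB.pos_of_orthogonal_timelike hkk hk hw
  by_cases hll : B l l < 0
  · exact hB.pos_of_orthogonal_timelike hll hl hw
  push Not at hkk hll
  rcases hkk.eq_or_lt with h0 | h0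
  · have hkl : B k l ≠ 0 := by rintro h; simp [h, ← h0] at hdet
    refine hB.pos_of_orthogonal_timelike (t := l - ((B l l + 1) / (2 * B k l)) • k) ?_ ?_ hw
    · have : B (l - ((B l l + 1) / (2 * B k l)) • k) (l - ((B l l + 1) / (2 * B k l)) • k) = -1 := by
        simp [hs l k, ← h0]; field_simp; ring
      linarith
    · simp [hk, hl]
  · refine hB.pos_of_orthogonal_timelike (t := (B k k) • l - (B k l) • k) ?_ ?_ hw
    · have : B ((B k k) • l - (B k l) • k) ((B k k) • l - (B k l) • k)
        = B k k * (B k k * B l l - B k l * B k l) := by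
        simp only [map_sub, map_smul, sub_apply,
          smul_apply, smul_eq_mul, hs l k]
        ring
      rw [this]; exact mul_neg_of_pos_of_neg h0 hdet
    · simp [hk, hl]

end Lorentz

/-! ### The dual frame of a nondegenerate plane -/

section DualFrame

variable {V : Type*} [AddCommGroup V] [Module ℝ V] [TopologicalSpace V]

/-- The Gram determinant of `k`, `l`. -/
def planeDet (B : V →L[ℝ] V →L[ℝ] ℝ) (k l : V) : ℝ := B k k * B l l - B k l * B k l

/-- The vector of the plane spanned by `k`, `l` whose product with `k` is `1` and whose product
with `l` is `0`. -/
def dualVec (B : V →L[ℝ] V →L[ℝ] ℝ) (k l : V) : V :=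
  (planeDet B k l)⁻¹ • (B l l • k - B k l • l)

/-- The component of `w` orthogonal to the plane spanned by `k`, `l`. -/
def perpPart (B : V →L[ℝ] V →L[ℝ] ℝ) (k l w : V) : V :=
  w - B k w • dualVec B k l - B l w • dualVec B l k

variable {B : V →L[ℝ] V →L[ℝ] ℝ} {k l : V}

theorem planeDet_comm (hs : ∀ v w, B v w = B w v) : planeDet B l k = planeDet B k l := by
  simp [planeDet, hs l k]; ring

theorem apply_dualVec_left (hD : planeDet B k l ≠ 0) : B k (dualVec B k l) = 1 := by
  simp only [dualVec, map_smul, map_sub, smul_eq_mul]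
  rw [inv_mul_eq_one₀ hD, planeDet]; ring

theorem apply_dualVec_right (hs : ∀ v w, B v w = B w v) : B l (dualVec B k l) = 0 := by
  simp only [dualVec, map_smul, map_sub, smul_eq_mul, hs l k]; ring

theorem apply_perpPart_left (hs : ∀ v w, B v w = B w v) (hD : planeDet B k l ≠ 0) (w : V) :
    B k (perpPart B k l w) = 0 := by
  simp [perpPart, apply_dualVec_left hD, apply_dualVec_right hs]

theorem apply_perpPart_right (hs : ∀ v w, B v w = B w v) (hD : planeDet B k l ≠ 0) (w : V) :
    B l (perpPart B k l w) = 0 := by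
  have hD' : planeDet B l k ≠ 0 := by rwa [planeDet_comm hs]
  simp [perpPart, apply_dualVec_right hs, apply_dualVec_left hD']

end DualFrame

/-! ### A Gronwall argument for second order differential inequalities -/

section Gronwall

variable {F : Type*} [NormedAddCommGroup F] [NormedSpace ℝ F]

theorem eventually_eq_zero_right_of_second_order {z z' z'' : ℝ → F} {s C : ℝ}
    (hz : ∀ᶠ t in 𝓝 s, HasDerivAt z (z' t) t) (hz' : ∀ᶠ t in 𝓝 s, HasDerivAt z' (z'' t) t)
    (hC : ∀ᶠ t in 𝓝 s, ‖z'' t‖ ≤ C * (‖z t‖ + ‖z' t‖)) (h0 : z s = 0) (h0' : z' s = 0) :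
    ∃ δ > 0, ∀ t ∈ Set.Icc s (s + δ), z t = 0 ∧ z' t = 0 := by
  obtain ⟨δ, hδ, h⟩ := Metric.eventually_nhds_iff_ball.1 (hz.and (hz'.and hC))
  have hmem : ∀ t ∈ Set.Icc s (s + δ / 2), t ∈ Metric.ball s δ := by
    intro t ht
    rw [Metric.mem_ball, Real.dist_eq, abs_lt]
    constructor <;> linarith [ht.1, ht.2]
  refine ⟨δ / 2, by positivity, fun t ht => ?_⟩
  have key := eq_zero_of_abs_deriv_le_mul_abs_self_of_eq_zero_right
    (f := fun t => (z t, z' t)) (f' := fun t => (z' t, z'' t)) (K := 1 + 2 * |C|)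
    (a := s) (b := s + δ / 2)
    (fun t ht => ((h t (hmem t ht)).1.continuousAt.prodMk
      (h t (hmem t ht)).2.1.continuousAt).continuousWithinAt)
    (fun t ht => ((h t (hmem t ⟨ht.1, ht.2.le⟩)).1.prodMk
      (h t (hmem t ⟨ht.1, ht.2.le⟩)).2.1).hasDerivWithinAt)
    (by simp [h0, h0'])
    (fun t ht => by
      have h3 := (h t (hmem t ⟨ht.1, ht.2.le⟩)).2.2
      have ha : ‖z t‖ ≤ ‖(z t, z' t)‖ := norm_fst_le (z t, z' t)
      have hb : ‖z' t‖ ≤ ‖(z t, z' t)‖ := norm_snd_le (z t, z' t)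
      have hc := le_abs_self C
      have hc0 := abs_nonneg C
      have hn := norm_nonneg (z t, z' t)
      rw [Prod.norm_def]
      refine max_le ?_ ?_
      · nlinarith
      · show ‖z'' t‖ ≤ _
        have hsum : 0 ≤ ‖z t‖ + ‖z' t‖ := by positivity
        nlinarith)
  simpa using key t ht

/-- Gronwall's inequality for the pair `(z, z')`: the inequality `‖z''‖ ≤ C (‖z‖ + ‖z'‖)` with zero
initial data forces `z = 0`. -/
theorem eventually_eq_zero_of_second_order {z z' z'' : ℝ → F} {s C : ℝ}
    (hz : ∀ᶠ t in 𝓝 s, HasDerivAt z (z' t) t) (hz' : ∀ᶠ t in 𝓝 s, HasDerivAt z' (z'' t) t)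
    (hC : ∀ᶠ t in 𝓝 s, ‖z'' t‖ ≤ C * (‖z t‖ + ‖z' t‖)) (h0 : z s = 0) (h0' : z' s = 0) :
    ∀ᶠ t in 𝓝 s, z t = 0 ∧ z' t = 0 := by
  obtain ⟨δ, hδ, h1⟩ := eventually_eq_zero_right_of_second_order hz hz' hC h0 h0'
  -- time reversal `t ↦ 2 s - t`
  have hr : Filter.Tendsto (fun t => 2 * s - t) (𝓝 s) (𝓝 s) := by
    have : Continuous fun t : ℝ => 2 * s - t := by fun_prop
    simpa [two_mul] using this.tendsto s
  have hd : ∀ t, HasDerivAt (fun t => 2 * s - t) (-1) t := fun t => by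
    simpa using (hasDerivAt_id t).const_sub (2 * s)
  obtain ⟨δ', hδ', h2⟩ := eventually_eq_zero_right_of_second_order (s := s) (C := C)
    (z := fun t => z (2 * s - t)) (z' := fun t => -z' (2 * s - t)) (z'' := fun t => z'' (2 * s - t))
    (by filter_upwards [hr.eventually hz] with t ht
        simpa [Function.comp_def] using ht.scomp t (hd t))
    (by filter_upwards [hr.eventually hz'] with t ht
        simpa [Function.comp_def, Pi.neg_def] using (ht.scomp t (hd t)).neg)
    (by filter_upwards [hr.eventually hC] with t ht
        simpa using ht)
    (by simpa [two_mul] using h0) (by simpa [two_mul] using h0')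
  filter_upwards [Icc_mem_nhds (show s - δ' < s by linarith) (show s < s + δ by linarith)] with t ht
  rcases le_total s t with h | h
  · exact h1 t ⟨h, ht.2⟩
  · simpa using h2 (2 * s - t) ⟨by linarith, by linarith [ht.1]⟩

end Gronwall

/-! ### Killing fields and geodesics in a coordinate domain -/

section Coordinates

theorem one_add_one_le_infty : (1 : WithTop ℕ∞) + 1 ≤ ∞ := by
  rw [one_add_one_eq_two]
  exact WithTop.coe_le_coe.2 (le_top : (2 : ℕ∞) ≤ ⊤)

variable {E : Type*} [NormedAddCommGroup E] [NormedSpace ℝ E]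

/-- The Christoffel symbols of the first kind `Γ(u, v; ·)` of the metric coefficients `G`, as a
linear functional of the last argument. -/
def christoffelForm (G : E → E →L[ℝ] E →L[ℝ] ℝ) (x u v : E) : E →L[ℝ] ℝ :=
  (1 / 2 : ℝ) • (fderiv ℝ G x u v + fderiv ℝ G x v u - ((fderiv ℝ G x).flip u).flip v)

theorem christoffelForm_apply (G : E → E →L[ℝ] E →L[ℝ] ℝ) (x u v w : E) :
    christoffelForm G x u v w =
      (fderiv ℝ G x u v w + fderiv ℝ G x v u w - fderiv ℝ G x w u v) / 2 := by
  simp [christoffelForm]; ring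

/-- The Christoffel symbols of the second kind: `Γ(u, v; ·)` with its index raised. -/
def spray (G : E → E →L[ℝ] E →L[ℝ] ℝ) (x u v : E) : E :=
  (G x).inverse (christoffelForm G x u v)

theorem christoffelForm_add_left (G : E → E →L[ℝ] E →L[ℝ] ℝ) (x u u' v w : E) :
    christoffelForm G x (u + u') v w = christoffelForm G x u v w + christoffelForm G x u' v w := by
  simp [christoffelForm_apply]; ring

theorem christoffelForm_add_right (G : E → E →L[ℝ] E →L[ℝ] ℝ) (x u v v' w : E) :
    christoffelForm G x u (v + v') w = christoffelForm G x u v w + christoffelForm G x u v' w := by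
  simp [christoffelForm_apply]; ring

theorem christoffelForm_smul_left (G : E → E →L[ℝ] E →L[ℝ] ℝ) (c : ℝ) (x u v w : E) :
    christoffelForm G x (c • u) v w = c * christoffelForm G x u v w := by
  simp [christoffelForm_apply]; ring

theorem christoffelForm_smul_right (G : E → E →L[ℝ] E →L[ℝ] ℝ) (c : ℝ) (x u v w : E) :
    christoffelForm G x u (c • v) w = c * christoffelForm G x u v w := by
  simp [christoffelForm_apply]; ring

/-- The field `ρ X₀ + X₁`. -/
def combo (X : Fin 2 → E → E) (ρ : ℝ) (x : E) : E := ρ • X 0 x + X 1 x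

/-- The function `⟨ρ X₀ + X₁, ρ X₀ + X₁⟩`. -/
def comboSq (G : E → E →L[ℝ] E →L[ℝ] ℝ) (X : Fin 2 → E → E) (ρ : ℝ) (x : E) : ℝ :=
  G x (combo X ρ x) (combo X ρ x)

/-- Two commuting Killing fields `X₀`, `X₁` with negative Gram determinant on an open set `U` of a
vector space with a Lorentzian metric `G`. -/
structure CoordKilling (G : E → E →L[ℝ] E →L[ℝ] ℝ) (X : Fin 2 → E → E) (U : Set E) : Prop where
  isOpen : IsOpen U
  metric_smooth : ContDiffOn ℝ ∞ G U
  field_smooth : ∀ α, ContDiffOn ℝ ∞ (X α) U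
  lorentz : ∀ x ∈ U, IsLorentzForm (fun v w => G x v w)
  killing : ∀ α, ∀ x ∈ U, ∀ u v,
    fderiv ℝ G x (X α x) u v + G x (fderiv ℝ (X α) x u) v + G x u (fderiv ℝ (X α) x v) = 0
  commute : ∀ x ∈ U, fderiv ℝ (X 1) x (X 0 x) = fderiv ℝ (X 0) x (X 1 x)
  det_neg : ∀ x ∈ U, planeDet (G x) (X 0 x) (X 1 x) < 0

theorem fderiv_metric_apply {G : E → E →L[ℝ] E →L[ℝ] ℝ} {Y Z : E → E} {x : E}
    (hG : DifferentiableAt ℝ G x) (hY : DifferentiableAt ℝ Y x) (hZ : DifferentiableAt ℝ Z x)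
    (w : E) :
    fderiv ℝ (fun y => G y (Y y) (Z y)) x w = fderiv ℝ G x w (Y x) (Z x)
      + G x (fderiv ℝ Y x w) (Z x) + G x (Y x) (fderiv ℝ Z x w) := by
  rw [((hG.hasFDerivAt.clm_apply hY.hasFDerivAt).clm_apply hZ.hasFDerivAt).fderiv]
  simp; ring

namespace CoordKilling

variable {G : E → E →L[ℝ] E →L[ℝ] ℝ} {X : Fin 2 → E → E} {U : Set E} (h : CoordKilling G X U)
  {x : E} (hx : x ∈ U)
include h hx

theorem symm (u v : E) : G x u v = G x v u := (h.lorentz x hx).1 u v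

theorem contDiffAt_metric : ContDiffAt ℝ ∞ G x :=
  h.metric_smooth.contDiffAt (h.isOpen.mem_nhds hx)

theorem contDiffAt_field (α : Fin 2) : ContDiffAt ℝ ∞ (X α) x :=
  (h.field_smooth α).contDiffAt (h.isOpen.mem_nhds hx)

theorem contDiffAt_combo (ρ : ℝ) : ContDiffAt ℝ ∞ (combo X ρ) x :=
  (contDiffAt_const.smul (h.contDiffAt_field hx 0)).add (h.contDiffAt_field hx 1)

theorem contDiffAt_comboSq (ρ : ℝ) : ContDiffAt ℝ ∞ (comboSq G X ρ) x :=
  ((h.contDiffAt_metric hx).clm_apply (h.contDiffAt_combo hx ρ)).clm_apply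
    (h.contDiffAt_combo hx ρ)

theorem differentiableAt_metric : DifferentiableAt ℝ G x :=
  (h.contDiffAt_metric hx).differentiableAt (by simp)

theorem differentiableAt_field (α : Fin 2) : DifferentiableAt ℝ (X α) x :=
  (h.contDiffAt_field hx α).differentiableAt (by simp)

theorem differentiableAt_combo (ρ : ℝ) : DifferentiableAt ℝ (combo X ρ) x :=
  (h.contDiffAt_combo hx ρ).differentiableAt (by simp)

theorem fderiv_combo (ρ : ℝ) (w : E) :
    fderiv ℝ (combo X ρ) x w = ρ • fderiv ℝ (X 0) x w + fderiv ℝ (X 1) x w := by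
  have := ((h.differentiableAt_field hx 0).hasFDerivAt.const_smul ρ).add
    (h.differentiableAt_field hx 1).hasFDerivAt
  have h2 : HasFDerivAt (combo X ρ) _ x := this
  rw [h2.fderiv]; simp

theorem killing_combo (ρ : ℝ) (u v : E) :
    fderiv ℝ G x (combo X ρ x) u v + G x (fderiv ℝ (combo X ρ) x u) v
      + G x u (fderiv ℝ (combo X ρ) x v) = 0 := by
  have h0 := h.killing 0 x hx u v
  have h1 := h.killing 1 x hx u v
  simp only [h.fderiv_combo hx, combo, map_add, map_smul, add_apply, smul_apply,
    smul_eq_mul]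
  linear_combination ρ * h0 + h1

theorem fderiv_metric_symm (w u v : E) : fderiv ℝ G x w u v = fderiv ℝ G x w v u := by
  have key : ∀ a b : E, fderiv ℝ (fun y => G y a b) x w = fderiv ℝ G x w a b := fun a b => by
    have := fderiv_metric_apply (h.differentiableAt_metric hx)
      (differentiableAt_const a) (differentiableAt_const b) w
    simpa using this
  rw [← key, ← key]
  have : (fun y => G y u v) =ᶠ[𝓝 x] fun y => G y v u := by
    filter_upwards [h.isOpen.mem_nhds hx] with y hy using h.symm hy u v
  rw [this.fderiv_eq]

theorem fderiv_comboSq (ρ : ℝ) (w : E) :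
    fderiv ℝ (comboSq G X ρ) x w = fderiv ℝ G x w (combo X ρ x) (combo X ρ x)
      + 2 * G x (fderiv ℝ (combo X ρ) x w) (combo X ρ x) := by
  have := fderiv_metric_apply (h.differentiableAt_metric hx) (h.differentiableAt_combo hx ρ)
    (h.differentiableAt_combo hx ρ) w
  rw [h.symm hx (combo X ρ x) (fderiv ℝ (combo X ρ) x w)] at this
  rw [show comboSq G X ρ = fun y => G y (combo X ρ y) (combo X ρ y) from rfl, this]
  ring

/-- The Killing equation turns the acceleration `∇_R R` of `R = ρ X₀ + X₁` into half the gradient of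
`-⟨R, R⟩`. -/
theorem accel_eq (ρ : ℝ) (w : E) :
    G x (fderiv ℝ (combo X ρ) x (combo X ρ x)) w
      + christoffelForm G x (combo X ρ x) (combo X ρ x) w
      = -(1 / 2) * fderiv ℝ (comboSq G X ρ) x w := by
  have h1 := h.killing_combo hx ρ (combo X ρ x) w
  rw [h.fderiv_comboSq hx, christoffelForm_apply]
  have h2 := h.symm hx (combo X ρ x) (fderiv ℝ (combo X ρ) x w)
  linear_combination h1 - h2

theorem fderiv_comboSq_field (ρ : ℝ) (α : Fin 2) : fderiv ℝ (comboSq G X ρ) x (X α x) = 0 := by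
  have h1 := h.killing α x hx (combo X ρ x) (combo X ρ x)
  have hc : fderiv ℝ (X α) x (combo X ρ x) = fderiv ℝ (combo X ρ) x (X α x) := by
    rw [h.fderiv_combo hx]
    fin_cases α
    · simp [combo, h.commute x hx]
    · simp [combo, h.commute x hx]
  rw [hc, h.symm hx (combo X ρ x)] at h1
  rw [h.fderiv_comboSq hx]
  linear_combination h1

theorem fderiv_comboSq_combo (ρ : ℝ) : fderiv ℝ (comboSq G X ρ) x (combo X ρ x) = 0 := by
  have h0 := h.fderiv_comboSq_field hx ρ 0
  have h1 := h.fderiv_comboSq_field hx ρ 1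
  rw [show combo X ρ x = ρ • X 0 x + X 1 x from rfl, map_add, map_smul, h0, h1]; simp

/-- The derivative of the identity `d⟨R, R⟩(R) = 0` in the direction `R`. -/
theorem fderiv_fderiv_comboSq (ρ : ℝ) :
    fderiv ℝ (fderiv ℝ (comboSq G X ρ)) x (combo X ρ x) (combo X ρ x)
      + fderiv ℝ (comboSq G X ρ) x (fderiv ℝ (combo X ρ) x (combo X ρ x)) = 0 := by
  have hd : DifferentiableAt ℝ (fderiv ℝ (comboSq G X ρ)) x :=
    ((h.contDiffAt_comboSq hx ρ).fderiv_right (m := 1) one_add_one_le_infty).differentiableAt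
      (by simp)
  have h1 := (hd.hasFDerivAt.clm_apply (h.differentiableAt_combo hx ρ).hasFDerivAt).fderiv
  have h2 : (fun y => fderiv ℝ (comboSq G X ρ) y (combo X ρ y)) =ᶠ[𝓝 x] fun _ => 0 := by
    filter_upwards [h.isOpen.mem_nhds hx] with y hy using h.fderiv_comboSq_combo hy ρ
  rw [h2.fderiv_eq] at h1
  have h3 := congrArg (fun A : E →L[ℝ] ℝ => A (combo X ρ x)) h1
  simp at h3
  linear_combination -h3

theorem eq_of_metric_eq {u v : E} (huv : ∀ w, G x u w = G x v w) : u = v := by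
  rw [← sub_eq_zero]
  exact (h.lorentz x hx).eq_zero_of_forall fun w => by simp [huv w]

variable [FiniteDimensional ℝ E]

theorem metric_isInvertible : (G x).IsInvertible := by
  have hinj : Function.Injective (G x) := by
    rw [injective_iff_map_eq_zero]
    intro v hv
    exact (h.lorentz x hx).eq_zero_of_forall fun w => by simp [hv]
  let f : E ≃ₗ[ℝ] (E →L[ℝ] ℝ) :=
    LinearEquiv.ofInjectiveOfFinrankEq (G x).toLinearMap hinj (by
      rw [← (LinearMap.toContinuousLinearMap (𝕜 := ℝ) (E := E) (F' := ℝ)).finrank_eq]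
      exact (Subspace.dual_finrank_eq (K := ℝ) (V := E)).symm)
  exact ⟨f.toContinuousLinearEquiv, by ext v w; rfl⟩

theorem metric_inverse (φ : E →L[ℝ] ℝ) : G x ((G x).inverse φ) = φ := by
  obtain ⟨f, hf⟩ := h.metric_isInvertible hx
  rw [← hf, ContinuousLinearMap.inverse_equiv]; simp

theorem metric_spray (u v w : E) : G x (spray G x u v) w = christoffelForm G x u v w := by
  rw [spray, h.metric_inverse hx]

omit hx

/-- A geodesic that is tangent to `R = ρ X₀ + X₁` at a point where `R` is null and `∇_R R ≠ 0`
stays in the region `⟨R, R⟩ ≥ 0` for short times: the second derivative of `⟨R, R⟩` along it is a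
positive multiple of `⟨∇_R R, ∇_R R⟩`, and `∇_R R` is spacelike, being orthogonal to the Killing
fields. -/
theorem eventually_comboSq_nonneg {ρ : ℝ} {c : ℝ → E} {s k : ℝ} (hc : ContDiffAt ℝ ∞ c s)
    (hs : c s ∈ U)
    (hgeo : ∀ w, G (c s) (deriv (deriv c) s) w
      + christoffelForm G (c s) (deriv c s) (deriv c s) w = 0)
    (hk : k ≠ 0) (hck : deriv c s = k • combo X ρ (c s)) (h0 : comboSq G X ρ (c s) = 0)
    (hdf : fderiv ℝ (comboSq G X ρ) (c s) ≠ 0) :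
    ∀ᶠ t in 𝓝 s, 0 ≤ comboSq G X ρ (c t) := by
  set f := comboSq G X ρ with hf
  set R := combo X ρ with hR
  have hcU : ∀ᶠ t in 𝓝 s, c t ∈ U := hc.continuousAt.eventually (h.isOpen.mem_nhds hs)
  have hcd : ∀ᶠ t in 𝓝 s, ContDiffAt ℝ 1 c t :=
    (hc.of_le (by exact mod_cast le_top)).eventually (by simp)
  have hderiv : ∀ᶠ t in 𝓝 s, deriv (fun t => f (c t)) t = fderiv ℝ f (c t) (deriv c t) := by
    filter_upwards [hcU, hcd] with t ht htd
    have h1 : HasFDerivAt f (fderiv ℝ f (c t)) (c t) :=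
      ((h.contDiffAt_comboSq ht ρ).differentiableAt (by simp)).hasFDerivAt
    exact (h1.comp_hasDerivAt t (htd.differentiableAt (by simp)).hasDerivAt).deriv
  have hd2 : DifferentiableAt ℝ (fderiv ℝ f) (c s) :=
    ((h.contDiffAt_comboSq hs ρ).fderiv_right (m := 1) one_add_one_le_infty).differentiableAt
      (by simp)
  have hcs : HasDerivAt c (deriv c s) s := (hc.differentiableAt (by simp)).hasDerivAt
  have hcs2 : HasDerivAt (deriv c) (deriv (deriv c) s) s := by
    have : ContDiffAt ℝ 1 (deriv c) s := by
      have h2 : ContDiffAt ℝ 1 (fderiv ℝ c) s := hc.fderiv_right one_add_one_le_infty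
      exact h2.clm_apply contDiffAt_const
    exact (this.differentiableAt (by simp)).hasDerivAt
  have hdd : deriv (deriv fun t => f (c t)) s
      = fderiv ℝ (fderiv ℝ f) (c s) (deriv c s) (deriv c s)
        + fderiv ℝ f (c s) (deriv (deriv c) s) := by
    rw [Filter.EventuallyEq.deriv_eq hderiv]
    exact ((hd2.hasFDerivAt.comp_hasDerivAt s hcs).clm_apply hcs2).deriv
  -- the acceleration `∇_R R`
  set W := fderiv ℝ R (c s) (R (c s)) + spray G (c s) (R (c s)) (R (c s)) with hW
  have hGW : ∀ w, G (c s) W w = -(1 / 2) * fderiv ℝ f (c s) w := fun w => by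
    rw [hW, map_add, add_apply, h.metric_spray hs]
    exact h.accel_eq hs ρ w
  have hacc : deriv (deriv c) s = -(k ^ 2) • spray G (c s) (R (c s)) (R (c s)) := by
    refine h.eq_of_metric_eq hs fun w => ?_
    have h1 := hgeo w
    rw [hck, christoffelForm_smul_left, christoffelForm_smul_right] at h1
    rw [map_smul, smul_apply, h.metric_spray hs, smul_eq_mul]
    linear_combination h1
  have hWpos : 0 < G (c s) W W := by
    refine (h.lorentz _ hs).pos_of_orthogonal_plane (h.det_neg _ hs) ?_ ?_ ?_
    · rw [h.symm hs, hGW, h.fderiv_comboSq_field hs]; simp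
    · rw [h.symm hs, hGW, h.fderiv_comboSq_field hs]; simp
    · intro hW0
      refine hdf (ContinuousLinearMap.ext fun w => ?_)
      have := hGW w
      rw [hW0] at this
      simp at this ⊢
      exact this
  have hval : deriv (deriv fun t => f (c t)) s = 2 * k ^ 2 * G (c s) W W := by
    have h1 := h.fderiv_fderiv_comboSq hs ρ
    have h2 := hGW W
    rw [hdd, hck, hacc, h2, hW]
    simp only [map_smul, smul_apply, smul_eq_mul, map_add]
    linear_combination k ^ 2 * h1
  have hmin : IsLocalMin (fun t => f (c t)) s := by
    refine isLocalMin_of_deriv_deriv_pos ?_ ?_ ?_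
    · rw [hval]; positivity
    · rw [hderiv.self_of_nhds, hck, map_smul, h.fderiv_comboSq_combo hs]; simp
    · exact ContinuousAt.comp (f := c) (h.contDiffAt_comboSq hs ρ).continuousAt hc.continuousAt
  filter_upwards [hmin] with t ht
  simpa [h0] using ht

end CoordKilling

end Coordinates

/-! ### The second fundamental form conditions in slice coordinates -/

section Slice

variable {E E' F : Type*} [NormedAddCommGroup E] [NormedSpace ℝ E]
  [NormedAddCommGroup E'] [NormedSpace ℝ E'] [NormedAddCommGroup F] [NormedSpace ℝ F]

/-- The combination of `X₀`, `X₁` whose products with `X₀`, `X₁` are `1`, `-ρ`. It spans the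
orthogonal complement of `ρ X₀ + X₁` in the plane of the Killing fields. -/
def comboDual (G : E → E →L[ℝ] E →L[ℝ] ℝ) (X : Fin 2 → E → E) (ρ : ℝ) (x : E) : E :=
  dualVec (G x) (X 0 x) (X 1 x) - ρ • dualVec (G x) (X 1 x) (X 0 x)

/-- `ξ` is orthogonal to the slice `L (E' × 0)` at the point `p`. -/
def IsSliceNormal (G : E → E →L[ℝ] E →L[ℝ] ℝ) (L : (E' × F) ≃L[ℝ] E) (p ξ : E) : Prop :=
  ∀ v, (L.symm v).2 = 0 → G p v ξ = 0

/-- The conditions on the second fundamental form of a fundamental photon submanifold at `p`, in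
coordinates in which the submanifold is part of the slice `L (E' × 0)`. The second fundamental form
is then given by the Christoffel symbols alone. -/
structure SliceCondition (G : E → E →L[ℝ] E →L[ℝ] ℝ) (X : Fin 2 → E → E) (ρ : ℝ)
    (L : (E' × F) ≃L[ℝ] E) (p H : E) : Prop where
  field_tangent : ∀ α, (L.symm (X α p)).2 = 0
  plane : ∀ ξ, IsSliceNormal G L p ξ →
    christoffelForm G p (comboDual G X ρ p) (comboDual G X ρ p) ξ
      = G p (comboDual G X ρ p) (comboDual G X ρ p) * G p H ξ
  mixed : ∀ ξ, IsSliceNormal G L p ξ → ∀ a, (L.symm a).2 = 0 → (∀ α, G p (X α p) a = 0) →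
    christoffelForm G p (comboDual G X ρ p) a ξ = 0
  perp : ∀ ξ, IsSliceNormal G L p ξ → ∀ a, (L.symm a).2 = 0 → (∀ α, G p (X α p) a = 0) →
    christoffelForm G p a a ξ = G p a a * G p H ξ
  grad : comboSq G X ρ p = 0 → ∀ ξ, IsSliceNormal G L p ξ → fderiv ℝ (comboSq G X ρ) p ξ = 0

/-- The master equation is the umbilicity condition for the direction `comboDual`. Here `a`, `b`,
`c` are the entries of the Gram matrix and `a'`, `b'`, `c'` their derivatives. -/
theorem umbilic_of_master {a b c a' b' c' ρ h : ℝ} (hD : a * c - b * b ≠ 0)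
    (hm : ρ * ρ * (1 / 2 * (a' / (a * c - b * b)
            - a * (a' * c + a * c' - 2 * b * b') / (a * c - b * b) ^ 2) - a / (a * c - b * b) * h)
        + 2 * ρ * (1 / 2 * (b' / (a * c - b * b)
            - b * (a' * c + a * c' - 2 * b * b') / (a * c - b * b) ^ 2) - b / (a * c - b * b) * h)
        + (1 / 2 * (c' / (a * c - b * b)
            - c * (a' * c + a * c' - 2 * b * b') / (a * c - b * b) ^ 2) - c / (a * c - b * b) * h)
        = 0) :
    (c + ρ * b) ^ 2 * (-(1 / 2) * a') - 2 * (c + ρ * b) * (b + ρ * a) * (-(1 / 2) * b')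
        + (b + ρ * a) ^ 2 * (-(1 / 2) * c')
      = ((c + ρ * b) ^ 2 * a - 2 * (c + ρ * b) * (b + ρ * a) * b + (b + ρ * a) ^ 2 * c) * h := by
  generalize hDD : a * c - b * b = D at hD hm
  field_simp at hm
  subst hDD
  linear_combination (1 / 2) * hm

variable {G : E → E →L[ℝ] E →L[ℝ] ℝ} {X : Fin 2 → E → E} {U : Set E} {ρ : ℝ}

/-- `dualVec` written out for the Killing fields. -/
theorem comboDual_eq (h : CoordKilling G X U) {x : E} (hx : x ∈ U) (ρ : ℝ) :
    comboDual G X ρ x = (planeDet (G x) (X 0 x) (X 1 x))⁻¹ •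
      ((G x (X 1 x) (X 1 x) + ρ * G x (X 0 x) (X 1 x)) • X 0 x
        - (G x (X 0 x) (X 1 x) + ρ * G x (X 0 x) (X 0 x)) • X 1 x) := by
  have hs : ∀ v w, G x v w = G x w v := fun v w => h.symm hx v w
  rw [comboDual, dualVec, dualVec, planeDet_comm hs, hs (X 1 x) (X 0 x)]
  module

theorem plane_of_master (h : CoordKilling G X U) {p : E} (hp : p ∈ U) {H ξ : E}
    (hII : ∀ α β, christoffelForm G p (X α p) (X β p) ξ
      = -(1 / 2) * fderiv ℝ (fun x => G x (X α x) (X β x)) p ξ)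
    (hm : ∑ α, ∑ β, rhoCoeff ρ α * rhoCoeff ρ β * ((1 / 2) *
      fderiv ℝ (fun x => (planeDet (G x) (X 0 x) (X 1 x))⁻¹ * G x (X α x) (X β x)) p ξ
        - (planeDet (G p) (X 0 p) (X 1 p))⁻¹ * G p (X α p) (X β p) * G p H ξ) = 0) :
    christoffelForm G p (comboDual G X ρ p) (comboDual G X ρ p) ξ
      = G p (comboDual G X ρ p) (comboDual G X ρ p) * G p H ξ := by
  have hD := (h.det_neg p hp).ne
  have hs : ∀ v w, G p v w = G p w v := fun v w => h.symm hp v w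
  have hdiff : ∀ α β, DifferentiableAt ℝ (fun x => G x (X α x) (X β x)) p := fun α β =>
    ((h.differentiableAt_metric hp).clm_apply (h.differentiableAt_field hp α)).clm_apply
      (h.differentiableAt_field hp β)
  set γ : Fin 2 → Fin 2 → E → ℝ := fun α β x => G x (X α x) (X β x) with hγ
  have hsymm : γ 1 0 =ᶠ[𝓝 p] γ 0 1 := by
    filter_upwards [h.isOpen.mem_nhds hp] with y hy using h.symm hy _ _
  have hDet : HasFDerivAt (fun x => planeDet (G x) (X 0 x) (X 1 x))
      ((γ 0 0 p • fderiv ℝ (γ 1 1) p + γ 1 1 p • fderiv ℝ (γ 0 0) p)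
        - (γ 0 1 p • fderiv ℝ (γ 0 1) p + γ 0 1 p • fderiv ℝ (γ 0 1) p)) p :=
    ((hdiff 0 0).hasFDerivAt.mul (hdiff 1 1).hasFDerivAt).sub
      ((hdiff 0 1).hasFDerivAt.mul (hdiff 0 1).hasFDerivAt)
  have hquot : ∀ α β, fderiv ℝ (fun x => (planeDet (G x) (X 0 x) (X 1 x))⁻¹ * γ α β x) p ξ
      = fderiv ℝ (γ α β) p ξ / planeDet (G p) (X 0 p) (X 1 p)
        - γ α β p * (fderiv ℝ (γ 0 0) p ξ * γ 1 1 p + γ 0 0 p * fderiv ℝ (γ 1 1) p ξ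
          - 2 * γ 0 1 p * fderiv ℝ (γ 0 1) p ξ) / planeDet (G p) (X 0 p) (X 1 p) ^ 2 := by
    intro α β
    have h1 := ((hasDerivAt_inv hD).comp_hasFDerivAt p hDet).mul (hdiff α β).hasFDerivAt
    have h2 : HasFDerivAt (fun x => (planeDet (G x) (X 0 x) (X 1 x))⁻¹ * γ α β x) _ p := h1
    rw [h2.fderiv]
    simp [hγ]
    field_simp
    ring
  simp only [Fin.sum_univ_two, rhoCoeff, Matrix.cons_val_zero, Matrix.cons_val_one] at hm
  have e10 : fderiv ℝ (fun x => (planeDet (G x) (X 0 x) (X 1 x))⁻¹ * G x (X 1 x) (X 0 x)) p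
      = fderiv ℝ (fun x => (planeDet (G x) (X 0 x) (X 1 x))⁻¹ * γ 0 1 x) p := by
    refine Filter.EventuallyEq.fderiv_eq ?_
    filter_upwards [hsymm] with y hy
    rw [← hy]
  rw [e10] at hm
  have q00 := hquot 0 0
  have q01 := hquot 0 1
  have q11 := hquot 1 1
  simp only [hγ] at q00 q01 q11
  simp only [hγ, q00, q01, q11] at hm
  have h00 := hII 0 0
  have h01 := hII 0 1
  have h10 := hII 1 0
  have h11 := hII 1 1
  have f10 : fderiv ℝ (fun x => G x (X 1 x) (X 0 x)) p = fderiv ℝ (fun x => G x (X 0 x) (X 1 x)) p :=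
    Filter.EventuallyEq.fderiv_eq hsymm
  rw [f10] at h10
  have key := umbilic_of_master (a := G p (X 0 p) (X 0 p)) (b := G p (X 0 p) (X 1 p))
    (c := G p (X 1 p) (X 1 p)) (a' := fderiv ℝ (fun x => G x (X 0 x) (X 0 x)) p ξ)
    (b' := fderiv ℝ (fun x => G x (X 0 x) (X 1 x)) p ξ)
    (c' := fderiv ℝ (fun x => G x (X 1 x) (X 1 x)) p ξ) (ρ := ρ) (h := G p H ξ) hD (by
      rw [hs (X 1 p) (X 0 p)] at hm
      simp only [planeDet] at hm
      linear_combination hm)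
  rw [comboDual_eq h hp, sub_eq_add_neg, ← neg_smul]
  simp only [christoffelForm_smul_left, christoffelForm_smul_right, christoffelForm_add_left,
    christoffelForm_add_right, h00, h01, h10, h11, map_smul, map_add, add_apply, smul_apply,
    smul_eq_mul, hs (X 1 p) (X 0 p)]
  linear_combination ((planeDet (G p) (X 0 p) (X 1 p))⁻¹) ^ 2 * key

/-! ### The normal acceleration as a function vanishing on the slice -/

variable (G X ρ) in
/-- The normal component of the Christoffel symbols on the part of `v` orthogonal to `ρ X₀ + X₁`,
corrected by the umbilicity factor read off from the fixed direction `a₀`. It vanishes on vectors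
tangent to the submanifold, and on null vectors orthogonal to `ρ X₀ + X₁` it is minus the transverse
acceleration of the geodesic. -/
def normalDefect (L : (E' × F) ≃L[ℝ] E) (a₀ : E) (q : E × E) : F :=
  (L.symm (spray G q.1 (q.2 - G q.1 (combo X ρ q.1) q.2 • dualVec (G q.1) (X 1 q.1) (X 0 q.1))
      (q.2 - G q.1 (combo X ρ q.1) q.2 • dualVec (G q.1) (X 1 q.1) (X 0 q.1))
    - (G q.1 (q.2 - G q.1 (combo X ρ q.1) q.2 • dualVec (G q.1) (X 1 q.1) (X 0 q.1))
        (q.2 - G q.1 (combo X ρ q.1) q.2 • dualVec (G q.1) (X 1 q.1) (X 0 q.1))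
      / G q.1 (perpPart (G q.1) (X 0 q.1) (X 1 q.1) a₀) (perpPart (G q.1) (X 0 q.1) (X 1 q.1) a₀))
      • spray G q.1 (perpPart (G q.1) (X 0 q.1) (X 1 q.1) a₀)
        (perpPart (G q.1) (X 0 q.1) (X 1 q.1) a₀))).2

theorem normalDefect_of_null {L : (E' × F) ≃L[ℝ] E} {a₀ x v : E} (hR : G x (combo X ρ x) v = 0)
    (hv : G x v v = 0) : normalDefect G X ρ L a₀ (x, v) = (L.symm (spray G x v v)).2 := by
  simp [normalDefect, hR, hv]

theorem comboDual_spec (h : CoordKilling G X U) {x : E} (hx : x ∈ U) (ρ : ℝ) :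
    G x (X 0 x) (comboDual G X ρ x) = 1 ∧ G x (X 1 x) (comboDual G X ρ x) = -ρ := by
  have hs : ∀ v w, G x v w = G x w v := fun v w => h.symm hx v w
  have hD := (h.det_neg x hx).ne
  have hD' : planeDet (G x) (X 1 x) (X 0 x) ≠ 0 := by rwa [planeDet_comm hs]
  simp [comboDual, apply_dualVec_left hD, apply_dualVec_left hD', apply_dualVec_right hs]

theorem comboDual_sq (h : CoordKilling G X U) {x : E} (hx : x ∈ U) (ρ : ℝ) :
    G x (comboDual G X ρ x) (comboDual G X ρ x)
      = comboSq G X ρ x / planeDet (G x) (X 0 x) (X 1 x) := by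
  have hs : ∀ v w, G x v w = G x w v := fun v w => h.symm hx v w
  have hD := (h.det_neg x hx).ne
  obtain ⟨h0, h1⟩ := comboDual_spec h hx ρ
  nth_rw 1 [comboDual_eq h hx]
  simp [h0, h1, comboSq, combo, hs (X 1 x) (X 0 x)]
  field_simp
  ring

section Tangent

variable {L : (E' × F) ≃L[ℝ] E} {p H : E}

theorem tangent_dualVec (hX : ∀ α, (L.symm (X α p)).2 = 0) (α β : Fin 2) :
    (L.symm (dualVec (G p) (X α p) (X β p))).2 = 0 := by
  simp [dualVec, hX]

theorem tangent_comboDual (hX : ∀ α, (L.symm (X α p)).2 = 0) :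
    (L.symm (comboDual G X ρ p)).2 = 0 := by
  simp [comboDual, tangent_dualVec hX]

theorem tangent_perpPart (hX : ∀ α, (L.symm (X α p)).2 = 0) {a : E} (ha : (L.symm a).2 = 0) :
    (L.symm (perpPart (G p) (X 0 p) (X 1 p) a)).2 = 0 := by
  simp [perpPart, tangent_dualVec hX, ha]

/-- A vector orthogonal to all normal vectors of the slice is tangent to it: the gradients of the
transverse coordinates are normal. -/
theorem tangent_of_forall_normal [FiniteDimensional ℝ E] (h : CoordKilling G X U) (hp : p ∈ U)
    {Z : E} (hZ : ∀ ξ, IsSliceNormal G L p ξ → G p Z ξ = 0) : (L.symm Z).2 = 0 := by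
  refine SeparatingDual.eq_zero_of_forall_dual_eq_zero (R := ℝ) fun η => ?_
  let φ : E →L[ℝ] ℝ := (η.comp (ContinuousLinearMap.snd ℝ E' F)).comp (L.symm : E →L[ℝ] E' × F)
  have hφ : ∀ v, G p v ((G p).inverse φ) = η (L.symm v).2 := fun v => by
    rw [h.symm hp, h.metric_inverse hp]; rfl
  rw [← hφ]
  exact hZ _ fun v hv => by rw [hφ, hv, map_zero]

/-- The part `v'` of a tangent vector `v` orthogonal to `ρ X₀ + X₁` is the sum of a multiple of
`comboDual` and of a tangent vector orthogonal to the Killing fields. On such vectors the second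
fundamental form is umbilic, and the direction `a₀` recovers the umbilicity factor. -/
theorem SliceCondition.normalDefect_eq_zero [FiniteDimensional ℝ E] (h : CoordKilling G X U)
    (hp : p ∈ U) (hc : SliceCondition G X ρ L p H) {a₀ v : E} (ha₀ : (L.symm a₀).2 = 0)
    (ha : G p (perpPart (G p) (X 0 p) (X 1 p) a₀) (perpPart (G p) (X 0 p) (X 1 p) a₀) ≠ 0)
    (hv : (L.symm v).2 = 0) : normalDefect G X ρ L a₀ (p, v) = 0 := by
  have hs : ∀ v w, G p v w = G p w v := fun v w => h.symm hp v w
  have hD := (h.det_neg p hp).ne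
  have hD' : planeDet (G p) (X 1 p) (X 0 p) ≠ 0 := by rwa [planeDet_comm hs]
  have hX := hc.field_tangent
  set a := perpPart (G p) (X 0 p) (X 1 p) a₀ with ha_def
  set T := comboDual G X ρ p with hT
  set v' := v - G p (combo X ρ p) v • dualVec (G p) (X 1 p) (X 0 p) with hv'
  have hv't : (L.symm v').2 = 0 := by simp [hv', hv, tangent_dualVec hX]
  obtain ⟨hT0, hT1⟩ := comboDual_spec h hp ρ
  rw [← hT] at hT0 hT1
  -- `v'` is a multiple of `T` plus a tangent vector `b` orthogonal to the Killing fields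
  obtain ⟨b, hb⟩ : ∃ b, b = v' - G p (X 0 p) v' • T := ⟨_, rfl⟩
  have hbt : (L.symm b).2 = 0 := by simp [hb, hv't, hT, tangent_comboDual hX]
  have hb0 : G p (X 0 p) b = 0 := by simp [hb, hT0]
  have hv1 : G p (X 1 p) v' = -ρ * G p (X 0 p) v' := by
    simp [hv', combo, apply_dualVec_left hD', apply_dualVec_right hs]
  have hb1 : G p (X 1 p) b = 0 := by simp [hb, hT1, hv1]; ring
  have hbX : ∀ α, G p (X α p) b = 0 := by intro α; fin_cases α <;> assumption
  have haX : ∀ α, G p (X α p) a = 0 := by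
    intro α; fin_cases α
    · exact apply_perpPart_left hs hD _
    · exact apply_perpPart_right hs hD _
  have hTb : G p T b = 0 := by
    rw [hT, comboDual, dualVec, dualVec]; simp [hb0, hb1]
  have hv'b : v' = G p (X 0 p) v' • T + b := by rw [hb]; abel
  show (L.symm (spray G p v' v' - (G p v' v' / G p a a) • spray G p a a)).2 = 0
  refine tangent_of_forall_normal h hp fun ξ hξ => ?_
  rw [map_sub, map_smul, sub_apply, smul_apply, h.metric_spray hp, h.metric_spray hp,
    hc.perp ξ hξ a (tangent_perpPart hX ha₀) haX]
  have hbT : christoffelForm G p b T ξ = christoffelForm G p T b ξ := by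
    rw [christoffelForm_apply, christoffelForm_apply,
      h.fderiv_metric_symm hp ξ b T]
    ring
  have hTξ := hc.plane ξ hξ
  have hTbξ := hc.mixed ξ hξ b hbt hbX
  rw [← hT] at hTξ hTbξ
  have e1 : christoffelForm G p v' v' ξ = G p v' v' * G p H ξ := by
    generalize G p (X 0 p) v' = k at hv'b
    rw [hv'b]
    simp only [christoffelForm_smul_left, christoffelForm_smul_right, christoffelForm_add_left,
      christoffelForm_add_right, map_smul, map_add, add_apply, smul_apply, smul_eq_mul,
      hc.perp ξ hξ b hbt hbX, hbT, hTbξ, hTξ, hTb, hs b T]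
    ring
  rw [e1, smul_eq_mul]
  field_simp
  ring

end Tangent

set_option maxSynthPendingDepth 3 in
theorem contDiffAt_normalDefect [FiniteDimensional ℝ E] (h : CoordKilling G X U)
    {L : (E' × F) ≃L[ℝ] E} {a₀ x v : E} (hx : x ∈ U)
    (ha : G x (perpPart (G x) (X 0 x) (X 1 x) a₀) (perpPart (G x) (X 0 x) (X 1 x) a₀) ≠ 0) :
    ContDiffAt ℝ 1 (normalDefect G X ρ L a₀) (x, v) := by
  have one_le : (1 : WithTop ℕ∞) ≤ ∞ := le_self_add.trans one_add_one_le_infty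
  have hfst : ContDiffAt ℝ 1 (Prod.fst : E × E → E) (x, v) := contDiffAt_fst
  have hsnd : ContDiffAt ℝ 1 (Prod.snd : E × E → E) (x, v) := contDiffAt_snd
  have hG : ContDiffAt ℝ 1 (fun q : E × E => G q.1) (x, v) :=
    ((h.contDiffAt_metric hx).of_le one_le).comp (x, v) hfst
  have hdG : ContDiffAt ℝ 1 (fun q : E × E => fderiv ℝ G q.1) (x, v) :=
    ((h.contDiffAt_metric hx).fderiv_right (m := 1) one_add_one_le_infty).comp (x, v) hfst
  have hX : ∀ α, ContDiffAt ℝ 1 (fun q : E × E => X α q.1) (x, v) := fun α =>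
    ((h.contDiffAt_field hx α).of_le one_le).comp (x, v) hfst
  have hinv : ContDiffAt ℝ 1 (fun q : E × E => (G q.1).inverse) (x, v) := by
    obtain ⟨f, hf⟩ := h.metric_isInvertible hx
    have h1 : ContDiffAt ℝ 1 (ContinuousLinearMap.inverse : (E →L[ℝ] E →L[ℝ] ℝ) → _) (G x) := by
      rw [← hf]; exact contDiffAt_map_inverse f
    exact ContDiffAt.comp (x, v) h1 hG
  have happ : ∀ {u w : E × E → E}, ContDiffAt ℝ 1 u (x, v) → ContDiffAt ℝ 1 w (x, v) →
      ContDiffAt ℝ 1 (fun q => G q.1 (u q) (w q)) (x, v) := fun hu hw =>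
    (hG.clm_apply hu).clm_apply hw
  have hspray : ∀ {u w : E × E → E}, ContDiffAt ℝ 1 u (x, v) → ContDiffAt ℝ 1 w (x, v) →
      ContDiffAt ℝ 1 (fun q => spray G q.1 (u q) (w q)) (x, v) := fun {u w} hu hw => by
    have hflip : ContDiffAt ℝ 1 (fun q : E × E => ((fderiv ℝ G q.1).flip (u q)).flip (w q))
        (x, v) := by
      have h1 : ContDiffAt ℝ 1 (fun q : E × E => (fderiv ℝ G q.1).flip) (x, v) :=
        (ContinuousLinearMap.flipₗᵢ ℝ E E (E →L[ℝ] ℝ)).contDiff.contDiffAt.comp (x, v) hdG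
      have h2 := (ContinuousLinearMap.flipₗᵢ ℝ E E ℝ).contDiff.contDiffAt.comp (x, v)
        (h1.clm_apply hu)
      exact h2.clm_apply hw
    have hform : ContDiffAt ℝ 1 (fun q => christoffelForm G q.1 (u q) (w q)) (x, v) :=
      ((((hdG.clm_apply hu).clm_apply hw).add ((hdG.clm_apply hw).clm_apply hu)).sub
        hflip).const_smul (1 / 2 : ℝ)
    exact hinv.clm_apply hform
  have hdet : ∀ α β, ContDiffAt ℝ 1 (fun q : E × E => planeDet (G q.1) (X α q.1) (X β q.1))
      (x, v) := fun α β =>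
    ((happ (hX α) (hX α)).mul (happ (hX β) (hX β))).sub
      ((happ (hX α) (hX β)).mul (happ (hX α) (hX β)))
  have hD := (h.det_neg x hx).ne
  have hD' : planeDet (G x) (X 1 x) (X 0 x) ≠ 0 := by
    rwa [planeDet_comm fun v w => h.symm hx v w]
  have hdual : ∀ α β, planeDet (G x) (X α x) (X β x) ≠ 0 →
      ContDiffAt ℝ 1 (fun q : E × E => dualVec (G q.1) (X α q.1) (X β q.1)) (x, v) :=
    fun α β h0 => ((hdet α β).inv h0).smul
      (((happ (hX β) (hX β)).smul (hX α)).sub ((happ (hX α) (hX β)).smul (hX β)))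
  have hcombo : ContDiffAt ℝ 1 (fun q : E × E => combo X ρ q.1) (x, v) :=
    (contDiffAt_const.smul (hX 0)).add (hX 1)
  have hperp : ContDiffAt ℝ 1 (fun q : E × E => perpPart (G q.1) (X 0 q.1) (X 1 q.1) a₀) (x, v) :=
    (contDiffAt_const.sub ((happ (hX 0) contDiffAt_const).smul (hdual 0 1 hD))).sub
      ((happ (hX 1) contDiffAt_const).smul (hdual 1 0 hD'))
  have hv' : ContDiffAt ℝ 1 (fun q : E × E =>
      q.2 - G q.1 (combo X ρ q.1) q.2 • dualVec (G q.1) (X 1 q.1) (X 0 q.1)) (x, v) :=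
    hsnd.sub ((happ hcombo hsnd).smul (hdual 1 0 hD'))
  have hfin := (hspray hv' hv').sub
    (((happ hv' hv').div (happ hperp hperp) ha).smul (hspray hperp hperp))
  exact contDiff_snd.contDiffAt.comp (x, v) (L.symm.contDiff.contDiffAt.comp (x, v) hfin)

end Slice

/-! ### Geodesics tangent to a slice -/

section SliceGeodesic

variable {E E' F : Type*} [NormedAddCommGroup E] [NormedSpace ℝ E]
  [NormedAddCommGroup E'] [NormedSpace ℝ E'] [NormedAddCommGroup F] [NormedSpace ℝ F]
  {G : E → E →L[ℝ] E →L[ℝ] ℝ} {X : Fin 2 → E → E} {U : Set E} {ρ : ℝ}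
  {L : (E' × F) ≃L[ℝ] E} {p H : E}

theorem combo_products (h : CoordKilling G X U) (hp : p ∈ U) (h0 : comboSq G X ρ p = 0) :
    G p (X 0 p) (combo X ρ p) ≠ 0 ∧
      G p (X 1 p) (combo X ρ p) = -ρ * G p (X 0 p) (combo X ρ p) := by
  have hs : ∀ v w, G p v w = G p w v := fun v w => h.symm hp v w
  have hD := h.det_neg p hp
  have h1 : ρ * G p (X 0 p) (combo X ρ p) + G p (X 1 p) (combo X ρ p) = 0 := by
    have : comboSq G X ρ p = ρ * G p (X 0 p) (combo X ρ p) + G p (X 1 p) (combo X ρ p) := by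
      conv_lhs => rw [comboSq]
      conv_lhs => enter [1]; rw [combo]
      simp
    rw [← this, h0]
  refine ⟨fun h2 => ?_, by linarith⟩
  rw [h2, mul_zero, zero_add] at h1
  simp only [combo, map_add, map_smul, smul_eq_mul, hs (X 1 p) (X 0 p)] at h1 h2
  have : planeDet (G p) (X 0 p) (X 1 p) = 0 := by
    rw [planeDet]
    linear_combination G p (X 0 p) (X 0 p) * h1 - G p (X 0 p) (X 1 p) * h2
  linarith

/-- Where `R = ρ X₀ + X₁` is null, a null vector orthogonal to `R` with nonzero energy is a multiple
of `R`: subtracting the multiple of `R` with the same energy leaves a null vector orthogonal to both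
Killing fields. -/
theorem eq_smul_combo_of_null (h : CoordKilling G X U) (hp : p ∈ U) {v : E}
    (h0 : comboSq G X ρ p = 0) (hv : G p v v = 0) (hR : G p (combo X ρ p) v = 0)
    (hE : G p (X 0 p) v ≠ 0) : ∃ k : ℝ, k ≠ 0 ∧ v = k • combo X ρ p := by
  have hs : ∀ v w, G p v w = G p w v := fun v w => h.symm hp v w
  obtain ⟨hl, hl1⟩ := combo_products h hp h0
  have hv1 : G p (X 1 p) v = -ρ * G p (X 0 p) v := by
    simp [combo] at hR; linarith
  refine ⟨G p (X 0 p) v / G p (X 0 p) (combo X ρ p), div_ne_zero hE hl, ?_⟩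
  by_contra hne
  have hw := sub_ne_zero.2 hne
  have hpos := (h.lorentz p hp).pos_of_orthogonal_plane (h.det_neg p hp) (by simp [hl])
    (by simp [hl1, hv1]; field_simp; ring) hw
  rw [comboSq] at h0
  simp [hv, h0, hR, hs v] at hpos

/-- Where `R = ρ X₀ + X₁` is null, the gradient of `⟨R, R⟩` is tangent to the slice. -/
theorem SliceCondition.exists_gradient [FiniteDimensional ℝ E] (h : CoordKilling G X U)
    (hp : p ∈ U) (hc : SliceCondition G X ρ L p H) (h0 : comboSq G X ρ p = 0)
    (hdf : fderiv ℝ (comboSq G X ρ) p ≠ 0) :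
    ∃ W, (L.symm W).2 = 0 ∧ (∀ α, G p (X α p) W = 0) ∧ 0 < G p W W ∧
      fderiv ℝ (comboSq G X ρ) p W = G p W W := by
  have hW : ∀ w, G p ((G p).inverse (fderiv ℝ (comboSq G X ρ) p)) w
      = fderiv ℝ (comboSq G X ρ) p w := fun w => by rw [h.metric_inverse hp]
  have hX : ∀ α, G p (X α p) ((G p).inverse (fderiv ℝ (comboSq G X ρ) p)) = 0 := fun α => by
    rw [h.symm hp, hW, h.fderiv_comboSq_field hp]
  refine ⟨_, tangent_of_forall_normal h hp fun ξ hξ => ?_, hX, ?_, (hW _).symm⟩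
  · rw [hW]; exact hc.grad h0 ξ hξ
  · refine (h.lorentz p hp).pos_of_orthogonal_plane (h.det_neg p hp) (hX 0) (hX 1) fun h1 => hdf ?_
    ext w
    rw [← hW, h1]; simp

/-- If some nonzero null vector with impact parameter `ρ` is tangent to the slice at `p`, then the
slice has a tangent direction orthogonal to the Killing fields. -/
theorem SliceCondition.exists_perp [FiniteDimensional ℝ E] (h : CoordKilling G X U)
    (hp : p ∈ U) (hc : SliceCondition G X ρ L p H) {v : E} (hvt : (L.symm v).2 = 0)
    (hv : G p v v = 0) (hR : G p (combo X ρ p) v = 0) (hE : G p (X 0 p) v ≠ 0)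
    (hreg : comboSq G X ρ p = 0 → fderiv ℝ (comboSq G X ρ) p ≠ 0) :
    ∃ a₀, (L.symm a₀).2 = 0 ∧ G p (perpPart (G p) (X 0 p) (X 1 p) a₀)
      (perpPart (G p) (X 0 p) (X 1 p) a₀) ≠ 0 := by
  have hs : ∀ v w, G p v w = G p w v := fun v w => h.symm hp v w
  have hD := (h.det_neg p hp).ne
  by_cases h0 : comboSq G X ρ p = 0
  · obtain ⟨W, hWt, hWX, hWpos, -⟩ := hc.exists_gradient h hp h0 (hreg h0)
    refine ⟨W, hWt, ?_⟩
    have : perpPart (G p) (X 0 p) (X 1 p) W = W := by simp [perpPart, hWX]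
    rw [this]; exact hWpos.ne'
  · refine ⟨v, hvt, ((h.lorentz p hp).pos_of_orthogonal_plane (h.det_neg p hp)
      (apply_perpPart_left hs hD v) (apply_perpPart_right hs hD v) fun hz => ?_).ne'⟩
    have hv1 : G p (X 1 p) v = -ρ * G p (X 0 p) v := by
      simp [combo] at hR; linarith
    have hvT : v = G p (X 0 p) v • comboDual G X ρ p := by
      rw [perpPart, hv1] at hz
      rw [comboDual, smul_sub, smul_smul, ← sub_eq_zero, ← hz]
      module
    rw [hvT] at hv
    simp only [map_smul, smul_apply, smul_eq_mul, comboDual_sq h hp] at hv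
    simp [hE, h0, hD] at hv

/-- A function that vanishes on the face `ℓ = 0` of the half slice `ℓ ≥ 0`, is nonnegative on the
half slice and has nonzero derivative along the slice has positive inner normal derivative. -/
theorem fderiv_normal_pos {f : E → ℝ} {y₀ e₀ : E'} {ℓ : E' →L[ℝ] ℝ} (he : ℓ e₀ = 1)
    (hy₀ : ℓ y₀ = 0) (hf : DifferentiableAt ℝ f (L (y₀, 0)))
    (hnn : ∀ᶠ y in 𝓝[{y | 0 ≤ ℓ y}] y₀, 0 ≤ f (L (y, 0)) ∧ (ℓ y = 0 → f (L (y, 0)) = 0))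
    {W : E} (hW : (L.symm W).2 = 0) (hfW : fderiv ℝ f (L (y₀, 0)) W ≠ 0) :
    0 < fderiv ℝ f (L (y₀, 0)) (L (e₀, 0)) := by
  have hline : ∀ w : E', HasDerivAt (fun t : ℝ => f (L (y₀ + t • w, 0)))
      (fderiv ℝ f (L (y₀, 0)) (L (w, 0))) 0 := by
    intro w
    have h1 : HasDerivAt (fun t : ℝ => L (y₀ + t • w, (0 : F))) (L (w, 0)) 0 := by
      have h2 : HasDerivAt (fun t : ℝ => (y₀ + t • w, (0 : F))) (w, 0) 0 := by
        refine HasDerivAt.prodMk ?_ (hasDerivAt_const _ _)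
        simpa using ((hasDerivAt_id (0 : ℝ)).smul_const w).const_add y₀
      exact L.hasFDerivAt.comp_hasDerivAt _ h2
    have h3 : HasFDerivAt f (fderiv ℝ f (L (y₀, 0))) (L (y₀ + (0 : ℝ) • w, 0)) := by
      simpa using hf.hasFDerivAt
    exact h3.comp_hasDerivAt _ h1
  have htend : ∀ w : E', Filter.Tendsto (fun t : ℝ => y₀ + t • w) (𝓝 0) (𝓝 y₀) := by
    intro w
    have : Continuous fun t : ℝ => y₀ + t • w := by fun_prop
    simpa using this.tendsto 0
  have hface : ∀ w, ℓ w = 0 → fderiv ℝ f (L (y₀, 0)) (L (w, 0)) = 0 := by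
    intro w hw
    have h1 : (fun t : ℝ => f (L (y₀ + t • w, 0))) =ᶠ[𝓝 0] fun _ => 0 := by
      have h2 : Filter.Tendsto (fun t : ℝ => y₀ + t • w) (𝓝 0) (𝓝[{y | 0 ≤ ℓ y}] y₀) :=
        tendsto_nhdsWithin_iff.2 ⟨htend w, Filter.Eventually.of_forall fun t => by
          simp [hy₀, hw]⟩
      filter_upwards [h2.eventually hnn] with t ht
      exact ht.2 (by simp [hy₀, hw])
    rw [← (hline w).deriv, h1.deriv_eq]; simp
  have hnonneg : 0 ≤ fderiv ℝ f (L (y₀, 0)) (L (e₀, 0)) := by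
    have h1 := (hline e₀).hasDerivWithinAt (s := Set.Ioi 0)
    rw [hasDerivWithinAt_iff_tendsto_slope' (by simp)] at h1
    refine ge_of_tendsto h1 ?_
    have h2 : Filter.Tendsto (fun t : ℝ => y₀ + t • e₀) (𝓝[>] 0) (𝓝[{y | 0 ≤ ℓ y}] y₀) := by
      refine tendsto_nhdsWithin_iff.2 ⟨(htend e₀).mono_left nhdsWithin_le_nhds, ?_⟩
      filter_upwards [self_mem_nhdsWithin] with t ht
      have : (0 : ℝ) < t := ht
      simp [hy₀, he, this.le]
    filter_upwards [h2.eventually hnn, self_mem_nhdsWithin] with t ht ht0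
    have hz : f (L (y₀, 0)) = 0 := (hnn.self_of_nhdsWithin (by simp [hy₀])).2 hy₀
    have : (0 : ℝ) < t := ht0
    simp only [slope, vsub_eq_sub, zero_smul, add_zero, hz, sub_zero, smul_eq_mul]
    exact mul_nonneg (inv_nonneg.2 this.le) ht.1
  refine lt_of_le_of_ne hnonneg fun h0 => hfW ?_
  have hdec : W = L ((L.symm W).1 - ℓ (L.symm W).1 • e₀, 0) + ℓ (L.symm W).1 • L (e₀, 0) := by
    rw [← map_smul, ← map_add]
    apply L.symm.injective
    ext
    · simp
    · simp [hW]
  rw [hdec, map_add, map_smul, hface _ (by simp [he]), ← h0]; simp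

/-- Under the assumptions of `fderiv_normal_pos`, a point at which `f ≥ 0` lies outside the half
slice only as far as it is away from the slice. -/
theorem exists_forall_neg_le {f : E → ℝ} {y₀ e₀ : E'} {ℓ : E' →L[ℝ] ℝ} (he : ℓ e₀ = 1)
    (hy₀ : ℓ y₀ = 0) {A : E →L[ℝ] ℝ} (hf : HasStrictFDerivAt f A (L (y₀, 0)))
    (hnn : ∀ᶠ y in 𝓝[{y | 0 ≤ ℓ y}] y₀, ℓ y = 0 → f (L (y, 0)) = 0)
    (hpos : 0 < A (L (e₀, 0))) :
    ∃ C, 0 ≤ C ∧ ∀ᶠ x in 𝓝 (L (y₀, 0)), 0 ≤ f x →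
      max 0 (-ℓ (L.symm x).1) ≤ C * ‖(L.symm x).2‖ := by
  set α := A (L (e₀, 0)) with hα
  set N := ‖L (e₀, (0 : F))‖ with hN
  set M := ‖(L : E' × F →L[ℝ] E)‖ with hM
  have hN0 : 0 ≤ N := norm_nonneg _
  have hM0 : 0 ≤ M := norm_nonneg _
  set ε := α / (2 * (N + 1)) with hε
  have hε0 : 0 < ε := by positivity
  have hεN : ε * N ≤ α / 2 := by
    rw [hε]
    have : α / (2 * (N + 1)) * N = α / 2 * (N / (N + 1)) := by field_simp
    rw [this]
    have h1 : N / (N + 1) ≤ 1 := by rw [div_le_one (by positivity)]; linarith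
    nlinarith
  refine ⟨2 * (‖A‖ * M + ε * M) / α, by positivity, ?_⟩
  have hproj : Continuous fun x : E =>
      L ((L.symm x).1 - ℓ (L.symm x).1 • e₀, (0 : F)) := by fun_prop
  have hpt : Filter.Tendsto (fun x : E =>
      (x, L ((L.symm x).1 - ℓ (L.symm x).1 • e₀, (0 : F)))) (𝓝 (L (y₀, 0)))
      (𝓝 (L (y₀, 0), L (y₀, 0))) := by
    refine Filter.Tendsto.prodMk_nhds Filter.tendsto_id ?_
    simpa [hy₀] using hproj.tendsto (L (y₀, 0))
  have hface : Filter.Tendsto (fun x : E => (L.symm x).1 - ℓ (L.symm x).1 • e₀) (𝓝 (L (y₀, 0)))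
      (𝓝[{y | 0 ≤ ℓ y}] y₀) := by
    refine tendsto_nhdsWithin_iff.2 ⟨?_, Filter.Eventually.of_forall fun x => by simp [he]⟩
    have : Continuous fun x : E => (L.symm x).1 - ℓ (L.symm x).1 • e₀ := by fun_prop
    simpa [hy₀] using this.tendsto (L (y₀, 0))
  filter_upwards [hpt.eventually (hf.isLittleO.bound hε0), hface.eventually hnn] with x hx hx0 hfx
  have hz0 := norm_nonneg (L.symm x).2
  refine max_le (by positivity) ?_
  set y := (L.symm x).1 with hy
  set z := (L.symm x).2 with hz
  by_cases hneg : 0 ≤ ℓ y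
  · have : 0 ≤ 2 * (‖A‖ * M + ε * M) / α * ‖z‖ := by positivity
    linarith
  push Not at hneg
  have hfb : f (L (y - ℓ y • e₀, 0)) = 0 := hx0 (by simp [he])
  have hdiff : x - L (y - ℓ y • e₀, (0 : F)) = ℓ y • L (e₀, (0 : F)) + L (0, z) := by
    have : x = L (y, z) := by simp [hy, hz]
    conv_lhs => rw [this]
    rw [← map_smul, ← map_sub, ← map_add]
    congr 1
    ext <;> simp
  rw [hfb, sub_zero, hdiff, map_add, map_smul, smul_eq_mul, ← hα, Real.norm_eq_abs] at hx
  have hLz : ‖L ((0 : E'), z)‖ ≤ M * ‖z‖ := by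
    have := (L : E' × F →L[ℝ] E).le_opNorm ((0 : E'), z)
    simpa [Prod.norm_def] using this
  have hALz : A (L (0, z)) ≤ ‖A‖ * (M * ‖z‖) :=
    (le_abs_self _).trans ((A.le_opNorm _).trans (by gcongr))
  have hsum : ‖ℓ y • L (e₀, (0 : F)) + L (0, z)‖ ≤ -ℓ y * N + M * ‖z‖ := by
    refine (norm_add_le _ _).trans (add_le_add ?_ hLz)
    rw [norm_smul, Real.norm_eq_abs, abs_of_neg hneg]
  have h1 := (abs_le.1 hx).2
  have h2 : f x ≤ ℓ y * α + ‖A‖ * (M * ‖z‖) + ε * (-ℓ y * N + M * ‖z‖) := by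
    have := mul_le_mul_of_nonneg_left hsum hε0.le
    linarith
  have h3 : -ℓ y * α ≤ 2 * (‖A‖ * M + ε * M) * ‖z‖ := by nlinarith
  rw [div_mul_eq_mul_div, le_div_iff₀ hpos]
  exact h3

/-- A null geodesic with impact parameter `ρ` that touches the half slice `L ({ℓ ≥ 0} × 0)` stays
in it for short times. Its normal acceleration is bounded by its distance to the half slice in
position and velocity, so the distance satisfies a second order differential inequality. -/
theorem eventually_mem_slice [FiniteDimensional ℝ E] (h : CoordKilling G X U) {y₀ e₀ : E'}
    {ℓ : E' →L[ℝ] ℝ} (he : ℓ e₀ = 1) (hy₀ : 0 ≤ ℓ y₀)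
    (hslice : ∀ᶠ y in 𝓝[{y | 0 ≤ ℓ y}] y₀, (∃ H, SliceCondition G X ρ L (L (y, 0)) H) ∧
      0 ≤ comboSq G X ρ (L (y, 0)) ∧ (ℓ y = 0 → comboSq G X ρ (L (y, 0)) = 0))
    {c : ℝ → E} {s : ℝ} (hc : ContDiffAt ℝ ∞ c s) (hcs : c s = L (y₀, 0)) (hsU : c s ∈ U)
    (hc's : (L.symm (deriv c s)).2 = 0)
    (hgeo : ∀ᶠ t in 𝓝 s, ∀ w, G (c t) (deriv (deriv c) t) w
      + christoffelForm G (c t) (deriv c t) (deriv c t) w = 0)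
    (hnull : ∀ᶠ t in 𝓝 s, G (c t) (deriv c t) (deriv c t) = 0)
    (hR : ∀ᶠ t in 𝓝 s, G (c t) (combo X ρ (c t)) (deriv c t) = 0)
    (hE : G (c s) (X 0 (c s)) (deriv c s) ≠ 0)
    (hreg : comboSq G X ρ (c s) = 0 → fderiv ℝ (comboSq G X ρ) (c s) ≠ 0) :
    ∀ᶠ t in 𝓝 s, (L.symm (c t)).2 = 0 ∧ 0 ≤ ℓ (L.symm (c t)).1 ∧
      (L.symm (deriv c t)).2 = 0 := by
  have one_le : (1 : WithTop ℕ∞) ≤ ∞ := le_self_add.trans one_add_one_le_infty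
  have hcU : ∀ᶠ t in 𝓝 s, c t ∈ U := hc.continuousAt.eventually (h.isOpen.mem_nhds hsU)
  have hcd : ∀ᶠ t in 𝓝 s, ContDiffAt ℝ 2 c t :=
    (hc.of_le (by rw [← one_add_one_eq_two]; exact one_add_one_le_infty)).eventually (by simp)
  have hcd' : ∀ᶠ t in 𝓝 s, HasDerivAt c (deriv c t) t ∧
      HasDerivAt (deriv c) (deriv (deriv c) t) t := by
    filter_upwards [hcd] with t ht
    refine ⟨(ht.differentiableAt (by simp)).hasDerivAt, ?_⟩
    have h1 : ContDiffAt ℝ 1 (deriv c) t := by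
      have h2 : ContDiffAt ℝ 1 (fderiv ℝ c) t := ht.fderiv_right (by rw [one_add_one_eq_two])
      exact h2.clm_apply contDiffAt_const
    exact (h1.differentiableAt (by simp)).hasDerivAt
  have hfd := (h.contDiffAt_comboSq hsU ρ)
  obtain ⟨H, hH⟩ := (hslice.self_of_nhdsWithin hy₀).1
  rw [← hcs] at hH
  have hv := hnull.self_of_nhds
  have hRs := hR.self_of_nhds
  -- outside the half slice, the depth is controlled by the transverse coordinate
  obtain ⟨C, hC0, hC⟩ : ∃ C, 0 ≤ C ∧ ∀ᶠ t in 𝓝 s,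
      max 0 (-ℓ (L.symm (c t)).1) ≤ C * ‖(L.symm (c t)).2‖ := by
    rcases hy₀.eq_or_lt with h0 | h0
    · have hf0 : comboSq G X ρ (c s) = 0 := by
        rw [hcs]; exact (hslice.self_of_nhdsWithin hy₀).2.2 h0.symm
      obtain ⟨W, hWt, -, hWpos, hfW⟩ := hH.exists_gradient h hsU hf0 (hreg hf0)
      have hpos : 0 < fderiv ℝ (comboSq G X ρ) (L (y₀, 0)) (L (e₀, 0)) := by
        refine fderiv_normal_pos he h0.symm ?_ (hslice.mono fun y hy => hy.2) hWt ?_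
        · rw [← hcs]; exact hfd.differentiableAt (by simp)
        · rw [← hcs, hfW]; exact hWpos.ne'
      obtain ⟨C, hC0, hC⟩ := exists_forall_neg_le he h0.symm
        (by rw [← hcs]; exact hfd.hasStrictFDerivAt (by simp))
        (hslice.mono fun y hy => hy.2.2) hpos
      obtain ⟨k, hk, hck⟩ := eq_smul_combo_of_null h hsU hf0 hv hRs hE
      have hfc := h.eventually_comboSq_nonneg hc hsU hgeo.self_of_nhds hk hck hf0 (hreg hf0)
      rw [← hcs] at hC
      refine ⟨C, hC0, ?_⟩
      filter_upwards [hc.continuousAt.eventually hC, hfc] with t h1 h2 using h1 h2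
    · refine ⟨0, le_rfl, ?_⟩
      have : ContinuousAt (fun t => ℓ (L.symm (c t)).1) s := by
        have h2 : Continuous fun x => ℓ (L.symm x).1 := by fun_prop
        exact h2.continuousAt.comp hc.continuousAt
      have h3 : ∀ᶠ t in 𝓝 s, 0 < ℓ (L.symm (c t)).1 :=
        this.eventually (lt_mem_nhds (by simpa [hcs] using h0))
      filter_upwards [h3] with t ht
      simp [ht.le]
  -- the normal acceleration
  obtain ⟨a₀, ha₀, ha⟩ := hH.exists_perp h hsU hc's hv hRs hE hreg
  obtain ⟨K, V, hV, hK⟩ := (contDiffAt_normalDefect (ρ := ρ) (L := L) (v := deriv c s) h hsU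
    ha).exists_lipschitzOnWith
  have hc'cont : ContinuousAt (deriv c) s := hcd'.self_of_nhds.2.continuousAt
  let Y : ℝ → E' := fun t => (L.symm (c t)).1 + max 0 (-ℓ (L.symm (c t)).1) • e₀
  have hYs : Y s = y₀ := by simp [Y, hcs, hy₀]
  have hYc : ContinuousAt Y s := by
    have h2 : Continuous fun x : E => (L.symm x).1 + max 0 (-ℓ (L.symm x).1) • e₀ := by fun_prop
    exact h2.continuousAt.comp hc.continuousAt
  have hYR : ∀ t, 0 ≤ ℓ (Y t) := by
    intro t
    simp only [Y, map_add, map_smul, he, smul_eq_mul, mul_one]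
    linarith [le_max_right 0 (-ℓ (L.symm (c t)).1)]
  have hYtend : Filter.Tendsto Y (𝓝 s) (𝓝[{y | 0 ≤ ℓ y}] y₀) := by
    refine tendsto_nhdsWithin_iff.2 ⟨by simpa [hYs] using hYc.tendsto, ?_⟩
    exact Filter.Eventually.of_forall hYR
  have hQ : ContinuousAt (fun t => (L (Y t, (0 : F)), L ((L.symm (deriv c t)).1, (0 : F)))) s := by
    refine ContinuousAt.prodMk ?_ ?_
    · exact (L.continuous.comp (by fun_prop : Continuous fun y : E' => (y, (0 : F)))).continuousAt.comp
        hYc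
    · have h2 : Continuous fun x : E => L ((L.symm x).1, (0 : F)) := by fun_prop
      exact h2.continuousAt.comp hc'cont
  have hLs : L ((L.symm (deriv c s)).1, (0 : F)) = deriv c s := by
    rw [← hc's]; simp
  have hQV : ∀ᶠ t in 𝓝 s, (L (Y t, (0 : F)), L ((L.symm (deriv c t)).1, (0 : F))) ∈ V := by
    refine hQ.eventually_mem ?_
    rw [hYs, hLs, ← hcs]; exact hV
  have hcV : ∀ᶠ t in 𝓝 s, (c t, deriv c t) ∈ V :=
    (hc.continuousAt.prodMk hc'cont).eventually_mem hV
  have hQU : ∀ᶠ t in 𝓝 s, L (Y t, (0 : F)) ∈ U ∧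
      G (L (Y t, 0)) (perpPart (G (L (Y t, 0))) (X 0 (L (Y t, 0))) (X 1 (L (Y t, 0))) a₀)
        (perpPart (G (L (Y t, 0))) (X 0 (L (Y t, 0))) (X 1 (L (Y t, 0))) a₀) ≠ 0 := by
    have h1 : ∀ᶠ x in 𝓝 (c s), x ∈ U ∧ G x (perpPart (G x) (X 0 x) (X 1 x) a₀)
        (perpPart (G x) (X 0 x) (X 1 x) a₀) ≠ 0 := by
      have hU' : ∀ᶠ x in 𝓝 (c s), x ∈ U := h.isOpen.mem_nhds hsU
      refine hU'.and (ContinuousAt.eventually_ne ?_ ha)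
      have hX := fun α => (h.contDiffAt_field hsU α).continuousAt
      have hG := (h.contDiffAt_metric hsU).continuousAt
      have happ : ∀ {u w : E → E}, ContinuousAt u (c s) → ContinuousAt w (c s) →
          ContinuousAt (fun x => G x (u x) (w x)) (c s) := fun hu hw =>
        (hG.clm_apply hu).clm_apply hw
      have hD := (h.det_neg _ hsU).ne
      have hD' : planeDet (G (c s)) (X 1 (c s)) (X 0 (c s)) ≠ 0 := by
        rwa [planeDet_comm fun v w => h.symm hsU v w]
      have hdual : ∀ α β, planeDet (G (c s)) (X α (c s)) (X β (c s)) ≠ 0 →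
          ContinuousAt (fun x => dualVec (G x) (X α x) (X β x)) (c s) := fun α β h0 =>
        ((((happ (hX α) (hX α)).mul (happ (hX β) (hX β))).sub
          ((happ (hX α) (hX β)).mul (happ (hX α) (hX β)))).inv₀ h0).smul
          (((happ (hX β) (hX β)).smul (hX α)).sub ((happ (hX α) (hX β)).smul (hX β)))
      have hperp : ContinuousAt (fun x => perpPart (G x) (X 0 x) (X 1 x) a₀) (c s) :=
        (continuousAt_const.sub ((happ (hX 0) continuousAt_const).smul (hdual 0 1 hD))).sub
          ((happ (hX 1) continuousAt_const).smul (hdual 1 0 hD'))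
      exact happ hperp hperp
    have h2 : Filter.Tendsto (fun t => L (Y t, (0 : F))) (𝓝 s) (𝓝 (c s)) := by
      have := (L.continuous.comp
        (by fun_prop : Continuous fun y : E' => (y, (0 : F)))).continuousAt.comp hYc
      have h3 := this.tendsto
      simp only [Function.comp_def, hYs, ← hcs] at h3
      exact h3
    exact h2.eventually h1
  set M := ‖(L : E' × F →L[ℝ] E)‖ with hM
  have hM0 : 0 ≤ M := norm_nonneg _
  have hbound : ∀ᶠ t in 𝓝 s, ‖(L.symm (deriv (deriv c) t)).2‖ ≤
      (K * (M * (C * ‖e₀‖ + 1))) * (‖(L.symm (c t)).2‖ + ‖(L.symm (deriv c t)).2‖) := by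
    filter_upwards [hcU, hgeo, hnull, hR, hC, hQV, hcV, hQU, hYtend.eventually hslice] with
      t htU htgeo htnull htR htC htQ htc ⟨htQU, hta⟩ ⟨⟨H', hH'⟩, _⟩
    have hacc : deriv (deriv c) t = -spray G (c t) (deriv c t) (deriv c t) := by
      refine h.eq_of_metric_eq htU fun w => ?_
      rw [map_neg, neg_apply, h.metric_spray htU]
      linarith [htgeo w]
    have hzero := hH'.normalDefect_eq_zero h htQU ha₀ hta
      (v := L ((L.symm (deriv c t)).1, (0 : F))) (by simp)
    have hlip := hK.dist_le_mul _ htc _ htQ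
    rw [hzero, normalDefect_of_null htR htnull, dist_zero_right] at hlip
    rw [hacc, map_neg, Prod.snd_neg, norm_neg]
    refine hlip.trans ?_
    rw [mul_assoc]
    refine mul_le_mul_of_nonneg_left ?_ K.2
    have hz := norm_nonneg (L.symm (c t)).2
    have hz' := norm_nonneg (L.symm (deriv c t)).2
    have he0 := norm_nonneg e₀
    rw [dist_eq_norm, Prod.norm_def]
    refine max_le ?_ ?_
    · have e1 : c t - L (Y t, (0 : F))
          = L (-(max 0 (-ℓ (L.symm (c t)).1) • e₀), (L.symm (c t)).2) := by
        apply L.symm.injective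
        ext <;> simp [Y]
      simp only [Prod.fst_sub]
      rw [e1]
      refine ((L : E' × F →L[ℝ] E).le_opNorm _).trans ?_
      rw [mul_assoc]
      refine mul_le_mul_of_nonneg_left ?_ hM0
      rw [Prod.norm_def]
      refine max_le ?_ ?_
      · simp only [norm_neg, norm_smul, Real.norm_eq_abs, abs_of_nonneg (le_max_left (0 : ℝ) _)]
        have h1 := mul_le_mul_of_nonneg_right htC he0
        have h2 : 0 ≤ C * ‖e₀‖ := by positivity
        nlinarith
      · have h2 : 0 ≤ C * ‖e₀‖ := by positivity
        simp only
        nlinarith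
    · have e1 : deriv c t - L ((L.symm (deriv c t)).1, (0 : F))
          = L (0, (L.symm (deriv c t)).2) := by
        apply L.symm.injective
        ext <;> simp
      simp only [Prod.snd_sub]
      rw [e1]
      refine ((L : E' × F →L[ℝ] E).le_opNorm _).trans ?_
      rw [mul_assoc]
      refine mul_le_mul_of_nonneg_left ?_ hM0
      have h2 : 0 ≤ C * ‖e₀‖ := by positivity
      simp only [Prod.norm_def, norm_zero]
      rw [max_eq_right hz']
      nlinarith
  have hlin : ∀ {u : ℝ → E} {u' : E} {t : ℝ}, HasDerivAt u u' t →
      HasDerivAt (fun t => (L.symm (u t)).2) (L.symm u').2 t := fun hu =>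
    ((ContinuousLinearMap.snd ℝ E' F).comp (L.symm : E →L[ℝ] E' × F)).hasFDerivAt.comp_hasDerivAt
      _ hu
  have hfinal := eventually_eq_zero_of_second_order
    (hcd'.mono fun t ht => hlin ht.1) (hcd'.mono fun t ht => hlin ht.2) hbound
    (by simp [hcs]) hc's
  filter_upwards [hfinal, hC] with t ⟨h1, h2⟩ h3
  refine ⟨h1, ?_, h2⟩
  rw [h1, norm_zero, mul_zero] at h3
  linarith [le_max_right 0 (-ℓ (L.symm (c t)).1)]

end SliceGeodesic

/-! ### Stationary axisymmetric spacetimes in charts -/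

section Charts

variable {m : ℕ} {M : Type*} [TopologicalSpace M] [ChartedSpace (EuclideanSpace ℝ (Fin m)) M]
  {e : OpenPartialHomeomorph M (EuclideanSpace ℝ (Fin m))}

theorem chart_mdifferentiable (he : e ∈ IsManifold.maximalAtlas (𝓡 m) ∞ M) :
    e.MDifferentiable (𝓡 m) (𝓡 m) :=
  ⟨(contMDiffOn_of_mem_maximalAtlas he).mdifferentiableOn (by simp),
    (contMDiffOn_symm_of_mem_maximalAtlas he).mdifferentiableOn (by simp)⟩

/-- The differential of a chart at `p`, as a map into the model space. -/
def chartDiff (e : OpenPartialHomeomorph M (EuclideanSpace ℝ (Fin m))) (p : M)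
    (v : TangentSpace (𝓡 m) p) : EuclideanSpace ℝ (Fin m) :=
  mfderiv (𝓡 m) (𝓡 m) e p v

theorem chartDiff_zero (p : M) : chartDiff e p 0 = 0 := map_zero (mfderiv (𝓡 m) (𝓡 m) e p)

theorem chartDiff_add (p : M) (v w : TangentSpace (𝓡 m) p) :
    chartDiff e p (v + w) = chartDiff e p v + chartDiff e p w :=
  map_add (mfderiv (𝓡 m) (𝓡 m) e p) v w

theorem chartDiff_smul (p : M) (c : ℝ) (v : TangentSpace (𝓡 m) p) :
    chartDiff e p (c • v) = c • chartDiff e p v :=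
  map_smul (mfderiv (𝓡 m) (𝓡 m) e p) c v

theorem coordField_apply (X : VField m M) {p : M} (hp : p ∈ e.source) :
    coordField X e (e p) = chartDiff e p (X p) := by
  have key : ∀ q : M, q = p → chartDiff e q (X q) = chartDiff e p (X p) := by rintro q rfl; rfl
  exact key _ (e.left_inv hp)

theorem symm_chartDiff (he : e ∈ IsManifold.maximalAtlas (𝓡 m) ∞ M) {p : M} (hp : p ∈ e.source)
    (v : TangentSpace (𝓡 m) p) :
    mfderiv (𝓡 m) (𝓡 m) e.symm (e p) (chartDiff e p v) = v :=
  congrArg (fun A => A v) ((chart_mdifferentiable he).symm_comp_deriv hp)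

theorem chartDiff_symm (he : e ∈ IsManifold.maximalAtlas (𝓡 m) ∞ M) {x : EuclideanSpace ℝ (Fin m)}
    (hx : x ∈ e.target) (v : EuclideanSpace ℝ (Fin m)) :
    chartDiff e (e.symm x) (mfderiv (𝓡 m) (𝓡 m) e.symm x v) = v :=
  congrArg (fun A => A v) ((chart_mdifferentiable he).comp_symm_deriv hx)

theorem chartDiff_injective (he : e ∈ IsManifold.maximalAtlas (𝓡 m) ∞ M) {p : M}
    (hp : p ∈ e.source) : Function.Injective (chartDiff e p) := fun v w hvw => by
  rw [← symm_chartDiff he hp v, hvw, symm_chartDiff he hp]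

variable [IsManifold (𝓡 m) ∞ M]

theorem inner_eq_coordMetric (g : LorentzMetric m M) (he : e ∈ IsManifold.maximalAtlas (𝓡 m) ∞ M)
    {p : M} (hp : p ∈ e.source) (u v : TangentSpace (𝓡 m) p) :
    g.inner p u v = coordMetric g e (e p) (chartDiff e p u) (chartDiff e p v) := by
  have h1 : coordMetric g e (e p) (chartDiff e p u) (chartDiff e p v)
    = g.inner (e.symm (e p)) (mfderiv (𝓡 m) (𝓡 m) e.symm (e p) (chartDiff e p u))
      (mfderiv (𝓡 m) (𝓡 m) e.symm (e p) (chartDiff e p v)) := rfl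
  have key : ∀ q : M, q = p → ∀ u' v' : EuclideanSpace ℝ (Fin m),
      (g.inner q : EuclideanSpace ℝ (Fin m) →L[ℝ] EuclideanSpace ℝ (Fin m) →L[ℝ] ℝ) u' v'
      = (g.inner p : EuclideanSpace ℝ (Fin m) →L[ℝ] EuclideanSpace ℝ (Fin m) →L[ℝ] ℝ) u' v' := by
    rintro q rfl u' v'; rfl
  rw [h1, symm_chartDiff he hp, symm_chartDiff he hp]
  exact (key _ (e.left_inv hp) u v).symm

theorem coordMetric_lorentz (g : LorentzMetric m M) (he : e ∈ IsManifold.maximalAtlas (𝓡 m) ∞ M)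
    {x : EuclideanSpace ℝ (Fin m)} (hx : x ∈ e.target) :
    IsLorentzForm (fun v w => coordMetric g e x v w) := by
  obtain ⟨hs, t, ht, hpos⟩ := g.lorentz (e.symm x)
  have hp := e.map_target hx
  have hin := fun u v => inner_eq_coordMetric g he hp u v
  rw [e.right_inv hx] at hin
  refine ⟨fun v w => hs _ _, chartDiff e _ t, ?_, fun w hw htw => ?_⟩
  · change coordMetric g e x _ _ < 0
    rw [← hin]; exact ht
  · have hw' := chartDiff_symm he hx w
    rw [← hw'] at hw htw ⊢
    change coordMetric g e x _ _ = 0 at htw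
    change 0 < coordMetric g e x _ _
    rw [← hin] at htw ⊢
    refine hpos _ (fun h0 => hw ?_) htw
    rw [h0, chartDiff_zero]

theorem contMDiffOn_coordVector (he : e ∈ IsManifold.maximalAtlas (𝓡 m) ∞ M)
    (v : EuclideanSpace ℝ (Fin m)) :
    ContMDiffOn (𝓡 m) (𝓡 m).tangent ∞ (fun x : EuclideanSpace ℝ (Fin m) =>
      (⟨e.symm x, mfderiv (𝓡 m) (𝓡 m) e.symm x v⟩ : TangentBundle (𝓡 m) M)) e.target := by
  have h1 := (contMDiffOn_symm_of_mem_maximalAtlas he).contMDiffOn_tangentMapWithin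
    (m := ∞) (by simp) e.open_target.uniqueMDiffOn
  have h2 : ContMDiff (𝓡 m) (𝓡 m).tangent ∞ (fun x : EuclideanSpace ℝ (Fin m) =>
      (⟨x, v⟩ : TangentBundle (𝓡 m) (EuclideanSpace ℝ (Fin m)))) :=
    contMDiff_vectorSpace_iff_contDiff.2 contDiff_const
  refine (h1.comp h2.contMDiffOn (s := e.target) fun x hx => hx).congr fun x hx => ?_
  simp only [Function.comp, tangentMapWithin]
  rw [mfderivWithin_of_isOpen e.open_target hx]

theorem contDiffOn_coordMetric (g : LorentzMetric m M)
    (he : e ∈ IsManifold.maximalAtlas (𝓡 m) ∞ M) : ContDiffOn ℝ ∞ (coordMetric g e) e.target := by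
  refine contDiffOn_clm_apply.2 fun u => contDiffOn_clm_apply.2 fun v => ?_
  have h1 := (g.contMDiff.contMDiffOn (s := Set.univ)).comp
    (contMDiffOn_symm_of_mem_maximalAtlas he) fun x _ => Set.mem_univ _
  have h2 := ContMDiffOn.clm_bundle_apply₂ (F₁ := EuclideanSpace ℝ (Fin m))
    (F₂ := EuclideanSpace ℝ (Fin m)) (F₃ := ℝ) (E₁ := TangentSpace (𝓡 m) (M := M))
    (E₂ := TangentSpace (𝓡 m) (M := M)) (E₃ := Bundle.Trivial M ℝ) (b := e.symm)
    (ψ := fun x => g.inner (e.symm x))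
    h1 (contMDiffOn_coordVector he u) (contMDiffOn_coordVector he v)
  rw [← contMDiffOn_iff_contDiffOn]
  intro x hx
  have h3 := (Bundle.contMDiffWithinAt_totalSpace.1 (h2 x hx)).2
  exact h3

theorem contDiffOn_coordField {X : VField m M} (he : e ∈ IsManifold.maximalAtlas (𝓡 m) ∞ M)
    (hX : ContMDiff (𝓡 m) (𝓡 m).tangent ∞ (fun p => (⟨p, X p⟩ : TangentBundle (𝓡 m) M))) :
    ContDiffOn ℝ ∞ (coordField X e) e.target := by
  have h1 := (contMDiffOn_of_mem_maximalAtlas he).contMDiffOn_tangentMapWithin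
    (m := ∞) (by simp) e.open_source.uniqueMDiffOn
  have h2 := h1.comp (hX.contMDiffOn (s := e.source)) fun x hx => hx
  have h3 := h2.comp (contMDiffOn_symm_of_mem_maximalAtlas he) fun x hx => e.map_target hx
  have h4 := contMDiff_snd_tangentBundle_modelSpace (EuclideanSpace ℝ (Fin m)) (𝓡 m) (n := ∞)
  have h5 := h4.comp_contMDiffOn h3
  rw [← contMDiffOn_iff_contDiffOn]
  refine h5.congr fun x hx => ?_
  simp only [Function.comp, tangentMapWithin]
  rw [mfderivWithin_of_isOpen e.open_source (e.map_target hx)]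
  rfl

theorem coordField_commute {X Y : VField m M} (he : e ∈ IsManifold.maximalAtlas (𝓡 m) ∞ M)
    (hX : ContMDiff (𝓡 m) (𝓡 m).tangent ∞ (fun p => (⟨p, X p⟩ : TangentBundle (𝓡 m) M)))
    (hY : ContMDiff (𝓡 m) (𝓡 m).tangent ∞ (fun p => (⟨p, Y p⟩ : TangentBundle (𝓡 m) M)))
    (hXY : ∀ p, VectorField.mlieBracket (𝓡 m) X Y p = 0) {x : EuclideanSpace ℝ (Fin m)}
    (hx : x ∈ e.target) :
    fderiv ℝ (coordField Y e) x (coordField X e x)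
      = fderiv ℝ (coordField X e) x (coordField Y e x) := by
  have h2le : minSmoothness ℝ 2 ≤ (∞ : WithTop ℕ∞) := by
    rw [minSmoothness_of_isRCLikeNormedField, ← one_add_one_eq_two]
    exact one_add_one_le_infty
  have : IsManifold (𝓡 m) (minSmoothness ℝ 2) M := IsManifold.of_le h2le
  have h1 := VectorField.mpullback_mlieBracket (I := 𝓡 m) (I' := 𝓡 m) (f := e.symm) (x₀ := x)
    (n := ∞) ((hX _).mdifferentiableAt (by simp)) ((hY _).mdifferentiableAt (by simp))
    (contMDiffAt_symm_of_mem_maximalAtlas he hx) h2le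
  have h2 : VectorField.mpullback (𝓡 m) (𝓡 m) e.symm (VectorField.mlieBracket (𝓡 m) X Y) x = 0 := by
    rw [VectorField.mpullback_apply, hXY, map_zero]
  have hpull : ∀ Z : VField m M,
      VectorField.mpullback (𝓡 m) (𝓡 m) e.symm Z =ᶠ[𝓝 x] coordField Z e := by
    intro Z
    filter_upwards [e.open_target.mem_nhds hx] with y hy
    have hinj : mfderiv (𝓡 m) (𝓡 m) e.symm y (coordField Z e y) = Z (e.symm y) := by
      have := symm_chartDiff he (e.map_target hy) (Z (e.symm y))
      rw [e.right_inv hy] at this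
      exact this
    rw [VectorField.mpullback_apply, ← hinj]
    have hinv : (mfderiv (𝓡 m) (𝓡 m) e.symm y).IsInvertible := by
      exact ⟨(chart_mdifferentiable he).symm.mfderiv hy, rfl⟩
    exact congrArg (fun A => A (coordField Z e y)) hinv.inverse_comp_self
  rw [h2, ← VectorField.mlieBracketWithin_univ,
    Filter.EventuallyEq.mlieBracketWithin_vectorField_eq_nhds (hpull X) (hpull Y) ] at h1
  have h3 : VectorField.mlieBracketWithin (𝓡 m) (coordField X e) (coordField Y e) Set.univ x
    = VectorField.lieBracketWithin ℝ (coordField X e) (coordField Y e) Set.univ x :=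
    congrFun VectorField.mlieBracketWithin_eq_lieBracketWithin x
  have h4 := h1.trans h3
  rw [VectorField.lieBracketWithin_univ, VectorField.lieBracket] at h4
  exact sub_eq_zero.1 h4.symm

end Charts

section ChartTranslation

variable {m : ℕ} {M : Type*} [TopologicalSpace M] [ChartedSpace (EuclideanSpace ℝ (Fin m)) M]
  {e : OpenPartialHomeomorph M (EuclideanSpace ℝ (Fin m))}

theorem chartDiff_eq_fderiv (he : e ∈ IsManifold.maximalAtlas (𝓡 m) ∞ M) {h : M → ℝ} {p : M}
    (hp : p ∈ e.source) (hh : DifferentiableAt ℝ (fun x => h (e.symm x)) (e p))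
    (ξ : TangentSpace (𝓡 m) p) :
    dirDeriv h p ξ = fderiv ℝ (fun x => h (e.symm x)) (e p) (chartDiff e p ξ) := by
  have h1 : HasMFDerivAt (𝓡 m) 𝓘(ℝ, ℝ) (fun x => h (e.symm x)) (e p)
      (fderiv ℝ (fun x => h (e.symm x)) (e p)) := hh.hasFDerivAt.hasMFDerivAt
  have h2 := ((chart_mdifferentiable he).mdifferentiableAt hp).hasMFDerivAt
  have h3 := h1.comp p h2
  have h4 : h =ᶠ[𝓝 p] (fun x => h (e.symm x)) ∘ e := by
    filter_upwards [e.open_source.mem_nhds hp] with q hq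
    simp [e.left_inv hq]
  have h5 := h3.congr_of_eventuallyEq h4
  rw [dirDeriv, h5.mfderiv]
  rfl

theorem hasDerivAt_chart_comp (he : e ∈ IsManifold.maximalAtlas (𝓡 m) ∞ M) {γ : ℝ → M} {t : ℝ}
    (hγ : MDifferentiableAt 𝓘(ℝ, ℝ) (𝓡 m) γ t) (ht : γ t ∈ e.source) :
    HasDerivAt (fun s => e (γ s)) (chartDiff e (γ t) (velocity γ t)) t := by
  have h2 := ((chart_mdifferentiable he).mdifferentiableAt ht).hasMFDerivAt
  have h3 := h2.comp t hγ.hasMFDerivAt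
  let A : ℝ →L[ℝ] EuclideanSpace ℝ (Fin m) :=
    (mfderiv (𝓡 m) (𝓡 m) e (γ t)).comp (mfderiv 𝓘(ℝ, ℝ) (𝓡 m) γ t)
  have h4 : HasFDerivAt (fun s => e (γ s)) A t := h3.hasFDerivAt
  exact h4.hasDerivAt

variable {K : Fin 2 → VField m M}

theorem rhoHat_eq (K : Fin 2 → VField m M) (ρ : ℝ) (p : M) :
    rhoHat K ρ p = ρ • K 0 p + K 1 p := by
  simp [rhoHat, rhoCoeff, Fin.sum_univ_two]

theorem chartDiff_rhoHat (ρ : ℝ) {p : M} (hp : p ∈ e.source) :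
    chartDiff e p (rhoHat K ρ p) = combo (fun α => coordField (K α) e) ρ (e p) := by
  rw [rhoHat_eq, chartDiff_add, chartDiff_smul, combo, coordField_apply _ hp, coordField_apply _ hp]

variable [IsManifold (𝓡 m) ∞ M] (g : LorentzMetric m M)

theorem christoffel_eq (x u v w : EuclideanSpace ℝ (Fin m)) :
    christoffel g e x u v w = christoffelForm (coordMetric g e) x u v w := by
  rw [christoffelForm_apply]; rfl

theorem gram_eq (he : e ∈ IsManifold.maximalAtlas (𝓡 m) ∞ M) {x : EuclideanSpace ℝ (Fin m)}
    (hx : x ∈ e.target) (α β : Fin 2) :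
    gram g K (e.symm x) α β = coordMetric g e x (coordField (K α) e x) (coordField (K β) e x) := by
  have := inner_eq_coordMetric g he (e.map_target hx) (K α (e.symm x)) (K β (e.symm x))
  rwa [e.right_inv hx] at this

theorem gram_det_eq (he : e ∈ IsManifold.maximalAtlas (𝓡 m) ∞ M) {x : EuclideanSpace ℝ (Fin m)}
    (hx : x ∈ e.target) :
    (gram g K (e.symm x)).det
      = planeDet (coordMetric g e x) (coordField (K 0) e x) (coordField (K 1) e x) := by
  rw [Matrix.det_fin_two, gram_eq g he hx, gram_eq g he hx, gram_eq g he hx, gram_eq g he hx,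
    planeDet, show coordMetric g e x (coordField (K 1) e x) (coordField (K 0) e x) = _ from
      (coordMetric_lorentz g he hx).1 _ _]

theorem rhoNormSq_eq (he : e ∈ IsManifold.maximalAtlas (𝓡 m) ∞ M) (ρ : ℝ)
    {x : EuclideanSpace ℝ (Fin m)} (hx : x ∈ e.target) :
    rhoNormSq g K ρ (e.symm x)
      = comboSq (coordMetric g e) (fun α => coordField (K α) e) ρ x := by
  have := inner_eq_coordMetric g he (e.map_target hx) (rhoHat K ρ (e.symm x))
    (rhoHat K ρ (e.symm x))
  rw [chartDiff_rhoHat ρ (e.map_target hx), e.right_inv hx] at this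
  exact this

variable {g}

theorem IsStationaryAxisymmetric.coordKilling (hK : IsStationaryAxisymmetric g K)
    (he : e ∈ IsManifold.maximalAtlas (𝓡 m) ∞ M) :
    CoordKilling (coordMetric g e) (fun α => coordField (K α) e) e.target where
  isOpen := e.open_target
  metric_smooth := contDiffOn_coordMetric g he
  field_smooth α := contDiffOn_coordField he (hK.killing α).1
  lorentz _ hx := coordMetric_lorentz g he hx
  killing α x hx u v := (hK.killing α).2 e he x hx u v
  commute _ hx := coordField_commute he (hK.killing 0).1 (hK.killing 1).1 hK.commute hx
  det_neg x hx := by rw [← gram_det_eq g he hx]; exact hK.det_neg _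

theorem dirDeriv_rhoNormSq (hK : IsStationaryAxisymmetric g K)
    (he : e ∈ IsManifold.maximalAtlas (𝓡 m) ∞ M) (ρ : ℝ) {p : M} (hp : p ∈ e.source)
    (ξ : TangentSpace (𝓡 m) p) :
    dirDeriv (rhoNormSq g K ρ) p ξ = fderiv ℝ (comboSq (coordMetric g e)
      (fun α => coordField (K α) e) ρ) (e p) (chartDiff e p ξ) := by
  have h1 : (fun x => rhoNormSq g K ρ (e.symm x)) =ᶠ[𝓝 (e p)]
      comboSq (coordMetric g e) (fun α => coordField (K α) e) ρ := by
    filter_upwards [e.open_target.mem_nhds (e.map_source hp)] with x hx using rhoNormSq_eq g he ρ hx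
  have h2 := ((hK.coordKilling he).contDiffAt_comboSq (e.map_source hp) ρ).differentiableAt
    (by simp)
  rw [chartDiff_eq_fderiv he hp (h2.congr_of_eventuallyEq h1), h1.fderiv_eq]

/-- Regularity of the impact parameter says that `⟨ρ̂, ρ̂⟩` has no critical zeros. This form does not
depend on a chart. -/
theorem exists_dirDeriv_ne_of_regular (hK : IsStationaryAxisymmetric g K) {ρ : ℝ}
    (hρ : IsRegularParameter g K ρ) {p : M} (hp : rhoNormSq g K ρ p = 0) :
    ∃ w : TangentSpace (𝓡 m) p, dirDeriv (rhoNormSq g K ρ) p w ≠ 0 := by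
  obtain ⟨w, hw⟩ := hρ p hp
  refine ⟨w, fun h0 => hw ?_⟩
  have he : chartAt (EuclideanSpace ℝ (Fin m)) p ∈ IsManifold.maximalAtlas (𝓡 m) ∞ M :=
    IsManifold.chart_mem_maximalAtlas (I := 𝓡 m) (n := ∞) p
  have hps : p ∈ (chartAt (EuclideanSpace ℝ (Fin m)) p).source := mem_chart_source _ p
  set e := chartAt (EuclideanSpace ℝ (Fin m)) p with hedef
  rw [dirDeriv_rhoNormSq hK he ρ hps] at h0
  have h1 := (hK.coordKilling he).accel_eq (e.map_source hps) ρ (chartDiff e p w)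
  rw [h0, mul_zero] at h1
  have h2 : coordField (rhoHat K ρ) e =ᶠ[𝓝 (e p)] combo (fun α => coordField (K α) e) ρ := by
    filter_upwards [e.open_target.mem_nhds (e.map_source hps)] with x hx
    have := coordField_apply (rhoHat K ρ) (e.map_target hx)
    rwa [e.right_inv hx, chartDiff_rhoHat ρ (e.map_target hx), e.right_inv hx] at this
  have h3 : covDeriv g (rhoHat K ρ) p (rhoHat K ρ p) w
      = coordMetric g e (e p) (fderiv ℝ (coordField (rhoHat K ρ) e) (e p)
          (chartDiff e p (rhoHat K ρ p))) (chartDiff e p w)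
        + christoffel g e (e p) (chartDiff e p (rhoHat K ρ p)) (coordField (rhoHat K ρ) e (e p))
          (chartDiff e p w) := rfl
  rw [h3, christoffel_eq, h2.fderiv_eq, h2.self_of_nhds, chartDiff_rhoHat ρ hps]
  exact h1

theorem fderiv_comboSq_ne_of_regular (hK : IsStationaryAxisymmetric g K) {ρ : ℝ}
    (hρ : IsRegularParameter g K ρ) (he : e ∈ IsManifold.maximalAtlas (𝓡 m) ∞ M)
    {x : EuclideanSpace ℝ (Fin m)} (hx : x ∈ e.target)
    (h0 : comboSq (coordMetric g e) (fun α => coordField (K α) e) ρ x = 0) :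
    fderiv ℝ (comboSq (coordMetric g e) (fun α => coordField (K α) e) ρ) x ≠ 0 := by
  intro hz
  rw [← rhoNormSq_eq g he ρ hx] at h0
  obtain ⟨w, hw⟩ := exists_dirDeriv_ne_of_regular hK hρ h0
  rw [dirDeriv_rhoNormSq hK he ρ (e.map_target hx), e.right_inv hx, hz] at hw
  exact hw rfl

/-- `τ̂` is a nonzero multiple of the dual vector of `ρ̂` in the plane of the Killing fields. -/
theorem exists_chartDiff_tauHat (hK : IsStationaryAxisymmetric g K)
    (he : e ∈ IsManifold.maximalAtlas (𝓡 m) ∞ M) (ρ : ℝ) {p : M} (hp : p ∈ e.source) :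
    ∃ k : ℝ, k ≠ 0 ∧ chartDiff e p (tauHat g K ρ p)
      = k • comboDual (coordMetric g e) (fun α => coordField (K α) e) ρ (e p) := by
  have hD := hK.det_neg p
  refine ⟨Real.sqrt |(gram g K p).det|, (Real.sqrt_pos.2 (abs_pos.2 hD.ne)).ne', ?_⟩
  have hx := e.map_source hp
  rw [comboDual_eq (hK.coordKilling he) hx ρ, ← gram_det_eq g he hx, e.left_inv hp]
  have hg : ∀ α β, coordMetric g e (e p) (coordField (K α) e (e p)) (coordField (K β) e (e p))
      = gram g K p α β := fun α β => by rw [← gram_eq g he hx, e.left_inv hp]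
  simp only [hg, tauHat, levi, Fin.sum_univ_two, chartDiff_add, chartDiff_smul]
  simp only [coordField_apply _ hp]
  have hsymm : gram g K p 1 0 = gram g K p 0 1 := (g.lorentz p).1 _ _
  have hinv : (gram g K p)⁻¹ = (gram g K p).det⁻¹ •
      !![gram g K p 1 1, -gram g K p 0 1; -gram g K p 1 0, gram g K p 0 0] := by
    rw [Matrix.inv_def, Matrix.adjugate_fin_two, Ring.inverse_eq_inv']
  rw [hinv, hsymm]
  simp [rhoCoeff, Matrix.mulVec, dotProduct, Fin.sum_univ_two, smul_smul, sub_eq_add_neg]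
  module

end ChartTranslation

/-! ### Charts adapted to a submanifold -/

section HalfSpaceChart

variable {n : ℕ} [NeZero n] {S : Type*} [TopologicalSpace S]

theorem extend_symm_mem_source (φ : OpenPartialHomeomorph S (EuclideanHalfSpace n))
    {y : EuclideanSpace ℝ (Fin n)} (hy : y ∈ (φ.extend (𝓡∂ n)).target) :
    (φ.extend (𝓡∂ n)).symm y ∈ φ.source := by
  rw [← φ.extend_source (I := 𝓡∂ n)]
  exact (φ.extend (𝓡∂ n)).map_target hy

theorem extend_target_mem_nhdsWithin_halfSpace
    (φ : OpenPartialHomeomorph S (EuclideanHalfSpace n)) {q : S} (hq : q ∈ φ.source) :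
    (φ.extend (𝓡∂ n)).target ∈ 𝓝[{y | 0 ≤ y 0}] (φ.extend (𝓡∂ n) q) := by
  rw [← range_modelWithCornersEuclideanHalfSpace]
  exact φ.extend_target_mem_nhdsWithin hq

end HalfSpaceChart

section Adapted

variable {m n : ℕ} [NeZero n]
  {M : Type*} [TopologicalSpace M] [ChartedSpace (EuclideanSpace ℝ (Fin m)) M]
  {S : Type*} [TopologicalSpace S] [ChartedSpace (EuclideanHalfSpace n) S]
  {F : Type} [NormedAddCommGroup F] [NormedSpace ℝ F]

/-- A pair of charts `φ` of `S` and `e` of `M` in which the map `ι : S → M` becomes the linear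
inclusion `y ↦ L (y, 0)`. -/
structure IsAdaptedChart (ι : S → M) (φ : OpenPartialHomeomorph S (EuclideanHalfSpace n))
    (e : OpenPartialHomeomorph M (EuclideanSpace ℝ (Fin m)))
    (L : (EuclideanSpace ℝ (Fin n) × F) ≃L[ℝ] EuclideanSpace ℝ (Fin m)) : Prop where
  dom : φ ∈ IsManifold.maximalAtlas (𝓡∂ n) ∞ S
  cod : e ∈ IsManifold.maximalAtlas (𝓡 m) ∞ M
  maps : ∀ q ∈ φ.source, ι q ∈ e.source
  apply_eq : ∀ q ∈ φ.source, e (ι q) = L (φ.extend (𝓡∂ n) q, 0)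

theorem exists_isAdaptedChart {ι : S → M} (hι : Manifold.IsSmoothEmbedding (𝓡∂ n) (𝓡 m) ∞ ι)
    (p : S) : ∃ (F : Type) (_ : NormedAddCommGroup F) (_ : NormedSpace ℝ F)
      (φ : OpenPartialHomeomorph S (EuclideanHalfSpace n))
      (e : OpenPartialHomeomorph M (EuclideanSpace ℝ (Fin m)))
      (L : (EuclideanSpace ℝ (Fin n) × F) ≃L[ℝ] EuclideanSpace ℝ (Fin m)),
      p ∈ φ.source ∧ IsAdaptedChart ι φ e L := by
  obtain ⟨F, iF, iF', hF⟩ := hι.isImmersion.isImmersionAt p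
  obtain ⟨φ, e, hp, -, hφ, he, hsub, L, hL⟩ := Classical.choice hF.property
  refine ⟨F, iF, iF', φ, e, L, hp, hφ, he, fun q hq => hsub hq, fun q hq => ?_⟩
  have h1 := hL ((φ.extend (𝓡∂ n)).map_source (by rwa [φ.extend_source]))
  rw [Function.comp_apply, Function.comp_apply, (φ.extend (𝓡∂ n)).left_inv
    (by rwa [φ.extend_source])] at h1
  exact h1

namespace IsAdaptedChart

variable {ι : S → M} {φ : OpenPartialHomeomorph S (EuclideanHalfSpace n)}
  {e : OpenPartialHomeomorph M (EuclideanSpace ℝ (Fin m))}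
  {L : (EuclideanSpace ℝ (Fin n) × F) ≃L[ℝ] EuclideanSpace ℝ (Fin m)}
  (h : IsAdaptedChart ι φ e L)
include h

theorem dom_mdifferentiable : φ.MDifferentiable (𝓡∂ n) (𝓡∂ n) :=
  ⟨(contMDiffOn_of_mem_maximalAtlas h.dom).mdifferentiableOn (by simp),
    (contMDiffOn_symm_of_mem_maximalAtlas h.dom).mdifferentiableOn (by simp)⟩

theorem hasMFDerivAt_extend {q : S} (hq : q ∈ φ.source) :
    HasMFDerivAt (𝓡∂ n) (𝓡 n) (φ.extend (𝓡∂ n)) q (mfderiv (𝓡∂ n) (𝓡∂ n) φ q) :=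
  (ModelWithCorners.hasMFDerivAt (𝓡∂ n)).comp q
    (h.dom_mdifferentiable.mdifferentiableAt hq).hasMFDerivAt

theorem mfderiv_extend_surjective {q : S} (hq : q ∈ φ.source)
    (y : EuclideanSpace ℝ (Fin n)) :
    ∃ w : TangentSpace (𝓡∂ n) q, mfderiv (𝓡∂ n) (𝓡 n) (φ.extend (𝓡∂ n)) q w = y := by
  rw [(h.hasMFDerivAt_extend hq).mfderiv]
  exact h.dom_mdifferentiable.mfderiv_surjective hq y

theorem apply_symm_eq {y : EuclideanSpace ℝ (Fin n)} (hy : y ∈ (φ.extend (𝓡∂ n)).target) :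
    e (ι ((φ.extend (𝓡∂ n)).symm y)) = L (y, 0) := by
  rw [h.apply_eq _ (extend_symm_mem_source φ hy), (φ.extend (𝓡∂ n)).right_inv hy]

theorem chartDiff_mfderiv (hι : Manifold.IsSmoothEmbedding (𝓡∂ n) (𝓡 m) ∞ ι) {q : S}
    (hq : q ∈ φ.source) (w : TangentSpace (𝓡∂ n) q) :
    chartDiff e (ι q) (mfderiv (𝓡∂ n) (𝓡 m) ι q w)
      = L (mfderiv (𝓡∂ n) (𝓡 n) (φ.extend (𝓡∂ n)) q w, 0) := by
  have h1 := ((chart_mdifferentiable h.cod).mdifferentiableAt (h.maps q hq)).hasMFDerivAt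
  have h2 : MDifferentiableAt (𝓡∂ n) (𝓡 m) ι q := hι.contMDiff.mdifferentiable (by simp) q
  have h3 := h1.comp q h2.hasMFDerivAt
  let A : EuclideanSpace ℝ (Fin n) →L[ℝ] EuclideanSpace ℝ (Fin m) :=
    (L : EuclideanSpace ℝ (Fin n) × F →L[ℝ] EuclideanSpace ℝ (Fin m)).comp
      (ContinuousLinearMap.inl ℝ (EuclideanSpace ℝ (Fin n)) F)
  have h4 : HasMFDerivAt (𝓡 n) (𝓡 m) A (φ.extend (𝓡∂ n) q) A :=
    A.hasFDerivAt.hasMFDerivAt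
  have h5 := h4.comp q (h.hasMFDerivAt_extend hq)
  have h6 : e ∘ ι =ᶠ[𝓝 q] A ∘ φ.extend (𝓡∂ n) := by
    filter_upwards [φ.open_source.mem_nhds hq] with q' hq'
    exact h.apply_eq q' hq'
  have h7 := hasMFDerivAt_unique h3 (h5.congr_of_eventuallyEq h6)
  rw [(h.hasMFDerivAt_extend hq).mfderiv]
  exact congrArg (fun B => B w) h7

/-- The tangent spaces of the submanifold in an adapted chart. -/
theorem exists_mfderiv_eq_iff (hι : Manifold.IsSmoothEmbedding (𝓡∂ n) (𝓡 m) ∞ ι) {q : S}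
    (hq : q ∈ φ.source) (v : TangentSpace (𝓡 m) (ι q)) :
    (∃ w : TangentSpace (𝓡∂ n) q, mfderiv (𝓡∂ n) (𝓡 m) ι q w = v) ↔
      (L.symm (chartDiff e (ι q) v)).2 = 0 := by
  constructor
  · rintro ⟨w, rfl⟩
    rw [h.chartDiff_mfderiv hι hq]; simp
  · intro hv
    obtain ⟨w, hw⟩ := h.mfderiv_extend_surjective hq (L.symm (chartDiff e (ι q) v)).1
    refine ⟨w, chartDiff_injective h.cod (h.maps q hq) ?_⟩
    rw [h.chartDiff_mfderiv hι hq, hw, ← hv]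
    simp

theorem mem_tangentSub_iff (hι : Manifold.IsSmoothEmbedding (𝓡∂ n) (𝓡 m) ∞ ι) {q : S}
    (hq : q ∈ φ.source) (v : TangentSpace (𝓡 m) (ι q)) :
    v ∈ tangentSub (n := n) ι q ↔ (L.symm (chartDiff e (ι q) v)).2 = 0 :=
  (h.exists_mfderiv_eq_iff hι hq v)

/-- Points of the face of a chart of the submanifold are boundary points. -/
theorem mem_boundary {q : S} (hq : q ∈ φ.source) (h0 : φ.extend (𝓡∂ n) q 0 = 0) :
    q ∈ (𝓡∂ n).boundary S := by
  rw [← ModelWithCorners.compl_interior]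
  intro hint
  have h1 : (𝓡∂ n).IsInteriorPoint (φ q) :=
    MDifferentiableAt.isInteriorPoint_of_surjective_mfderiv
      (h.dom_mdifferentiable.mdifferentiableAt hq) (h.dom_mdifferentiable.mfderiv_surjective hq) hint
  rw [ModelWithCorners.IsInteriorPoint, interior_range_modelWithCornersEuclideanHalfSpace] at h1
  have h2 : (0 : ℝ) < φ.extend (𝓡∂ n) q 0 := h1
  exact h2.ne' h0

variable [IsManifold (𝓡 m) ∞ M] {g : LorentzMetric m M}

/-- In an adapted chart the second fundamental form reduces to the Christoffel symbols. -/
theorem secondForm_eq (hι : Manifold.IsSmoothEmbedding (𝓡∂ n) (𝓡 m) ∞ ι) {q : S}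
    (hq : q ∈ φ.source) (u v : TangentSpace (𝓡∂ n) q) (ξ : TangentSpace (𝓡 m) (ι q)) :
    secondForm g ι φ e q u v ξ = christoffelForm (coordMetric g e) (e (ι q))
      (chartDiff e (ι q) (mfderiv (𝓡∂ n) (𝓡 m) ι q u))
      (chartDiff e (ι q) (mfderiv (𝓡∂ n) (𝓡 m) ι q v)) (chartDiff e (ι q) ξ) := by
  let A : EuclideanSpace ℝ (Fin n) →L[ℝ] EuclideanSpace ℝ (Fin m) :=
    (L : EuclideanSpace ℝ (Fin n) × F →L[ℝ] EuclideanSpace ℝ (Fin m)).comp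
      (ContinuousLinearMap.inl ℝ (EuclideanSpace ℝ (Fin n)) F)
  set R : Set (EuclideanSpace ℝ (Fin n)) := Set.range (𝓡∂ n) with hR
  set Φ : EuclideanSpace ℝ (Fin n) → EuclideanSpace ℝ (Fin m) :=
    e ∘ ι ∘ (φ.extend (𝓡∂ n)).symm with hΦ
  set y : EuclideanSpace ℝ (Fin n) := φ.extend (𝓡∂ n) q with hy
  have hyt : y ∈ (φ.extend (𝓡∂ n)).target :=
    (φ.extend (𝓡∂ n)).map_source (by rwa [φ.extend_source])
  have hyR : y ∈ R := φ.extend_target_subset_range hyt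
  have hΦA : ∀ᶠ y' in 𝓝[R] y, Φ y' = A y' := by
    filter_upwards [φ.extend_target_mem_nhdsWithin (I := 𝓡∂ n) hq] with y' hy'
    exact h.apply_symm_eq hy'
  have hUD : UniqueDiffOn ℝ R := (𝓡∂ n).uniqueDiffOn
  have hd1 : ∀ᶠ y' in 𝓝[R] y, fderivWithin ℝ Φ R y' = A := by
    filter_upwards [eventually_eventually_nhdsWithin.2 hΦA, self_mem_nhdsWithin] with y' hy' hy'R
    rw [Filter.EventuallyEq.fderivWithin_eq hy' (hy'.self_of_nhdsWithin hy'R)]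
    exact A.hasFDerivWithinAt.fderivWithin (hUD y' hy'R)
  have hd1y : fderivWithin ℝ Φ R y = A := hd1.self_of_nhdsWithin hyR
  have hd2 : fderivWithin ℝ (fderivWithin ℝ Φ R) R y = 0 := by
    rw [Filter.EventuallyEq.fderivWithin_eq (f₁ := fderivWithin ℝ Φ R) (f := fun _ => A) hd1 hd1y]
    exact fderivWithin_const_apply _
  have e1 : secondForm g ι φ e q u v ξ
      = coordMetric g e (e (ι q)) (fderivWithin ℝ (fderivWithin ℝ Φ R) R y
          (mfderiv (𝓡∂ n) (𝓡 n) (φ.extend (𝓡∂ n)) q u)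
          (mfderiv (𝓡∂ n) (𝓡 n) (φ.extend (𝓡∂ n)) q v)) (chartDiff e (ι q) ξ)
        + christoffel g e (e (ι q))
          (fderivWithin ℝ Φ R y (mfderiv (𝓡∂ n) (𝓡 n) (φ.extend (𝓡∂ n)) q u))
          (fderivWithin ℝ Φ R y (mfderiv (𝓡∂ n) (𝓡 n) (φ.extend (𝓡∂ n)) q v))
          (chartDiff e (ι q) ξ) := rfl
  rw [e1, hd2, hd1y, christoffel_eq, h.chartDiff_mfderiv hι hq, h.chartDiff_mfderiv hι hq]
  have h0 : ∀ a b : EuclideanSpace ℝ (Fin n), coordMetric g e (e (ι q)) ((0 : EuclideanSpace ℝ (Fin n) →L[ℝ]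
      EuclideanSpace ℝ (Fin n) →L[ℝ] EuclideanSpace ℝ (Fin m)) a b) (chartDiff e (ι q) ξ) = 0 :=
    fun a b => by simp
  exact (congrArg (· + _) (h0 _ _)).trans (zero_add _)

end IsAdaptedChart

end Adapted

/-! ### The second fundamental form conditions in adapted charts -/

section SliceTranslation

/-- Where `⟨ρ̂, ρ̂⟩` vanishes, the master equation says that its gradient is tangent to the slice. -/
theorem fderiv_comboSq_eq_zero_of_master {E : Type*} [NormedAddCommGroup E] [NormedSpace ℝ E]
    {G : E → E →L[ℝ] E →L[ℝ] ℝ} {X : Fin 2 → E → E} {U : Set E} {ρ : ℝ}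
    (h : CoordKilling G X U) {p : E} (hp : p ∈ U) {H ξ : E} (h0 : comboSq G X ρ p = 0)
    (hm : ∑ α, ∑ β, rhoCoeff ρ α * rhoCoeff ρ β * ((1 / 2) *
      fderiv ℝ (fun x => (planeDet (G x) (X 0 x) (X 1 x))⁻¹ * G x (X α x) (X β x)) p ξ
        - (planeDet (G p) (X 0 p) (X 1 p))⁻¹ * G p (X α p) (X β p) * G p H ξ) = 0) :
    fderiv ℝ (comboSq G X ρ) p ξ = 0 := by
  have hD := (h.det_neg p hp).ne
  have hdiff : ∀ α β, DifferentiableAt ℝ (fun x => G x (X α x) (X β x)) p := fun α β =>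
    ((h.differentiableAt_metric hp).clm_apply (h.differentiableAt_field hp α)).clm_apply
      (h.differentiableAt_field hp β)
  have hDet : DifferentiableAt ℝ (fun x => (planeDet (G x) (X 0 x) (X 1 x))⁻¹) p :=
    DifferentiableAt.inv (((hdiff 0 0).mul (hdiff 1 1)).sub ((hdiff 0 1).mul (hdiff 0 1))) hD
  have hf : DifferentiableAt ℝ (comboSq G X ρ) p :=
    (h.contDiffAt_comboSq hp ρ).differentiableAt (by simp)
  have hcombo : comboSq G X ρ = fun x =>
      ∑ α, ∑ β, rhoCoeff ρ α * rhoCoeff ρ β * G x (X α x) (X β x) := by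
    ext x
    simp [comboSq, combo, rhoCoeff, Fin.sum_univ_two]
    ring
  have hfun : (fun x => (planeDet (G x) (X 0 x) (X 1 x))⁻¹ * comboSq G X ρ x)
      = fun x => ∑ α, ∑ β, rhoCoeff ρ α * rhoCoeff ρ β *
        ((planeDet (G x) (X 0 x) (X 1 x))⁻¹ * G x (X α x) (X β x)) := by
    ext x
    simp only [hcombo, Finset.mul_sum]
    refine Finset.sum_congr rfl fun α _ => Finset.sum_congr rfl fun β _ => ?_
    ring
  have h1 : fderiv ℝ (fun x => (planeDet (G x) (X 0 x) (X 1 x))⁻¹ * comboSq G X ρ x) p ξ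
      = (planeDet (G p) (X 0 p) (X 1 p))⁻¹ * fderiv ℝ (comboSq G X ρ) p ξ := by
    rw [fderiv_fun_mul hDet hf, h0]
    simp
  have h2 : fderiv ℝ (fun x => (planeDet (G x) (X 0 x) (X 1 x))⁻¹ * comboSq G X ρ x) p ξ
      = ∑ α, ∑ β, rhoCoeff ρ α * rhoCoeff ρ β *
        fderiv ℝ (fun x => (planeDet (G x) (X 0 x) (X 1 x))⁻¹ * G x (X α x) (X β x)) p ξ := by
    have hd : ∀ α β, DifferentiableAt ℝ
        (fun x => (planeDet (G x) (X 0 x) (X 1 x))⁻¹ * G x (X α x) (X β x)) p :=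
      fun α β => hDet.mul (hdiff α β)
    have hs : HasFDerivAt (fun x => ∑ α, ∑ β, rhoCoeff ρ α * rhoCoeff ρ β *
        ((planeDet (G x) (X 0 x) (X 1 x))⁻¹ * G x (X α x) (X β x)))
        (∑ α, ∑ β, (rhoCoeff ρ α * rhoCoeff ρ β) • fderiv ℝ (fun x =>
          (planeDet (G x) (X 0 x) (X 1 x))⁻¹ * G x (X α x) (X β x)) p) p :=
      HasFDerivAt.fun_sum fun α _ => HasFDerivAt.fun_sum fun β _ =>
        (hd α β).hasFDerivAt.const_mul _
    rw [hfun, hs.fderiv]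
    simp [Fin.sum_univ_two]
  have h3 : ∑ α, ∑ β, rhoCoeff ρ α * rhoCoeff ρ β *
      ((planeDet (G p) (X 0 p) (X 1 p))⁻¹ * G p (X α p) (X β p) * G p H ξ) = 0 := by
    have : comboSq G X ρ p * ((planeDet (G p) (X 0 p) (X 1 p))⁻¹ * G p H ξ) = 0 := by
      rw [h0, zero_mul]
    rw [hcombo] at this
    simp only [Finset.sum_mul] at this
    rw [← this]
    refine Finset.sum_congr rfl fun α _ => Finset.sum_congr rfl fun β _ => ?_
    ring
  simp only [mul_sub, Finset.sum_sub_distrib] at hm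
  rw [h3, sub_zero] at hm
  have h4 : (1 / 2) * ((planeDet (G p) (X 0 p) (X 1 p))⁻¹ * fderiv ℝ (comboSq G X ρ) p ξ) = 0 := by
    rw [← h1, h2, Finset.mul_sum, ← hm]
    refine Finset.sum_congr rfl fun α _ => ?_
    rw [Finset.mul_sum]
    refine Finset.sum_congr rfl fun β _ => ?_
    ring
  have h5 := (mul_eq_zero.1 h4).resolve_left (by norm_num)
  exact (mul_eq_zero.1 h5).resolve_left (inv_ne_zero hD)

variable {m n : ℕ} [NeZero n]
  {M : Type*} [TopologicalSpace M] [ChartedSpace (EuclideanSpace ℝ (Fin m)) M]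
  [IsManifold (𝓡 m) ∞ M]
  {S : Type*} [TopologicalSpace S] [ChartedSpace (EuclideanHalfSpace n) S]
  {F : Type} [NormedAddCommGroup F] [NormedSpace ℝ F]
  {g : LorentzMetric m M} {K : Fin 2 → VField m M} {ι : S → M} {ρ : ℝ}
  {φ : OpenPartialHomeomorph S (EuclideanHalfSpace n)}
  {e : OpenPartialHomeomorph M (EuclideanSpace ℝ (Fin m))}
  {L : (EuclideanSpace ℝ (Fin n) × F) ≃L[ℝ] EuclideanSpace ℝ (Fin m)}

theorem chartDiff_surjective {m : ℕ} {M : Type*} [TopologicalSpace M]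
    [ChartedSpace (EuclideanSpace ℝ (Fin m)) M]
    {e : OpenPartialHomeomorph M (EuclideanSpace ℝ (Fin m))}
    (he : e ∈ IsManifold.maximalAtlas (𝓡 m) ∞ M) {p : M} (hp : p ∈ e.source)
    (v : EuclideanSpace ℝ (Fin m)) : ∃ w : TangentSpace (𝓡 m) p, chartDiff e p w = v :=
  (chart_mdifferentiable he).mfderiv_surjective hp v

theorem dirDeriv_gram (hK : IsStationaryAxisymmetric g K)
    (he : e ∈ IsManifold.maximalAtlas (𝓡 m) ∞ M) {p : M} (hp : p ∈ e.source) (α β : Fin 2)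
    (ξ : TangentSpace (𝓡 m) p) :
    dirDeriv (fun q => gram g K q α β) p ξ = fderiv ℝ (fun x => coordMetric g e x
      (coordField (K α) e x) (coordField (K β) e x)) (e p) (chartDiff e p ξ) := by
  have h := hK.coordKilling he
  have hx := e.map_source hp
  have h1 : (fun x => gram g K (e.symm x) α β) =ᶠ[𝓝 (e p)] fun x => coordMetric g e x
      (coordField (K α) e x) (coordField (K β) e x) := by
    filter_upwards [e.open_target.mem_nhds hx] with x hx using gram_eq g he hx α β
  have h2 : DifferentiableAt ℝ (fun x => coordMetric g e x
      (coordField (K α) e x) (coordField (K β) e x)) (e p) :=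
    ((h.differentiableAt_metric hx).clm_apply (h.differentiableAt_field hx α)).clm_apply
      (h.differentiableAt_field hx β)
  rw [chartDiff_eq_fderiv he hp (h2.congr_of_eventuallyEq h1), h1.fderiv_eq]

theorem dirDeriv_inv_det_mul_gram (hK : IsStationaryAxisymmetric g K)
    (he : e ∈ IsManifold.maximalAtlas (𝓡 m) ∞ M) {p : M} (hp : p ∈ e.source) (α β : Fin 2)
    (ξ : TangentSpace (𝓡 m) p) :
    dirDeriv (fun q => ((gram g K q).det)⁻¹ * gram g K q α β) p ξ
      = fderiv ℝ (fun x => (planeDet (coordMetric g e x) (coordField (K 0) e x)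
        (coordField (K 1) e x))⁻¹ * coordMetric g e x
      (coordField (K α) e x) (coordField (K β) e x)) (e p) (chartDiff e p ξ) := by
  have h := hK.coordKilling he
  have hx := e.map_source hp
  have h1 : (fun x => ((gram g K (e.symm x)).det)⁻¹ * gram g K (e.symm x) α β) =ᶠ[𝓝 (e p)]
      fun x => (planeDet (coordMetric g e x) (coordField (K 0) e x)
        (coordField (K 1) e x))⁻¹ * coordMetric g e x
      (coordField (K α) e x) (coordField (K β) e x) := by
    filter_upwards [e.open_target.mem_nhds hx] with x hx
    rw [gram_eq g he hx α β, gram_det_eq g he hx]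
  have hd : ∀ α β, DifferentiableAt ℝ (fun x => coordMetric g e x
      (coordField (K α) e x) (coordField (K β) e x)) (e p) := fun α β =>
    ((h.differentiableAt_metric hx).clm_apply (h.differentiableAt_field hx α)).clm_apply
      (h.differentiableAt_field hx β)
  have h2 : DifferentiableAt ℝ (fun x => (planeDet (coordMetric g e x) (coordField (K 0) e x)
        (coordField (K 1) e x))⁻¹ * coordMetric g e x
      (coordField (K α) e x) (coordField (K β) e x)) (e p) :=
    (DifferentiableAt.inv (((hd 0 0).mul (hd 1 1)).sub ((hd 0 1).mul (hd 0 1)))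
      (h.det_neg _ hx).ne).mul (hd α β)
  rw [chartDiff_eq_fderiv he hp (h2.congr_of_eventuallyEq h1), h1.fderiv_eq]

/-- The hypotheses on the second fundamental form, read in an adapted chart. -/
theorem IsAdaptedChart.sliceCondition (h : IsAdaptedChart ι φ e L)
    (hK : IsStationaryAxisymmetric g K)
    (hι : Manifold.IsSmoothEmbedding (𝓡∂ n) (𝓡 m) ∞ ι) (hinv : IsInvariant (n := n) K ι)
    {q : S} (hq : q ∈ φ.source) {H : TangentSpace (𝓡 m) (ι q)}
    (hH : SecondFormCondition (n := n) g K ι ρ q H) :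
    SliceCondition (coordMetric g e) (fun α => coordField (K α) e) ρ L (e (ι q))
      (chartDiff e (ι q) H) := by
  have he := h.cod
  have hp := h.maps q hq
  have hx := e.map_source hp
  have hC := hK.coordKilling (g := g) he
  have hfield : ∀ α, (L.symm (coordField (K α) e (e (ι q)))).2 = 0 := fun α => by
    rw [coordField_apply _ hp]
    exact (h.mem_tangentSub_iff hι hq _).1 (hinv.tangent α q)
  -- Normal vectors of the slice are the images of normal vectors of the submanifold.
  have hnormal : ∀ ξ : EuclideanSpace ℝ (Fin m), IsSliceNormal (coordMetric g e) L (e (ι q)) ξ →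
      ∃ ξ' : TangentSpace (𝓡 m) (ι q), IsNormal (n := n) g ι q ξ' ∧ chartDiff e (ι q) ξ' = ξ := by
    intro ξ hξ
    obtain ⟨ξ', rfl⟩ := chartDiff_surjective he hp ξ
    refine ⟨ξ', fun v hv => ?_, rfl⟩
    rw [inner_eq_coordMetric g he hp]
    exact hξ _ ((h.mem_tangentSub_iff hι hq v).1 hv)
  have htangent : ∀ a : EuclideanSpace ℝ (Fin m), (L.symm a).2 = 0 →
      ∃ w : TangentSpace (𝓡∂ n) q, chartDiff e (ι q) (mfderiv (𝓡∂ n) (𝓡 m) ι q w) = a := by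
    intro a ha
    obtain ⟨a', rfl⟩ := chartDiff_surjective he hp a
    obtain ⟨w, rfl⟩ := (h.exists_mfderiv_eq_iff hι hq a').2 ha
    exact ⟨w, rfl⟩
  have hperp : ∀ w : TangentSpace (𝓡∂ n) q,
      (∀ α, coordMetric g e (e (ι q)) (coordField (K α) e (e (ι q)))
        (chartDiff e (ι q) (mfderiv (𝓡∂ n) (𝓡 m) ι q w)) = 0) →
      ∀ β, g.inner (ι q) (K β (ι q)) (mfderiv (𝓡∂ n) (𝓡 m) ι q w) = 0 := by
    intro w hw β
    rw [inner_eq_coordMetric g he hp, ← coordField_apply _ hp]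
    exact hw β
  have hmaster : ∀ ξ' : TangentSpace (𝓡 m) (ι q), IsNormal (n := n) g ι q ξ' →
      ∑ α, ∑ β, rhoCoeff ρ α * rhoCoeff ρ β * ((1 / 2) *
      fderiv ℝ (fun x => (planeDet (coordMetric g e x) (coordField (K 0) e x)
        (coordField (K 1) e x))⁻¹ * coordMetric g e x (coordField (K α) e x)
          (coordField (K β) e x)) (e (ι q)) (chartDiff e (ι q) ξ')
        - (planeDet (coordMetric g e (e (ι q))) (coordField (K 0) e (e (ι q)))
            (coordField (K 1) e (e (ι q))))⁻¹
          * coordMetric g e (e (ι q)) (coordField (K α) e (e (ι q))) (coordField (K β) e (e (ι q)))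
          * coordMetric g e (e (ι q)) (chartDiff e (ι q) H) (chartDiff e (ι q) ξ')) = 0 := by
    intro ξ' hξ'
    have hm := hH.master ξ' hξ'
    simp only [dirDeriv_inv_det_mul_gram hK he hp] at hm
    rw [← inner_eq_coordMetric g he hp, ← gram_det_eq g he hx]
    simp only [← gram_eq g he hx]
    rwa [e.left_inv hp]
  refine ⟨hfield, fun ξ hξ => ?_, fun ξ hξ a ha hKa => ?_, fun ξ hξ a ha hKa => ?_,
    fun h0 ξ hξ => ?_⟩
  · obtain ⟨ξ', hξ', rfl⟩ := hnormal ξ hξ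
    refine plane_of_master hC hx (fun α β => ?_) (hmaster ξ' hξ')
    obtain ⟨u, hu⟩ := hinv.tangent α q
    obtain ⟨v, hv⟩ := hinv.tangent β q
    have h1 := hH.killing_killing φ h.dom hq e he hp ξ' hξ' α β u v hu hv
    rw [h.secondForm_eq hι hq] at h1
    change mfderiv (𝓡∂ n) (𝓡 m) ι q u = _ at hu
    change mfderiv (𝓡∂ n) (𝓡 m) ι q v = _ at hv
    rw [hu, hv, dirDeriv_gram hK he hp, ← coordField_apply _ hp, ← coordField_apply _ hp] at h1
    exact h1
  · obtain ⟨ξ', hξ', rfl⟩ := hnormal ξ hξ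
    obtain ⟨w, rfl⟩ := htangent a ha
    obtain ⟨k, hk, hτ⟩ := exists_chartDiff_tauHat hK he ρ hp
    obtain ⟨u, hu⟩ : ∃ u : TangentSpace (𝓡∂ n) q,
        mfderiv (𝓡∂ n) (𝓡 m) ι q u = tauHat g K ρ (ι q) := by
      rw [h.exists_mfderiv_eq_iff hι hq, hτ]
      simp [tangent_comboDual hfield]
    have h1 := hH.tau_perp φ h.dom hq e he hp ξ' hξ' u w hu (hperp w hKa)
    rw [h.secondForm_eq hι hq, hu, hτ, christoffelForm_smul_left] at h1
    exact (smul_eq_zero.1 h1).resolve_left hk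
  · obtain ⟨ξ', hξ', rfl⟩ := hnormal ξ hξ
    obtain ⟨w, rfl⟩ := htangent a ha
    have h1 := hH.perp_perp φ h.dom hq e he hp ξ' hξ' w w (hperp w hKa) (hperp w hKa)
    rwa [h.secondForm_eq hι hq, inner_eq_coordMetric g he hp, inner_eq_coordMetric g he hp] at h1
  · obtain ⟨ξ', hξ', rfl⟩ := hnormal ξ hξ
    exact fderiv_comboSq_eq_zero_of_master hC hx h0 (hmaster ξ' hξ')

end SliceTranslation

/-! ### The set of touching times is open -/

section Openness

variable {m n : ℕ} [NeZero n]
  {M : Type*} [TopologicalSpace M] [ChartedSpace (EuclideanSpace ℝ (Fin m)) M]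
  {S : Type*} [TopologicalSpace S] [ChartedSpace (EuclideanHalfSpace n) S]
  {F : Type} [NormedAddCommGroup F] [NormedSpace ℝ F]
  {ι : S → M} {γ : ℝ → M} {t : ℝ}
  {φ : OpenPartialHomeomorph S (EuclideanHalfSpace n)}
  {e : OpenPartialHomeomorph M (EuclideanSpace ℝ (Fin m))}
  {L : (EuclideanSpace ℝ (Fin n) × F) ≃L[ℝ] EuclideanSpace ℝ (Fin m)}

theorem TouchesAt.mem_range (h : TouchesAt m n ι γ t) : γ t ∈ Set.range ι := by
  obtain ⟨⟨q, w⟩, hu⟩ := h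
  exact ⟨q, congrArg Bundle.TotalSpace.proj hu⟩

theorem IsAdaptedChart.exists_tangentMap_eq_iff (h : IsAdaptedChart ι φ e L)
    (hι : Manifold.IsSmoothEmbedding (𝓡∂ n) (𝓡 m) ∞ ι) {q : S} (hq : q ∈ φ.source) {p : M}
    (hqp : ι q = p) (v : TangentSpace (𝓡 m) p) :
    (∃ u : TangentBundle (𝓡∂ n) S, tangentMap (𝓡∂ n) (𝓡 m) ι u = (⟨p, v⟩ : TangentBundle (𝓡 m) M))
      ↔ (L.symm (chartDiff e p v)).2 = 0 := by
  subst hqp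
  rw [← h.exists_mfderiv_eq_iff hι hq]
  constructor
  · rintro ⟨⟨q', w⟩, hu⟩
    have hb : ι q' = ι q := congrArg Bundle.TotalSpace.proj hu
    obtain rfl := hι.isEmbedding.injective hb
    refine ⟨w, ?_⟩
    simp only [tangentMap, Bundle.TotalSpace.mk.injEq, heq_eq_eq, true_and] at hu
    exact hu
  · rintro ⟨w, rfl⟩
    exact ⟨⟨q, w⟩, rfl⟩

theorem IsAdaptedChart.touchesAt_iff (h : IsAdaptedChart ι φ e L)
    (hι : Manifold.IsSmoothEmbedding (𝓡∂ n) (𝓡 m) ∞ ι) {q : S} (hq : q ∈ φ.source)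
    (hqt : ι q = γ t) (hγ : MDifferentiableAt 𝓘(ℝ, ℝ) (𝓡 m) γ t) :
    TouchesAt m n ι γ t ↔ (L.symm (deriv (fun s => e (γ s)) t)).2 = 0 := by
  rw [(hasDerivAt_chart_comp h.cod hγ (hqt ▸ h.maps q hq)).deriv]
  exact h.exists_tangentMap_eq_iff hι hq hqt _

variable [IsManifold (𝓡 m) ∞ M] {g : LorentzMetric m M} {K : Fin 2 → VField m M} {ρ : ℝ}
  {C : Set M} {J : Set ℝ}

theorem IsNullGeodesicWithImpact.contMDiffAt (hγ : IsNullGeodesicWithImpact g K ρ γ J)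
    (hJ : IsOpen J) (ht : t ∈ J) : ContMDiffAt 𝓘(ℝ, ℝ) (𝓡 m) ∞ γ t :=
  (hγ.geodesic.1 t ht).contMDiffAt (hJ.mem_nhds ht)

theorem IsNullGeodesicWithImpact.mdifferentiableAt (hγ : IsNullGeodesicWithImpact g K ρ γ J)
    (hJ : IsOpen J) (ht : t ∈ J) : MDifferentiableAt 𝓘(ℝ, ℝ) (𝓡 m) γ t :=
  (hγ.contMDiffAt hJ ht).mdifferentiableAt (by simp)

theorem IsNullGeodesicWithImpact.inner_rhoHat (hγ : IsNullGeodesicWithImpact g K ρ γ J)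
    (ht : t ∈ J) : g.inner (γ t) (rhoHat K ρ (γ t)) (velocity γ t) = 0 := by
  have h1 := hγ.impact t ht
  rw [eq_div_iff (hγ.energy_ne t ht)] at h1
  rw [rhoHat_eq]
  simp only [map_add, map_smul, add_apply, smul_apply, smul_eq_mul]
  rw [h1]; ring

theorem IsCausalRegion.rhoNormSq_nonneg (hC : IsCausalRegion g K ρ C) {p : M} (hp : p ∈ C) :
    0 ≤ rhoNormSq g K ρ p := by
  obtain ⟨p₀, -, rfl⟩ := hC
  exact connectedComponentIn_subset {q | 0 ≤ rhoNormSq g K ρ q} p₀ hp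

theorem eventually_touchesAt (hK : IsStationaryAxisymmetric g K)
    (hρ : IsRegularParameter g K ρ) (hC : IsCausalRegion g K ρ C)
    (hS : IsFundamentalPhotonSubmanifold (n := n) g K ι ρ C)
    (hJ : IsOpen J) (hγ : IsNullGeodesicWithImpact g K ρ γ J) (ht : t ∈ J)
    (htouch : TouchesAt m n ι γ t) : ∀ᶠ t' in 𝓝 t, TouchesAt m n ι γ t' := by
  obtain ⟨q, hqt⟩ := htouch.mem_range
  obtain ⟨F, _, _, φ, e, L, hq, h⟩ := exists_isAdaptedChart hS.embedding q
  have hι := hS.embedding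
  have he := h.cod
  have hp := h.maps q hq
  have hx := e.map_source hp
  have hpt : γ t ∈ e.source := hqt ▸ hp
  set y₀ : EuclideanSpace ℝ (Fin n) := φ.extend (𝓡∂ n) q with hy₀
  have hJt : ∀ᶠ t' in 𝓝 t, t' ∈ J ∧ γ t' ∈ e.source :=
    (hJ.eventually_mem ht).and <| (hγ.contMDiffAt hJ ht).continuousAt.eventually_mem
      (e.open_source.mem_nhds hpt)
  have hderiv : ∀ t', t' ∈ J → γ t' ∈ e.source →
      deriv (fun s => e (γ s)) t' = chartDiff e (γ t') (velocity γ t') := fun t' h1 h2 =>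
    (hasDerivAt_chart_comp he (hγ.mdifferentiableAt hJ h1) h2).deriv
  have hcs : e (γ t) = L (y₀, 0) := by rw [← hqt]; exact h.apply_eq q hq
  have key := eventually_mem_slice (hK.coordKilling he) (ρ := ρ) (L := L) (y₀ := y₀)
    (e₀ := EuclideanSpace.single 0 1) (ℓ := EuclideanSpace.proj 0) (by simp)
    (by
      have : y₀ ∈ Set.range (𝓡∂ n) := φ.extend_target_subset_range
        ((φ.extend (𝓡∂ n)).map_source (by rwa [φ.extend_source]))
      rw [range_modelWithCornersEuclideanHalfSpace] at this
      exact this)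
    (by
      filter_upwards [extend_target_mem_nhdsWithin_halfSpace φ hq] with y hy
      have hy' := extend_symm_mem_source φ hy
      have hey := h.apply_symm_eq hy
      have hM := h.maps _ hy'
      have hsq := rhoNormSq_eq (K := K) g he ρ (e.map_source hM)
      rw [e.left_inv hM, hey] at hsq
      refine ⟨?_, ?_, fun h0 => ?_⟩
      · obtain ⟨H, hH⟩ := hS.second_form ((φ.extend (𝓡∂ n)).symm y)
        have := h.sliceCondition hK hι hS.invariant hy' hH
        rw [hey] at this
        exact ⟨_, this⟩
      · rw [← hsq]
        exact hC.rhoNormSq_nonneg (hS.subset ⟨_, rfl⟩)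
      · rw [← hsq]
        refine (hS.boundary ⟨_, h.mem_boundary hy' ?_, rfl⟩).2
        rw [(φ.extend (𝓡∂ n)).right_inv hy]
        exact h0)
    (c := fun s => e (γ s)) (s := t)
    (by
      have h1 := (contMDiffOn_of_mem_maximalAtlas he).contMDiffAt (e.open_source.mem_nhds hpt)
      exact (h1.comp t (hγ.contMDiffAt hJ ht)).contDiffAt)
    hcs (e.map_source hpt) ((h.touchesAt_iff hι hq hqt (hγ.mdifferentiableAt hJ ht)).1 htouch)
    (by
      filter_upwards [hJt] with t' ht' w
      rw [← christoffel_eq]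
      exact hγ.geodesic.2 e he t' ht'.1 ht'.2 w)
    (by
      filter_upwards [hJt] with t' ht'
      rw [hderiv t' ht'.1 ht'.2, ← inner_eq_coordMetric g he ht'.2]
      exact hγ.null t' ht'.1)
    (by
      filter_upwards [hJt] with t' ht'
      rw [hderiv t' ht'.1 ht'.2, ← chartDiff_rhoHat ρ ht'.2, ← inner_eq_coordMetric g he ht'.2]
      exact hγ.inner_rhoHat ht'.1)
    (by
      rw [hderiv t ht hpt, coordField_apply _ hpt, ← inner_eq_coordMetric g he hpt]
      exact hγ.energy_ne t ht)
    (fderiv_comboSq_ne_of_regular hK hρ he (e.map_source hpt))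
  have hcont : ContinuousAt (fun s => (L.symm (e (γ s))).1) t :=
    (continuous_fst.comp L.symm.continuous).continuousAt.comp
      ((e.continuousAt hpt).comp (hγ.contMDiffAt hJ ht).continuousAt)
  have hy₀' : (L.symm (e (γ t))).1 = y₀ := by rw [hcs]; simp
  have hmem : ∀ᶠ t' in 𝓝 t, 0 ≤ (L.symm (e (γ t'))).1 0 →
      (L.symm (e (γ t'))).1 ∈ (φ.extend (𝓡∂ n)).target := by
    have h1 := extend_target_mem_nhdsWithin_halfSpace φ hq
    rw [mem_nhdsWithin_iff_eventually, ← hy₀, ← hy₀'] at h1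
    exact hcont.eventually h1
  filter_upwards [key, hJt, hmem] with t' hk ht' hm
  have hy := hm hk.2.1
  have hy' := extend_symm_mem_source φ hy
  have hqt' : ι ((φ.extend (𝓡∂ n)).symm (L.symm (e (γ t'))).1) = γ t' := by
    refine e.injOn (h.maps _ hy') ht'.2 ?_
    rw [h.apply_symm_eq hy, ← hk.1]
    simp
  exact (h.touchesAt_iff hι hy' hqt' (hγ.mdifferentiableAt hJ ht'.1)).2 hk.2.2

end Openness

/-! ### Time translations preserve the scalar products of velocities -/

section Flow

/-- The linearized flow equation: the derivative of a family `s ↦ h (s, t)` of integral curves of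
`Y` with respect to the parameter `t`. -/
theorem hasDerivAt_variation {E : Type*} [NormedAddCommGroup E] [NormedSpace ℝ E] {h : ℝ × ℝ → E}
    {Y : E → E} {s t : ℝ} (hh : ContDiffAt ℝ ∞ h (s, t))
    (hY : DifferentiableAt ℝ Y (h (s, t)))
    (hflow : ∀ᶠ z in 𝓝 (s, t), fderiv ℝ h z (1, 0) = Y (h z)) :
    HasDerivAt (fun s' => fderiv ℝ h (s', t) (0, 1))
      (fderiv ℝ Y (h (s, t)) (fderiv ℝ h (s, t) (0, 1))) s := by
  have hd : HasFDerivAt (fderiv ℝ h) (fderiv ℝ (fderiv ℝ h) (s, t)) (s, t) :=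
    ((hh.fderiv_right (m := 1) one_add_one_le_infty).differentiableAt (by simp)).hasFDerivAt
  have hh' : HasFDerivAt h (fderiv ℝ h (s, t)) (s, t) :=
    (hh.differentiableAt (by simp)).hasFDerivAt
  have hsymm := hh.isSymmSndFDerivAt (by
    rw [minSmoothness_of_isRCLikeNormedField]
    exact WithTop.coe_le_coe.2 (le_top : (2 : ℕ∞) ≤ ⊤))
  have happ : ∀ v : ℝ × ℝ, HasFDerivAt (fun z => fderiv ℝ h z v)
      ((ContinuousLinearMap.apply ℝ E v).comp (fderiv ℝ (fderiv ℝ h) (s, t))) (s, t) := fun v =>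
    (ContinuousLinearMap.apply ℝ E v).hasFDerivAt.comp (s, t) hd
  have h1 : fderiv ℝ (fderiv ℝ h) (s, t) (0, 1) (1, 0)
      = fderiv ℝ Y (h (s, t)) (fderiv ℝ h (s, t) (0, 1)) := by
    have h2 : HasFDerivAt (fun z => Y (h z)) ((fderiv ℝ Y (h (s, t))).comp (fderiv ℝ h (s, t)))
      (s, t) := hY.hasFDerivAt.comp (s, t) hh'
    have h3 := ((happ (1, 0)).congr_of_eventuallyEq
      (by filter_upwards [hflow] with z hz using hz.symm)).unique h2
    exact congrArg (fun A => A ((0 : ℝ), (1 : ℝ))) h3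
  rw [← h1, hsymm.eq]
  have h5 : HasDerivAt (fun s' : ℝ => (s', t)) ((1 : ℝ), (0 : ℝ)) s :=
    (hasDerivAt_id s).prodMk (hasDerivAt_const s t)
  exact HasFDerivAt.comp_hasDerivAt s (f := fun s' : ℝ => (s', t)) (happ (0, 1)) h5

set_option maxSynthPendingDepth 3 in
/-- The scalar products of a vector carried along by the flow of `X₀` with itself and with the fields
`X₀`, `X₁` are constant. -/
theorem CoordKilling.hasDerivAt_products {E : Type*} [NormedAddCommGroup E] [NormedSpace ℝ E]
    {G : E → E →L[ℝ] E →L[ℝ] ℝ} {X : Fin 2 → E → E} {U : Set E} (h : CoordKilling G X U)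
    {c w : ℝ → E} {s : ℝ} (hU : c s ∈ U) (hc : HasDerivAt c (X 0 (c s)) s)
    (hw : HasDerivAt w (fderiv ℝ (X 0) (c s) (w s)) s) :
    HasDerivAt (fun s' => G (c s') (w s') (w s')) 0 s ∧
      ∀ α, HasDerivAt (fun s' => G (c s') (X α (c s')) (w s')) 0 s := by
  have hG := HasFDerivAt.comp_hasDerivAt (f := c) s (h.differentiableAt_metric hU).hasFDerivAt hc
  constructor
  · refine ((hG.clm_apply hw).clm_apply hw).congr_deriv ?_
    have := h.killing 0 _ hU (w s) (w s)
    simp only [Function.comp, add_apply]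
    linarith
  · intro α
    have hX := HasFDerivAt.comp_hasDerivAt (f := c) s (h.differentiableAt_field hU α).hasFDerivAt hc
    refine ((hG.clm_apply hX).clm_apply hw).congr_deriv ?_
    have := h.killing 0 _ hU (X α (c s)) (w s)
    have hcomm : fderiv ℝ (X α) (c s) (X 0 (c s)) = fderiv ℝ (X 0) (c s) (X α (c s)) := by
      fin_cases α
      · rfl
      · exact h.commute _ hU
    simp only [Function.comp, add_apply, hcomm]
    linarith

variable {m : ℕ} {M : Type*} [TopologicalSpace M] [ChartedSpace (EuclideanSpace ℝ (Fin m)) M]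
  {Φ : ℝ × M → M} {γ : ℝ → M} {t : ℝ}

theorem contMDiffAt_flow_comp (hΦ : ContMDiff (𝓘(ℝ, ℝ).prod (𝓡 m)) (𝓡 m) ∞ Φ)
    (hγ : ContMDiffAt 𝓘(ℝ, ℝ) (𝓡 m) ∞ γ t) (s : ℝ) :
    ContMDiffAt 𝓘(ℝ, ℝ × ℝ) (𝓡 m) ∞ (fun z : ℝ × ℝ => Φ (z.1, γ z.2)) (s, t) := by
  have h1 : ContMDiffAt 𝓘(ℝ, ℝ × ℝ) 𝓘(ℝ, ℝ) ∞ (fun z : ℝ × ℝ => z.1) (s, t) :=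
    contDiff_fst.contMDiff.contMDiffAt
  have h2 : ContMDiffAt 𝓘(ℝ, ℝ × ℝ) 𝓘(ℝ, ℝ) ∞ (fun z : ℝ × ℝ => z.2) (s, t) :=
    contDiff_snd.contMDiff.contMDiffAt
  have h3 : ContMDiffAt 𝓘(ℝ, ℝ × ℝ) (𝓡 m) ∞ (fun z : ℝ × ℝ => γ z.2) (s, t) :=
    ContMDiffAt.comp (s, t) (g := γ) hγ h2
  exact (hΦ _).comp (s, t) (h1.prodMk h3)

theorem contMDiffAt_translate (hΦ : ContMDiff (𝓘(ℝ, ℝ).prod (𝓡 m)) (𝓡 m) ∞ Φ)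
    (hγ : ContMDiffAt 𝓘(ℝ, ℝ) (𝓡 m) ∞ γ t) (s : ℝ) :
    ContMDiffAt 𝓘(ℝ, ℝ) (𝓡 m) ∞ (fun t' => Φ (s, γ t')) t :=
  (hΦ (s, γ t)).comp t (contMDiffAt_const.prodMk hγ)

variable [IsManifold (𝓡 m) ∞ M] {g : LorentzMetric m M} {K : Fin 2 → VField m M}

theorem hasDerivAt_inner_translate (hK : IsStationaryAxisymmetric g K)
    (hΦ : ContMDiff (𝓘(ℝ, ℝ).prod (𝓡 m)) (𝓡 m) ∞ Φ)
    (hflow : ∀ p, IsMIntegralCurve (fun s => Φ (s, p)) (K 0))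
    (hγ : ∀ᶠ t' in 𝓝 t, ContMDiffAt 𝓘(ℝ, ℝ) (𝓡 m) ∞ γ t') (s : ℝ) :
    HasDerivAt (fun s' => g.inner (Φ (s', γ t)) (velocity (fun t' => Φ (s', γ t')) t)
        (velocity (m := m) (fun t' => Φ (s', γ t')) t)) 0 s ∧
      ∀ α, HasDerivAt (fun s' => g.inner (Φ (s', γ t)) (K α (Φ (s', γ t)))
        (velocity (fun t' => Φ (s', γ t')) t)) 0 s := by
  have hγt := hγ.self_of_nhds
  set e := chartAt (EuclideanSpace ℝ (Fin m)) (Φ (s, γ t)) with hedef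
  have he : e ∈ IsManifold.maximalAtlas (𝓡 m) ∞ M :=
    IsManifold.chart_mem_maximalAtlas (I := 𝓡 m) (n := ∞) _
  have hps : Φ (s, γ t) ∈ e.source := mem_chart_source _ _
  have hC := hK.coordKilling (g := g) he
  let h : ℝ × ℝ → EuclideanSpace ℝ (Fin m) := fun z => e (Φ (z.1, γ z.2))
  have hF := contMDiffAt_flow_comp hΦ hγt s
  have hh : ContDiffAt ℝ ∞ h (s, t) := by
    have h1 := (contMDiffOn_of_mem_maximalAtlas he).contMDiffAt (e.open_source.mem_nhds hps)
    exact (ContMDiffAt.comp (s, t) (g := e) (f := fun z : ℝ × ℝ => Φ (z.1, γ z.2)) h1 hF).contDiffAt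
  have hdiff : ∀ᶠ z in 𝓝 (s, t), DifferentiableAt ℝ h z := by
    filter_upwards [(hh.of_le (m := 1) (by simp)).eventually (by simp)] with z hz
      using hz.differentiableAt (by simp)
  have hsrc : ∀ᶠ z in 𝓝 (s, t), Φ (z.1, γ z.2) ∈ e.source :=
    hF.continuousAt.eventually_mem (e.open_source.mem_nhds hps)
  have hpartial : ∀ z : ℝ × ℝ, DifferentiableAt ℝ h z → Φ (z.1, γ z.2) ∈ e.source →
      fderiv ℝ h z (1, 0) = coordField (K 0) e (h z) := by
    intro z hz hzs
    have h1 : HasDerivAt (fun s' : ℝ => (s', z.2)) ((1 : ℝ), (0 : ℝ)) z.1 :=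
      (hasDerivAt_id z.1).prodMk (hasDerivAt_const z.1 z.2)
    have h2 : HasDerivAt (fun s' => e (Φ (s', γ z.2))) (fderiv ℝ h z (1, 0)) z.1 :=
      HasFDerivAt.comp_hasDerivAt z.1 (l := h) (f := fun s' : ℝ => (s', z.2)) hz.hasFDerivAt h1
    have h3 := hflow (γ z.2) z.1
    have h4 := hasDerivAt_chart_comp he (γ := fun s' => Φ (s', γ z.2)) h3.mdifferentiableAt hzs
    rw [h2.unique h4, velocity, h3.mfderiv]
    exact Eq.trans (congrArg (chartDiff e _) (one_smul ℝ (K 0 (Φ (z.1, γ z.2)))))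
      (coordField_apply (K 0) hzs).symm
  have hpartial' : ∀ s' : ℝ, DifferentiableAt ℝ h (s', t) → Φ (s', γ t) ∈ e.source →
      fderiv ℝ h (s', t) (0, 1)
        = chartDiff e (Φ (s', γ t)) (velocity (fun t' => Φ (s', γ t')) t) := by
    intro s' hz hzs
    have h1 : HasDerivAt (fun t' : ℝ => (s', t')) ((0 : ℝ), (1 : ℝ)) t :=
      (hasDerivAt_const t s').prodMk (hasDerivAt_id t)
    have h2 : HasDerivAt (fun t' => e (Φ (s', γ t'))) (fderiv ℝ h (s', t) (0, 1)) t :=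
      HasFDerivAt.comp_hasDerivAt t (l := h) (f := fun t' : ℝ => (s', t')) hz.hasFDerivAt h1
    exact h2.unique (hasDerivAt_chart_comp he (γ := fun t' => Φ (s', γ t'))
      ((contMDiffAt_translate hΦ hγt s').mdifferentiableAt (by simp)) hzs)
  have hx := e.map_source hps
  have hw := hasDerivAt_variation hh (Y := coordField (K 0) e) (hC.differentiableAt_field hx 0)
    (by filter_upwards [hdiff, hsrc] with z h1 h2 using hpartial z h1 h2)
  have hc : HasDerivAt (fun s' => h (s', t)) (coordField (K 0) e (h (s, t))) s := by
    rw [← hpartial (s, t) hdiff.self_of_nhds hps]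
    exact HasFDerivAt.comp_hasDerivAt s (l := h) (f := fun s' : ℝ => (s', t))
      hdiff.self_of_nhds.hasFDerivAt ((hasDerivAt_id s).prodMk (hasDerivAt_const s t))
  have key := hC.hasDerivAt_products (c := fun s' => h (s', t))
    (w := fun s' => fderiv ℝ h (s', t) (0, 1)) hx hc hw
  have hslice : Filter.Tendsto (fun s' : ℝ => (s', t)) (𝓝 s) (𝓝 (s, t)) :=
    (Continuous.prodMk_left t).tendsto s
  have hev := (hslice.eventually hdiff).and (hslice.eventually hsrc)
  constructor
  · refine key.1.congr_of_eventuallyEq ?_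
    filter_upwards [hev] with s' hs'
    rw [inner_eq_coordMetric g he hs'.2, ← hpartial' s' hs'.1 hs'.2]
  · intro α
    refine (key.2 α).congr_of_eventuallyEq ?_
    filter_upwards [hev] with s' hs'
    rw [inner_eq_coordMetric g he hs'.2, ← hpartial' s' hs'.1 hs'.2, ← coordField_apply _ hs'.2]

/-- Time translations are isometries and preserve the Killing fields, so they do not change the
scalar products of the velocity of a curve with itself and with the Killing fields. -/
theorem inner_translate (hK : IsStationaryAxisymmetric g K)
    (hΦ : ContMDiff (𝓘(ℝ, ℝ).prod (𝓡 m)) (𝓡 m) ∞ Φ)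
    (hflow : ∀ p, Φ (0, p) = p ∧ IsMIntegralCurve (fun s => Φ (s, p)) (K 0))
    (hγ : ∀ᶠ t' in 𝓝 t, ContMDiffAt 𝓘(ℝ, ℝ) (𝓡 m) ∞ γ t') (s : ℝ) :
    g.inner (Φ (s, γ t)) (velocity (fun t' => Φ (s, γ t')) t)
        (velocity (m := m) (fun t' => Φ (s, γ t')) t)
      = g.inner (γ t) (velocity γ t) (velocity (m := m) γ t) ∧
    ∀ α, g.inner (Φ (s, γ t)) (K α (Φ (s, γ t))) (velocity (fun t' => Φ (s, γ t')) t)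
      = g.inner (γ t) (K α (γ t)) (velocity γ t) := by
  have hd := hasDerivAt_inner_translate hK hΦ (fun p => (hflow p).2) hγ
  have h0 : (fun t' => Φ (0, γ t')) = γ := funext fun t' => (hflow _).1
  constructor
  · have h1 := is_const_of_deriv_eq_zero (fun s => (hd s).1.differentiableAt)
      (fun s => (hd s).1.deriv) s 0
    refine h1.trans ?_
    exact congrArg (fun c : ℝ → M => g.inner (c t) (velocity c t) (velocity (m := m) c t)) h0
  · intro α
    have h1 := is_const_of_deriv_eq_zero (fun s => ((hd s).2 α).differentiableAt)
      (fun s => ((hd s).2 α).deriv) s 0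
    refine h1.trans ?_
    exact congrArg (fun c : ℝ → M => g.inner (c t) (K α (c t)) (velocity c t)) h0

end Flow

/-! ### The set of touching times is closed -/

section Closedness

/-- Null vectors whose products with the two Killing fields are bounded are bounded: a null vector
orthogonal to both fields vanishes. -/
theorem CoordKilling.exists_norm_le_of_null {E : Type*} [NormedAddCommGroup E] [NormedSpace ℝ E]
    [FiniteDimensional ℝ E] {G : E → E →L[ℝ] E →L[ℝ] ℝ} {X : Fin 2 → E → E} {U : Set E}
    (h : CoordKilling G X U) {A : Set E} (hA : IsCompact A) (hAU : A ⊆ U) (b : ℝ) :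
    ∃ B : ℝ, ∀ x ∈ A, ∀ v, G x v v = 0 → (∀ α, |G x (X α x) v| ≤ b) → ‖v‖ ≤ B := by
  have hG : ContinuousOn (fun z : E × E => G z.1) (A ×ˢ Metric.sphere 0 1) :=
    (h.metric_smooth.continuousOn.mono hAU).comp continuousOn_fst fun z hz => hz.1
  have hX : ∀ α, ContinuousOn (fun z : E × E => X α z.1) (A ×ˢ Metric.sphere 0 1) := fun α =>
    ((h.field_smooth α).continuousOn.mono hAU).comp continuousOn_fst fun z hz => hz.1
  obtain ⟨δ, hδ, hmin⟩ := (hA.prod (isCompact_sphere (0 : E) 1)).exists_forall_le'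
    (f := fun z : E × E => |G z.1 z.2 z.2| + (|G z.1 (X 0 z.1) z.2| + |G z.1 (X 1 z.1) z.2|))
    (((hG.clm_apply continuousOn_snd).clm_apply continuousOn_snd).abs.add
      (((hG.clm_apply (hX 0)).clm_apply continuousOn_snd).abs.add
        ((hG.clm_apply (hX 1)).clm_apply continuousOn_snd).abs)) (a := 0) (by
      rintro ⟨x, w⟩ ⟨hx, hw⟩
      have hw0 : w ≠ 0 := by rintro rfl; simp at hw
      by_cases h0 : G x (X 0 x) w = 0
      · by_cases h1 : G x (X 1 x) w = 0
        · have := (h.lorentz x (hAU hx)).pos_of_orthogonal_plane (h.det_neg x (hAU hx)) h0 h1 hw0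
          have h2 : 0 < |G x w w| := abs_pos.2 this.ne'
          positivity
        · have h2 : 0 < |G x (X 1 x) w| := abs_pos.2 h1
          positivity
      · have h2 : 0 < |G x (X 0 x) w| := abs_pos.2 h0
        positivity)
  refine ⟨2 * b / δ, fun x hx v hv hb => ?_⟩
  have hb0 : 0 ≤ b := (abs_nonneg _).trans (hb 0)
  rcases eq_or_ne v 0 with rfl | hv0
  · rw [norm_zero]; positivity
  have hpos : 0 < ‖v‖ := norm_pos_iff.2 hv0
  have h1 := hmin (x, ‖v‖⁻¹ • v) ⟨hx, by simp [norm_smul, hpos.ne']⟩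
  simp only [map_smul, smul_apply, smul_eq_mul, hv, mul_zero, abs_zero, zero_add, abs_mul, abs_inv,
    abs_norm] at h1
  rw [le_div_iff₀ hδ]
  have h2 : ‖v‖ * δ ≤ |G x (X 0 x) v| + |G x (X 1 x) v| := by
    calc ‖v‖ * δ ≤ ‖v‖ * (‖v‖⁻¹ * |G x (X 0 x) v| + ‖v‖⁻¹ * |G x (X 1 x) v|) := by gcongr
      _ = _ := by field_simp
  linarith [hb 0, hb 1]

/-- A curve that starts well inside a coordinate ball and whose speed in the chart is small while it
is in the ball does not leave the ball. -/
theorem mem_chart_ball_of_speed_le {M E : Type*} [TopologicalSpace M] [T2Space M]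
    [NormedAddCommGroup E] [NormedSpace ℝ E] [FiniteDimensional ℝ E] {e : OpenPartialHomeomorph M E}
    {x₀ : E} {r β : ℝ} (hball : Metric.closedBall x₀ r ⊆ e.target) {c : ℝ → M}
    (hc : ∀ τ ∈ Set.Icc (0 : ℝ) 1, ContinuousAt c τ) (h0 : c 0 ∈ e.source) (hβ : 0 ≤ β)
    (hr : ‖e (c 0) - x₀‖ + β < r)
    (hspeed : ∀ τ ∈ Set.Icc (0 : ℝ) 1, c τ ∈ e.source → e (c τ) ∈ Metric.closedBall x₀ r →
      ∃ v, HasDerivAt (fun τ => e (c τ)) v τ ∧ ‖v‖ ≤ β) :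
    ∀ τ ∈ Set.Icc (0 : ℝ) 1, c τ ∈ e.source ∧ e (c τ) ∈ Metric.ball x₀ r := by
  set r₀ := ‖e (c 0) - x₀‖ with hr₀
  have hr0 : 0 ≤ r₀ := norm_nonneg _
  set W := e.symm '' Metric.closedBall x₀ r with hW
  have hWmem : ∀ p, p ∈ W ↔ p ∈ e.source ∧ e p ∈ Metric.closedBall x₀ r := by
    intro p
    constructor
    · rintro ⟨x, hx, rfl⟩
      exact ⟨e.map_target (hball hx), by rwa [e.right_inv (hball hx)]⟩
    · rintro ⟨hp, hx⟩
      exact ⟨e p, hx, e.left_inv hp⟩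
  have hWclosed : IsClosed W :=
    ((isCompact_closedBall x₀ r).image_of_continuousOn (e.continuousOn_symm.mono hball)).isClosed
  have hcont : ContinuousOn c (Set.Icc 0 1) := fun τ hτ => (hc τ hτ).continuousWithinAt
  have hcl := hcont.preimage_isClosed_of_isClosed isClosed_Icc hWclosed
  have hcont' : ContinuousOn (fun τ => ‖e (c τ) - x₀‖ - β * τ) (Set.Icc 0 1 ∩ c ⁻¹' W) := by
    have h1 : ContinuousOn (fun τ => e (c τ)) (Set.Icc 0 1 ∩ c ⁻¹' W) :=
      e.continuousOn.comp (hcont.mono Set.inter_subset_left) fun τ hτ => ((hWmem _).1 hτ.2).1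
    exact (h1.sub continuousOn_const).norm.sub (continuousOn_const.mul continuousOn_id)
  have key := IsClosed.Icc_subset_of_forall_mem_nhdsWithin (a := (0 : ℝ)) (b := 1)
    (s := {τ | c τ ∈ W ∧ ‖e (c τ) - x₀‖ ≤ r₀ + β * τ})
    (by
      convert hcont'.preimage_isClosed_of_isClosed hcl (isClosed_Iic (a := r₀)) using 1
      ext τ
      simp only [Set.mem_inter_iff, Set.mem_ofPred_eq, Set.mem_preimage, Set.mem_Iic]
      rw [sub_le_iff_le_add]
      tauto)
    (by
      refine ⟨(hWmem _).2 ⟨h0, ?_⟩, by simp [hr₀]⟩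
      rw [mem_closedBall_iff_norm]
      linarith)
    (by
      rintro x ⟨⟨hxW, hxr⟩, hx0, hx1⟩
      have hxI : x ∈ Set.Icc (0 : ℝ) 1 := ⟨hx0, hx1.le⟩
      have hxs := ((hWmem _).1 hxW).1
      have hxball : e (c x) ∈ Metric.ball x₀ r := by
        rw [mem_ball_iff_norm]
        nlinarith
      have hV : ∀ᶠ τ in 𝓝 x, c τ ∈ e.source ∩ e ⁻¹' Metric.ball x₀ r :=
        (hc x hxI).eventually_mem ((e.isOpen_inter_preimage Metric.isOpen_ball).mem_nhds
          ⟨hxs, hxball⟩)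
      obtain ⟨ε, hε, hVε⟩ := Metric.eventually_nhds_iff.1 hV
      have hlt : x < min (x + ε) 1 := lt_min (by linarith) hx1
      filter_upwards [Ioo_mem_nhdsGT hlt] with τ hτ
      have hτ1 : τ < 1 := hτ.2.trans_le (min_le_right _ _)
      have hτε : τ < x + ε := hτ.2.trans_le (min_le_left _ _)
      have hin : ∀ τ' ∈ Set.Icc x τ, τ' ∈ Set.Icc (0 : ℝ) 1 ∧
          c τ' ∈ e.source ∩ e ⁻¹' Metric.ball x₀ r := fun τ' hτ' =>
        ⟨⟨hx0.trans hτ'.1, hτ'.2.trans hτ1.le⟩, hVε (by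
          rw [Real.dist_eq, abs_of_nonneg (by linarith [hτ'.1])]; linarith [hτ'.2])⟩
      have hv : ∀ τ' ∈ Set.Icc x τ, ∃ v, HasDerivAt (fun τ => e (c τ)) v τ' ∧ ‖v‖ ≤ β :=
        fun τ' hτ' => hspeed τ' (hin τ' hτ').1 (hin τ' hτ').2.1
          (Metric.ball_subset_closedBall (hin τ' hτ').2.2)
      choose! v hv using hv
      have hmv := (convex_Icc x τ).norm_image_sub_le_of_norm_hasDerivWithin_le
        (f := fun τ => e (c τ)) (f' := v) (C := β)
        (fun τ' hτ' => (hv τ' hτ').1.hasDerivWithinAt) (fun τ' hτ' => (hv τ' hτ').2)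
        (Set.left_mem_Icc.2 hτ.1.le) (Set.right_mem_Icc.2 hτ.1.le)
      have hτin := hin τ (Set.right_mem_Icc.2 hτ.1.le)
      refine ⟨(hWmem _).2 ⟨hτin.2.1, Metric.ball_subset_closedBall hτin.2.2⟩, ?_⟩
      rw [Real.norm_eq_abs, abs_of_pos (sub_pos.2 hτ.1)] at hmv
      have h2 : e (c τ) - x₀ = (e (c τ) - e (c x)) + (e (c x) - x₀) := by abel
      calc ‖e (c τ) - x₀‖ ≤ ‖e (c τ) - e (c x)‖ + ‖e (c x) - x₀‖ := by
            rw [h2]; exact norm_add_le _ _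
        _ ≤ β * (τ - x) + (r₀ + β * x) := add_le_add hmv hxr
        _ = r₀ + β * τ := by ring)
  intro τ hτ
  obtain ⟨h1, h2⟩ := key hτ
  refine ⟨((hWmem _).1 h1).1, ?_⟩
  rw [mem_ball_iff_norm]
  nlinarith [hτ.2]

variable {m n : ℕ} [NeZero n]
  {M : Type*} [TopologicalSpace M] [ChartedSpace (EuclideanSpace ℝ (Fin m)) M]
  {S : Type*} [TopologicalSpace S] [ChartedSpace (EuclideanHalfSpace n) S]
  {F : Type} [NormedAddCommGroup F] [NormedSpace ℝ F]
  {ι : S → M} {γ : ℝ → M} {t : ℝ}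
  {φ : OpenPartialHomeomorph S (EuclideanHalfSpace n)}
  {e : OpenPartialHomeomorph M (EuclideanSpace ℝ (Fin m))}
  {L : (EuclideanSpace ℝ (Fin n) × F) ≃L[ℝ] EuclideanSpace ℝ (Fin m)}

/-- In a small coordinate ball the submanifold is exactly the half slice `z = 0`, `0 ≤ y 0`. -/
theorem IsAdaptedChart.exists_slice_ball (h : IsAdaptedChart ι φ e L)
    (hι : Manifold.IsSmoothEmbedding (𝓡∂ n) (𝓡 m) ∞ ι) {q : S} (hq : q ∈ φ.source) :
    ∃ r > 0, Metric.closedBall (e (ι q)) r ⊆ e.target ∧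
      ∀ p ∈ e.source, e p ∈ Metric.closedBall (e (ι q)) r →
        (p ∈ Set.range ι → p ∈ ι '' φ.source ∧ (L.symm (e p)).2 = 0 ∧ 0 ≤ (L.symm (e p)).1 0) ∧
        ((L.symm (e p)).2 = 0 → 0 ≤ (L.symm (e p)).1 0 → p ∈ Set.range ι) := by
  have hp := h.maps q hq
  have hx := e.map_source hp
  obtain ⟨V, hV, hVφ⟩ := hι.isEmbedding.isInducing.isOpen_iff.1 φ.open_source
  have hqV : ι q ∈ V := by
    have : q ∈ ι ⁻¹' V := hVφ ▸ hq
    exact this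
  have h1 : ∀ᶠ x in 𝓝 (e (ι q)), e.symm x ∈ V := by
    refine (e.continuousAt_symm hx).eventually_mem ?_
    rw [e.left_inv hp]
    exact hV.mem_nhds hqV
  have hy₀ : (L.symm (e (ι q))).1 = φ.extend (𝓡∂ n) q := by rw [h.apply_eq q hq]; simp
  have h2 : ∀ᶠ x in 𝓝 (e (ι q)), 0 ≤ (L.symm x).1 0 →
      (L.symm x).1 ∈ (φ.extend (𝓡∂ n)).target := by
    have h3 := extend_target_mem_nhdsWithin_halfSpace φ hq
    rw [mem_nhdsWithin_iff_eventually, ← hy₀] at h3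
    exact (continuous_fst.comp L.symm.continuous).continuousAt.eventually h3
  obtain ⟨r, hr, hball⟩ := Metric.nhds_basis_closedBall.eventually_iff.1
    ((e.open_target.eventually_mem hx).and (h1.and h2))
  refine ⟨r, hr, fun x hx => (hball hx).1, fun p hpe hpr => ⟨?_, fun hz hy => ?_⟩⟩
  · rintro ⟨q', rfl⟩
    have hq' : q' ∈ φ.source := by
      rw [← hVφ]
      have := (hball hpr).2.1
      rwa [e.left_inv hpe] at this
    refine ⟨⟨q', hq', rfl⟩, ?_⟩
    have hR : φ.extend (𝓡∂ n) q' ∈ Set.range (𝓡∂ n) := φ.extend_target_subset_range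
      ((φ.extend (𝓡∂ n)).map_source (by rwa [φ.extend_source]))
    rw [range_modelWithCornersEuclideanHalfSpace] at hR
    rw [h.apply_eq q' hq', L.symm_apply_apply]
    exact ⟨rfl, hR⟩
  · have hy' := (hball hpr).2.2 hy
    refine ⟨(φ.extend (𝓡∂ n)).symm (L.symm (e p)).1, ?_⟩
    refine e.injOn (h.maps _ (extend_symm_mem_source φ hy')) hpe ?_
    rw [h.apply_symm_eq hy', ← hz]
    simp

theorem continuousAt_deriv_chart_comp (he : e ∈ IsManifold.maximalAtlas (𝓡 m) ∞ M)
    (hγ : ContMDiffAt 𝓘(ℝ, ℝ) (𝓡 m) ∞ γ t) (ht : γ t ∈ e.source) :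
    ContinuousAt (deriv fun s => e (γ s)) t := by
  have h1 := (contMDiffOn_of_mem_maximalAtlas he).contMDiffAt (e.open_source.mem_nhds ht)
  have h2 : ContDiffAt ℝ ∞ (fun s => e (γ s)) t := (h1.comp t hγ).contDiffAt
  exact (h2.derivWithin (m := 0) (by simp)).continuousAt

variable [IsManifold (𝓡 m) ∞ M] {g : LorentzMetric m M} {K : Fin 2 → VField m M} {ρ : ℝ}
  {C : Set M} {J : Set ℝ}

theorem continuousAt_inner_velocity (hK : IsStationaryAxisymmetric g K)
    (hJ : IsOpen J) (hγ : ∀ t ∈ J, ContMDiffAt 𝓘(ℝ, ℝ) (𝓡 m) ∞ γ t) (ht : t ∈ J) (α : Fin 2) :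
    ContinuousAt (fun t => g.inner (γ t) (K α (γ t)) (velocity γ t)) t := by
  set e := chartAt (EuclideanSpace ℝ (Fin m)) (γ t) with hedef
  have he : e ∈ IsManifold.maximalAtlas (𝓡 m) ∞ M :=
    IsManifold.chart_mem_maximalAtlas (I := 𝓡 m) (n := ∞) _
  have hp : γ t ∈ e.source := mem_chart_source _ _
  have hC := hK.coordKilling (g := g) he
  have hx := e.map_source hp
  have hcont : ContinuousAt (fun s => e (γ s)) t :=
    (e.continuousAt hp).comp (hγ t ht).continuousAt
  have h1 : ContinuousAt (fun s => coordMetric g e (e (γ s))) t :=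
    ContinuousAt.comp (f := fun s => e (γ s)) (hC.contDiffAt_metric hx).continuousAt hcont
  have h2 : ContinuousAt (fun s => coordField (K α) e (e (γ s))) t :=
    ContinuousAt.comp (f := fun s => e (γ s)) (hC.contDiffAt_field hx α).continuousAt hcont
  refine ((h1.clm_apply h2).clm_apply
    (continuousAt_deriv_chart_comp he (hγ t ht) hp)).congr ?_
  filter_upwards [hJ.eventually_mem ht,
    (hγ t ht).continuousAt.eventually_mem (e.open_source.mem_nhds hp)] with s hs hs'
  rw [(hasDerivAt_chart_comp he ((hγ s hs).mdifferentiableAt (by simp)) hs').deriv,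
    coordField_apply _ hs', ← inner_eq_coordMetric g he hs']

end Closedness

section Closure

variable {m n : ℕ} [NeZero n]
  {M : Type*} [TopologicalSpace M] [T2Space M] [ChartedSpace (EuclideanSpace ℝ (Fin m)) M]
  [IsManifold (𝓡 m) ∞ M]
  {S : Type*} [TopologicalSpace S] [ChartedSpace (EuclideanHalfSpace n) S]
  {ι : S → M} {γ : ℝ → M} {g : LorentzMetric m M} {K : Fin 2 → VField m M} {ρ : ℝ}
  {J : Set ℝ} {t₁ : ℝ}

/-- Limits of touching times are times at which the geodesic is on the submanifold. Time translations
move the points `γ t` to the compact section; near a cluster point `q` of the translated points, a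
translated geodesic has bounded speed in a chart, and so it stays in the chart until time `t₁`, where
the submanifold is closed. -/
theorem mem_range_of_mem_closure (hK : IsStationaryAxisymmetric g K)
    (hι : Manifold.IsSmoothEmbedding (𝓡∂ n) (𝓡 m) ∞ ι) (hS : HasCompactSpatialSection g K ι)
    (hJ : IsOpen J) (hγ : ∀ t ∈ J, ContMDiffAt 𝓘(ℝ, ℝ) (𝓡 m) ∞ γ t)
    (hnull : ∀ t ∈ J, g.inner (γ t) (velocity γ t) (velocity (m := m) γ t) = 0)
    (ht₁ : t₁ ∈ J) (hcl : t₁ ∈ closure {t ∈ J | γ t ∈ Set.range ι}) : γ t₁ ∈ Set.range ι := by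
  obtain ⟨A, -, hQ, horbit⟩ := hS
  obtain ⟨Φ, hΦ, hflow⟩ := hK.complete
  set T := {t ∈ J | γ t ∈ Set.range ι} with hT
  have hinv : ∀ p ∈ Set.range ι, (∀ s, Φ (s, p) ∈ Set.range ι) ∧ ∃ s, Φ (s, p) ∈ A := fun p hp =>
    horbit (fun s => Φ (s, p)) (hflow p).2 (by rw [(hflow p).1]; exact hp)
  have hσ : ∀ t ∈ T, ∃ s, Φ (s, γ t) ∈ A := fun t ht => (hinv _ ht.2).2
  choose! σ hσ using hσ
  have hne : (𝓝[T] t₁).NeBot := mem_closure_iff_nhdsWithin_neBot.1 hcl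
  obtain ⟨p₀, ⟨⟨q, rfl⟩, -⟩, hq⟩ := hQ.exists_mapClusterPt (f := 𝓝[T] t₁)
    (u := fun t => Φ (σ t, γ t)) (Filter.tendsto_principal.2 (by
      filter_upwards [self_mem_nhdsWithin] with t ht
      exact ⟨(hinv _ ht.2).1 _, hσ t ht⟩))
  obtain ⟨F, _, _, φ, e, L, hqφ, h⟩ := exists_isAdaptedChart hι q
  have he := h.cod
  have hp := h.maps q hqφ
  have hC := hK.coordKilling (g := g) he
  obtain ⟨r, hr, hball, hslice⟩ := h.exists_slice_ball hι hqφ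
  set x₀ := e (ι q) with hx₀
  -- Bounds for the momenta `⟨K_α, γ'⟩` near `t₁` and for the speed of the translated geodesics.
  set P : Fin 2 → ℝ → ℝ := fun α t => g.inner (γ t) (K α (γ t)) (velocity γ t) with hP
  have hPb : ∀ α, ∀ᶠ t in 𝓝 t₁, |P α t| < |P α t₁| + 1 := fun α =>
    (continuousAt_inner_velocity hK hJ hγ ht₁ α).abs.eventually_lt continuousAt_const
      (lt_add_one _)
  have hPmax : ∀ α, |P α t₁| + 1 ≤ max (|P 0 t₁| + 1) (|P 1 t₁| + 1) := by
    intro α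
    fin_cases α
    · exact le_max_left _ _
    · exact le_max_right _ _
  obtain ⟨B, hB⟩ := hC.exists_norm_le_of_null (isCompact_closedBall x₀ r) hball
    (max (|P 0 t₁| + 1) (|P 1 t₁| + 1))
  obtain ⟨δ, hδ, hδb⟩ := Metric.eventually_nhds_iff_ball.1
    ((hJ.eventually_mem ht₁).and ((hPb 0).and (hPb 1)))
  have hδP : ∀ t ∈ Metric.ball t₁ δ, ∀ α, |P α t| ≤ max (|P 0 t₁| + 1) (|P 1 t₁| + 1) := by
    intro t ht α
    refine le_trans ?_ (hPmax α)
    fin_cases α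
    · exact (hδb t ht).2.1.le
    · exact (hδb t ht).2.2.le
  have hV : e.source ∩ e ⁻¹' Metric.ball x₀ (r / 2) ∈ 𝓝 (ι q) :=
    (e.isOpen_inter_preimage Metric.isOpen_ball).mem_nhds ⟨hp, by simp [hx₀, hr]⟩
  have hnear : ∀ᶠ t in 𝓝[T] t₁, t ∈ T ∧ t ∈ Metric.ball t₁ δ ∧ max B 0 * |t₁ - t| < r / 2 := by
    refine Filter.Eventually.and self_mem_nhdsWithin
      (eventually_nhdsWithin_of_eventually_nhds (Filter.Eventually.and (Metric.ball_mem_nhds t₁ hδ) ?_))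
    have : ContinuousAt (fun t => max B 0 * |t₁ - t|) t₁ := by fun_prop
    exact this.eventually_lt continuousAt_const (by simpa using hr)
  obtain ⟨t, htV, htT, htδ, htB⟩ :=
    ((mapClusterPt_iff_frequently.1 hq _ hV).and_eventually hnear).exists
  set s := σ t with hs
  let c : ℝ → M := fun t' => Φ (s, γ t')
  have hcsmooth : ∀ t' ∈ J, ContMDiffAt 𝓘(ℝ, ℝ) (𝓡 m) ∞ c t' := fun t' ht' =>
    contMDiffAt_translate hΦ (hγ t' ht') s
  have hspeed : ∀ t' ∈ Metric.ball t₁ δ, c t' ∈ e.source → e (c t') ∈ Metric.closedBall x₀ r →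
      ∃ v, HasDerivAt (fun t => e (c t)) v t' ∧ ‖v‖ ≤ B := by
    intro t' ht' hsrc hmem
    have hJt' := (hδb t' ht').1
    have hpres := inner_translate hK hΦ hflow
      (by filter_upwards [hJ.eventually_mem hJt'] with τ hτ using hγ τ hτ) s
    refine ⟨_, hasDerivAt_chart_comp he ((hcsmooth t' hJt').mdifferentiableAt (by simp)) hsrc,
      hB _ hmem _ ?_ fun α => ?_⟩
    · rw [← inner_eq_coordMetric g he hsrc]
      exact hpres.1.trans (hnull t' hJt')
    · rw [coordField_apply _ hsrc, ← inner_eq_coordMetric g he hsrc, hpres.2 α]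
      exact hδP t' ht' α
  -- The translated geodesic between the times `t` and `t₁`, parametrized by `[0, 1]`.
  let θ : ℝ → ℝ := fun τ => t + τ * (t₁ - t)
  have hθ : ∀ τ, HasDerivAt θ (t₁ - t) τ := fun τ =>
    (((hasDerivAt_id τ).mul_const (t₁ - t)).const_add t).congr_deriv (one_mul _)
  have hθδ : ∀ τ ∈ Set.Icc (0 : ℝ) 1, θ τ ∈ Metric.ball t₁ δ := by
    intro τ hτ
    have h1 := (convex_ball t₁ δ).add_smul_sub_mem htδ (Metric.mem_ball_self hδ) hτ
    exact h1
  have htrap := mem_chart_ball_of_speed_le (e := e) (x₀ := x₀) (r := r)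
    (β := max B 0 * |t₁ - t|) hball (c := fun τ => c (θ τ))
    (fun τ hτ => ContinuousAt.comp (f := θ) (hcsmooth _ (hδb _ (hθδ τ hτ)).1).continuousAt
      (hθ τ).continuousAt)
    (by simpa [θ] using htV.1) (by positivity)
    (by
      have h1 : ‖e (c t) - x₀‖ < r / 2 := by
        rw [← mem_ball_iff_norm]; exact htV.2
      have h2 : θ 0 = t := by simp [θ]
      rw [h2]
      linarith)
    (by
      intro τ hτ hsrc hmem
      obtain ⟨v, hv, hvB⟩ := hspeed _ (hθδ τ hτ) hsrc hmem
      refine ⟨(t₁ - t) • v, HasDerivAt.scomp (g₁ := fun t => e (c t)) (h := θ) τ hv (hθ τ), ?_⟩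
      rw [norm_smul, Real.norm_eq_abs, mul_comm]
      exact mul_le_mul_of_nonneg_right (hvB.trans (le_max_left _ _)) (abs_nonneg _))
  have hend := htrap 1 (Set.right_mem_Icc.2 zero_le_one)
  have hθ1 : θ 1 = t₁ := by simp [θ]
  simp only [hθ1] at hend
  -- The submanifold is closed in the coordinate ball.
  have hcont := (hcsmooth t₁ ht₁).continuousAt
  have hclosed : IsClosed {x : EuclideanSpace ℝ (Fin m) |
      (L.symm x).2 = 0 ∧ 0 ≤ (L.symm x).1 0} := by
    have hz : IsClosed {x : EuclideanSpace ℝ (Fin m) | (L.symm x).2 = 0} :=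
      isClosed_eq (continuous_snd.comp L.symm.continuous) continuous_const
    have hy : IsClosed {x : EuclideanSpace ℝ (Fin m) | 0 ≤ (L.symm x).1 0} :=
      isClosed_le continuous_const ((EuclideanSpace.proj (𝕜 := ℝ) (0 : Fin n)).continuous.comp
        (continuous_fst.comp L.symm.continuous))
    exact hz.inter hy
  have hev : ∀ᶠ t' in 𝓝 t₁, c t' ∈ e.source ∩ e ⁻¹' Metric.ball x₀ r :=
    hcont.eventually_mem ((e.isOpen_inter_preimage Metric.isOpen_ball).mem_nhds hend)
  have hlim := hclosed.mem_of_frequently_of_tendsto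
    (((mem_closure_iff_frequently.1 hcl).and_eventually hev).mono fun t' ht' =>
      ((hslice (c t') ht'.2.1 (Metric.ball_subset_closedBall ht'.2.2)).1
        ((hinv _ ht'.1.2).1 s)).2)
    ((e.continuousAt hend.1).comp hcont)
  have hmem : c t₁ ∈ Set.range ι :=
    (hslice (c t₁) hend.1 (Metric.ball_subset_closedBall hend.2)).2 hlim.1 hlim.2
  -- Translating back.
  have hback := (horbit ((fun s' => Φ (s', γ t₁)) ∘ (· + s)) ((hflow (γ t₁)).2.comp_add s)
    (by simpa using hmem)).1 (-s)
  simpa [(hflow (γ t₁)).1] using hback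

theorem touchesAt_of_mem_closure (hK : IsStationaryAxisymmetric g K)
    (hι : Manifold.IsSmoothEmbedding (𝓡∂ n) (𝓡 m) ∞ ι) (hS : HasCompactSpatialSection g K ι)
    (hJ : IsOpen J) (hγ : ∀ t ∈ J, ContMDiffAt 𝓘(ℝ, ℝ) (𝓡 m) ∞ γ t)
    (hnull : ∀ t ∈ J, g.inner (γ t) (velocity γ t) (velocity (m := m) γ t) = 0)
    (ht₁ : t₁ ∈ J) (hcl : t₁ ∈ closure {t ∈ J | TouchesAt m n ι γ t}) :
    TouchesAt m n ι γ t₁ := by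
  have hsub : {t ∈ J | TouchesAt m n ι γ t} ⊆ {t ∈ J | γ t ∈ Set.range ι} :=
    fun t ht => ⟨ht.1, ht.2.mem_range⟩
  obtain ⟨q, hq⟩ := mem_range_of_mem_closure hK hι hS hJ hγ hnull ht₁ (closure_mono hsub hcl)
  obtain ⟨F, _, _, φ, e, L, hqφ, h⟩ := exists_isAdaptedChart hι q
  obtain ⟨r, hr, hball, hslice⟩ := h.exists_slice_ball hι hqφ
  have hp : γ t₁ ∈ e.source := hq ▸ h.maps q hqφ
  have hev : ∀ᶠ t in 𝓝 t₁, γ t ∈ e.source ∩ e ⁻¹' Metric.ball (e (ι q)) r :=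
    (hγ t₁ ht₁).continuousAt.eventually_mem
      ((e.isOpen_inter_preimage Metric.isOpen_ball).mem_nhds ⟨hp, by simp [hq, hr]⟩)
  rw [h.touchesAt_iff hι hqφ hq ((hγ t₁ ht₁).mdifferentiableAt (by simp))]
  have hclosed : IsClosed {v : EuclideanSpace ℝ (Fin m) | (L.symm v).2 = 0} :=
    isClosed_eq (continuous_snd.comp L.symm.continuous) continuous_const
  refine hclosed.mem_of_frequently_of_tendsto
    (((mem_closure_iff_frequently.1 hcl).and_eventually hev).mono fun t ht => ?_)
    (continuousAt_deriv_chart_comp h.cod (hγ t₁ ht₁) hp)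
  obtain ⟨⟨q', hq', hqt⟩, -⟩ := (hslice (γ t) ht.2.1 (Metric.ball_subset_closedBall ht.2.2)).1
    ht.1.2.mem_range
  exact (h.touchesAt_iff hι hq' hqt ((hγ t ht.1.1).mdifferentiableAt (by simp))).1 ht.1.2

end Closure

end PhotonSubmanifold

end

open PhotonSubmanifold in
theorem proposition5 {m n : ℕ} [NeZero n]
    {M : Type*} [TopologicalSpace M] [T2Space M]
    [ChartedSpace (EuclideanSpace ℝ (Fin m)) M] [IsManifold (𝓡 m) ∞ M]
    {S : Type*} [TopologicalSpace S]
    [ChartedSpace (EuclideanHalfSpace n) S] [IsManifold (𝓡∂ n) ∞ S]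
    (g : LorentzMetric m M) (K : Fin 2 → VField m M)
    (hK : IsStationaryAxisymmetric g K)
    (ρ : ℝ) (hρ : IsRegularParameter g K ρ)
    (C : Set M) (hC : IsCausalRegion g K ρ C)
    (ι : S → M) (hS : IsFundamentalPhotonSubmanifold (n := n) g K ι ρ C)
    (J : Set ℝ) (hJ : IsOpen J) (hJc : J.OrdConnected)
    (γ : ℝ → M) (hγ : IsNullGeodesicWithImpact g K ρ γ J)
    (htouch : ∃ t ∈ J, TouchesAt m n ι γ t) :
    ∀ t ∈ J, γ t ∈ Set.range ι := by
  have hopen : IsOpen {t ∈ J | TouchesAt m n ι γ t} := by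
    refine isOpen_iff_mem_nhds.2 fun t ht => ?_
    exact (hJ.eventually_mem ht.1).and (eventually_touchesAt hK hρ hC hS hJ hγ ht.1 ht.2)
  have hsub : J ⊆ {t ∈ J | TouchesAt m n ι γ t} := by
    obtain ⟨t₀, ht₀, ht₀'⟩ := htouch
    refine hJc.isPreconnected.subset_of_closure_inter_subset hopen ⟨t₀, ht₀, ht₀, ht₀'⟩ ?_
    rintro t ⟨hcl, ht⟩
    exact ⟨ht, touchesAt_of_mem_closure hK hS.embedding hS.compact_section hJ
      (fun t ht => hγ.contMDiffAt hJ ht) hγ.null ht hcl⟩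
  exact fun t ht => (hsub ht).2.mem_range
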